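/- **Setting.** Let $d\ge 1$ and let $\Omega\subset\mathbb R^d$ be a bounded connected open set with Lipschitz boundary. For a measurable set $S$ write $\|v\|_S=(\int_S|v|^2)^{1/2}$ and $\|v\|=\|v\|_\Omega$; $(v,w)_S=\int_S v\cdot w$ and $|S|$ is the Lebesgue measure (the $(d-1)$-dimensional measure if $S$ is a face). $H^1_0(\Omega)$ is the closure of $C_c^\infty(\Omega)$ in $H^1(\Omega)$, and $H(\mathrm{div},\Omega)$ is the space of the fields in $[L^2(\Omega)]^d$ with a weak divergence in $L^2(\Omega)$. Let $f\in L^2(\Omega)$, let $p\in H^1_0(\Omega)$ be the weak solution of $-\Delta p=f$ with homogeneous Dirichlet data, $$(\nabla p,\nabla v)_\Omega=(f,v)_\Omega\qquad\forall v\in H^1_0(\Omega),$$ and let $u=-\nabla p$. **Mesh.** Let $\mathcal T_h$ be a finite collection of closed $d$-simplices with $\bigcup_{K\in\mathcal T_h}K=\overline\Omega$ such that the intersection of two different simplices is empty or an entire common face of dimension at most $d-1$. Below, a face is a $(d-1)$-dimensional face; $\mathcal F_K$ is the set of the $d+1$ faces of $K$. A face is interior if it is shared by two different $K,L\in\mathcal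 T_h$, written $\sigma_{K,L}$, and a boundary face if it lies in $\partial\Omega$. The mesh is admissible: there are points $x_K$, $K\in\mathcal T_h$, and, for each boundary face $\sigma\in\mathcal F_K$, a point $x_{K,\sigma}$ in the relative interior of $\sigma$, all these points being distinct, such that the line through $x_K$ and $x_L$ is orthogonal to $\sigma_{K,L}$ for each interior face, and the line through $x_K$ and $x_{K,\sigma}$ is orthogonal to $\sigma$ for each boundary face. Let $d_{K,L}=|x_K-x_L|$ if $x_L-x_K$ points from $K$ towards $L$ and $d_{K,L}=-|x_K-x_L|$ otherwise; let $d_{K,\sigma}=|x_K-x_{K,\sigma}|$ if $x_{K,\sigma}-x_K$ points out of $K$ across $\sigma$ and $d_{K,\sigma}=-|x_K-x_{K,\sigma}|$ otherwise. **Finite volume scheme.** Let the real numbers $p_K$, $K\in\mathcal T_h$, satisfy $$\sum_{\sigma\in\mathcal F_K}U_{K,\sigma}=(f,1)_K\quad\forall K\in\mathcal T_h,\qquad U_{K,\sigma}=-\frac{|\sigma_{K,L}|}{d_{K,L}}(p_L-p_K)\ \text{ if } \sigma=\sigma_{K,L},\qquad U_{K,\sigma}=-\frac{|\sigma|}{d_{K,\sigma}}(0-p_K)\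 \text{ if }\sigma\subset\partial\Omega .$$ **Reconstructions.** * Flux: on each $K\in\mathcal T_h$, $u_h(x)=\sum_{\sigma\in\mathcal F_K}U_{K,\sigma}\,\frac{1}{d\,|K|}\,(x-a_{K,\sigma})$, where $a_{K,\sigma}$ is the vertex of $K$ opposite to $\sigma$; this is the field in the lowest-order Raviart–Thomas space $RT_0(K)=\{c+b\,x:\ c\in\mathbb R^d,\ b\in\mathbb R\}$ with outward flux $U_{K,\sigma}$ through each face $\sigma\in\mathcal F_K$. * Postprocessed potential: on each $K\in\mathcal T_h$, $\tilde p_h|_K$ is the polynomial of total degree at most $2$ with $-\nabla\tilde p_h|_K=u_h|_K$ and mean value $(\tilde p_h,1)_K/|K|=p_K$. * Averaged potential: $s_h$ is the continuous function on $\overline\Omega$ that is a polynomial of total degree at most $2$ on each $K\in\mathcal T_h$ and takes the following values at the Lagrange nodes (all vertices and edge midpoints of the mesh elements): $s_h(x)=\frac1{|\mathcal T_x|}\sum_{K\in\mathcal T_x}\tilde p_h|_K(x)$ at the nodes $x\in\Omega$, where $\mathcal T_x$ is the set of the elements that contain $x$ and $|\mathcal T_x|$ is its cardinality, and $s_h(x)=0$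 at the nodes $x\in\partial\Omega$. **Theorem (guaranteed a posteriori error estimate).** Then $u_h\in H(\mathrm{div},\Omega)$, $s_h\in H^1_0(\Omega)$, and $$\|u-u_h\|\le\Big\{\sum_{K\in\mathcal T_h}\eta_K^2\Big\}^{1/2},\qquad \eta_K^2=\|u_h+\nabla s_h\|_K^2+\frac{h_K^2}{\pi^2}\Big\|f-\frac{(f,1)_K}{|K|}\Big\|_K^2,$$ where $h_K$ is the diameter of $K$. -/

import Mathlib

open MeasureTheory
open scoped ContDiff

noncomputable section

namespace FVPoisson

/-- The space `ℝᵈ` with its Euclidean norm. -/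
abbrev E (d : ℕ) : Type := EuclideanSpace ℝ (Fin d)

section Sobolev

variable {d : ℕ}

/-- The `L²(S)` norm of a scalar- or vector-valued function. -/
def l2Norm {F : Type*} [NormedAddCommGroup F] (S : Set (E d)) (v : E d → F) : ℝ :=
  Real.sqrt (∫ x in S, ‖v x‖ ^ 2)

/-- A bounded connected open set with Lipschitz boundary: near each boundary point, after a choice
of a direction `e`, the set is the strict epigraph of a Lipschitz function of the component
orthogonal to `e`. -/
structure IsLipschitzDomain (Ω : Set (E d)) : Prop where
  isOpen : IsOpen Ω
  isBounded : Bornology.IsBounded Ω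
  isConnected : IsConnected Ω
  lipschitz_boundary : ∀ x ∈ frontier Ω, ∃ (e : E d) (r : ℝ) (C : NNReal) (g : E d → ℝ),
    ‖e‖ = 1 ∧ 0 < r ∧ LipschitzWith C g ∧
      ∀ y ∈ Metric.ball x r, (y ∈ Ω ↔ g (y - inner ℝ e y • e) < inner ℝ e y)

/-- Smooth functions with compact support in `Ω`. -/
def IsTestFunction (Ω : Set (E d)) (φ : E d → ℝ) : Prop :=
  ContDiff ℝ ∞ φ ∧ HasCompactSupport φ ∧ tsupport φ ⊆ Ω

/-- `G` is the weak gradient of `v` on `Ω`; both are square integrable. -/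
def HasWeakGradient (Ω : Set (E d)) (v : E d → ℝ) (G : E d → E d) : Prop :=
  MemLp v 2 (volume.restrict Ω) ∧ MemLp G 2 (volume.restrict Ω) ∧
    ∀ (i : Fin d) (φ : E d → ℝ), IsTestFunction Ω φ →
      ∫ x in Ω, v x * gradient φ x i = -∫ x in Ω, G x i * φ x

open Classical in
/-- The weak gradient on `Ω` (a representative of it), and `0` if there is none. -/
def weakGrad (Ω : Set (E d)) (v : E d → ℝ) : E d → E d :=
  if h : ∃ G, HasWeakGradient Ω v G then h.choose else 0

/-- `v` belongs to `H¹₀(Ω)`, the closure of the test functions in `H¹(Ω)`. -/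
def MemH10 (Ω : Set (E d)) (v : E d → ℝ) : Prop :=
  ∃ G, HasWeakGradient Ω v G ∧
    ∀ ε : ℝ, 0 < ε → ∃ φ : E d → ℝ, IsTestFunction Ω φ ∧
      l2Norm Ω (fun x => v x - φ x) < ε ∧ l2Norm Ω (fun x => G x - gradient φ x) < ε

/-- `w` is the weak divergence of `v` on `Ω`; both are square integrable. -/
def HasWeakDivergence (Ω : Set (E d)) (v : E d → E d) (w : E d → ℝ) : Prop :=
  MemLp v 2 (volume.restrict Ω) ∧ MemLp w 2 (volume.restrict Ω) ∧
    ∀ φ : E d → ℝ, IsTestFunction Ω φ →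
      ∫ x in Ω, inner ℝ (v x) (gradient φ x) = -∫ x in Ω, w x * φ x

/-- `v` belongs to `H(div, Ω)`. -/
def MemHdiv (Ω : Set (E d)) (v : E d → E d) : Prop :=
  ∃ w, HasWeakDivergence Ω v w

/-- `p` is the weak solution in `H¹₀(Ω)` of `-Δ p = f` with homogeneous Dirichlet data. -/
def IsWeakSolution (Ω : Set (E d)) (f p : E d → ℝ) : Prop :=
  MemH10 Ω p ∧ ∀ v : E d → ℝ, MemH10 Ω v →
    ∫ x in Ω, inner ℝ (weakGrad Ω p x) (weakGrad Ω v x) = ∫ x in Ω, f x * v x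

end Sobolev

section Mesh

variable {d : ℕ}

/-- The closed simplex (or face) with the given vertices. -/
def cell (K : Finset (E d)) : Set (E d) := convexHull ℝ (K : Set (E d))

open Classical in
/-- A conforming simplicial mesh of `Ω`; an element is given by its `d + 1` vertices. Two different
elements meet in the hull of their common vertices, which is empty or an entire common face of
dimension at most `d - 1`. The face of `K` opposite to the vertex `a` is `K.erase a`. -/
structure SimplicialMesh (Ω : Set (E d)) where
  elems : Finset (Finset (E d))
  card_eq : ∀ K ∈ elems, K.card = d + 1
  affineIndependent : ∀ K ∈ elems, AffineIndependent ℝ ((↑) : K → E d)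
  iUnion_eq : (⋃ K ∈ elems, cell K) = closure Ω
  inter_eq : ∀ K ∈ elems, ∀ L ∈ elems, K ≠ L → cell K ∩ cell L = cell (K ∩ L)

variable {Ω : Set (E d)}

open Classical in
/-- `K` and `L` are distinct mesh elements that share the face opposite to the vertex `a` of `K` and
to the vertex `b` of `L`. -/
def SimplicialMesh.IsInteriorFace (T : SimplicialMesh Ω) (K L : Finset (E d)) (a b : E d) : Prop :=
  K ∈ T.elems ∧ L ∈ T.elems ∧ K ≠ L ∧ a ∈ K ∧ b ∈ L ∧ K.erase a = L.erase b

open Classical in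
/-- The face of the mesh element `K` opposite to its vertex `a` lies in the boundary of `Ω`. -/
def SimplicialMesh.IsBoundaryFace (T : SimplicialMesh Ω) (K : Finset (E d)) (a : E d) : Prop :=
  K ∈ T.elems ∧ a ∈ K ∧ cell (K.erase a) ⊆ frontier Ω

open Classical in
/-- The points attached to the elements and to the boundary faces of an admissible mesh. -/
structure AdmissiblePoints (T : SimplicialMesh Ω) where
  /-- the point `x_K` of the element `K` -/
  cellPt : Finset (E d) → E d
  /-- the point `x_{K,σ}` of the boundary face `σ` of `K` -/
  facePt : Finset (E d) → Finset (E d) → E d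
  facePt_mem : ∀ K a, T.IsBoundaryFace K a →
    facePt K (K.erase a) ∈ intrinsicInterior ℝ (cell (K.erase a))
  cellPt_ne_cellPt : ∀ K ∈ T.elems, ∀ L ∈ T.elems, K ≠ L → cellPt K ≠ cellPt L
  cellPt_ne_facePt : ∀ K ∈ T.elems, ∀ L a, T.IsBoundaryFace L a →
    cellPt K ≠ facePt L (L.erase a)
  facePt_ne_facePt : ∀ K a L b, T.IsBoundaryFace K a → T.IsBoundaryFace L b →
    (K, a) ≠ (L, b) → facePt K (K.erase a) ≠ facePt L (L.erase b)
  orthogonal_interior : ∀ K L a b, T.IsInteriorFace K L a b →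
    ∀ y ∈ K.erase a, ∀ z ∈ K.erase a, inner ℝ (cellPt L - cellPt K) (z - y) = 0
  orthogonal_boundary : ∀ K a, T.IsBoundaryFace K a →
    ∀ y ∈ K.erase a, ∀ z ∈ K.erase a,
      inner ℝ (facePt K (K.erase a) - cellPt K) (z - y) = 0

/-- The `(d-1)`-dimensional measure of the face with the given vertices. -/
def faceMeasure (σ : Finset (E d)) : ℝ :=
  (Measure.euclideanHausdorffMeasure (d - 1) : Measure (E d)).real (cell σ)

/-- The distance of `x` and `y`, counted negatively if `y - x` does not point in the direction
of `v`. -/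
def orientedDist (x y v : E d) : ℝ :=
  if 0 < (inner ℝ (y - x) v : ℝ) then dist x y else -dist x y

open Classical in
/-- The cell-centred finite volume scheme with cell values `pK` and face fluxes `U K σ`. For
an interior face, the vector from the opposite vertex in `K` to the opposite vertex in `L` gives
the direction from `K` to `L`; for a boundary face, the vector from the opposite vertex to the
face point gives the direction out of `K`. -/
structure IsFiniteVolumeSolution (T : SimplicialMesh Ω) (P : AdmissiblePoints T) (f : E d → ℝ)
    (pK : Finset (E d) → ℝ) (U : Finset (E d) → Finset (E d) → ℝ) : Prop where
  balance : ∀ K ∈ T.elems, ∑ a ∈ K, U K (K.erase a) = ∫ x in cell K, f x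
  flux_interior : ∀ K L a b, T.IsInteriorFace K L a b →
    U K (K.erase a) = -(faceMeasure (K.erase a) /
      orientedDist (P.cellPt K) (P.cellPt L) (b - a)) * (pK L - pK K)
  flux_boundary : ∀ K a, T.IsBoundaryFace K a →
    U K (K.erase a) = -(faceMeasure (K.erase a) /
      orientedDist (P.cellPt K) (P.facePt K (K.erase a)) (P.facePt K (K.erase a) - a)) *
        (0 - pK K)

/-- The lowest-order Raviart-Thomas basis field of the element `K` with unit outward flux through
the face opposite to the vertex `a` and no flux through the other faces. -/
def rtBasis (K : Finset (E d)) (a x : E d) : E d :=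
  (1 / ((d : ℝ) * volume.real (cell K))) • (x - a)

open Classical in
/-- The field in `RT₀(K)` with the outward face fluxes `U K σ`. -/
def elementFlux (U : Finset (E d) → Finset (E d) → ℝ) (K : Finset (E d)) (x : E d) : E d :=
  ∑ a ∈ K, U K (K.erase a) • rtBasis K a x

/-- The flux reconstruction `u_h`, elementwise equal to `elementFlux` (the values on the
mesh faces, a null set, are immaterial). -/
def fluxReconstruction (T : SimplicialMesh Ω) (U : Finset (E d) → Finset (E d) → ℝ) :
    E d → E d :=
  fun x => ∑ K ∈ T.elems, (interior (cell K)).indicator (elementFlux U K) x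

/-- The function on `ℝᵈ` given by a polynomial in `d` variables. -/
def polyFun (q : MvPolynomial (Fin d) ℝ) (x : E d) : ℝ := MvPolynomial.eval (fun i => x i) q

/-- The mean value of `v` on the element `K`. -/
def cellMean (K : Finset (E d)) (v : E d → ℝ) : ℝ :=
  (∫ x in cell K, v x) / volume.real (cell K)

/-- The potential postprocessing: on each element `K` a polynomial `q K` of degree at most `2` with
`-∇ (q K) = u_h` on `K` and mean value `pK K`. -/
def IsPotentialPostprocessing (T : SimplicialMesh Ω) (U : Finset (E d) → Finset (E d) → ℝ)
    (pK : Finset (E d) → ℝ) (q : Finset (E d) → MvPolynomial (Fin d) ℝ) : Prop :=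
  ∀ K ∈ T.elems, (q K).totalDegree ≤ 2 ∧
    (∀ x ∈ cell K, -gradient (polyFun (q K)) x = elementFlux U K x) ∧
    cellMean K (polyFun (q K)) = pK K

/-- The Lagrange nodes of the piecewise quadratic functions: the vertices (case `a = b`) and the
edge midpoints. -/
def SimplicialMesh.lagrangeNodes (T : SimplicialMesh Ω) : Set (E d) :=
  {x | ∃ K ∈ T.elems, ∃ a ∈ K, ∃ b ∈ K, x = midpoint ℝ a b}

open Classical in
/-- The mesh elements that contain the point `x`. -/
def SimplicialMesh.elemsAt (T : SimplicialMesh Ω) (x : E d) : Finset (Finset (E d)) :=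
  T.elems.filter (fun K => x ∈ cell K)

/-- The potential reconstruction by averaging: a function given on each closed element by a
polynomial of degree at most `2` (hence continuous on the closure of `Ω`), whose values at the
Lagrange nodes are the averages of the postprocessed potential inside `Ω` and zero on the
boundary. -/
structure IsPotentialReconstruction (T : SimplicialMesh Ω)
    (q : Finset (E d) → MvPolynomial (Fin d) ℝ) (s : E d → ℝ) : Prop where
  piecewise_quadratic : ∀ K ∈ T.elems, ∃ r : MvPolynomial (Fin d) ℝ, r.totalDegree ≤ 2 ∧
    ∀ x ∈ cell K, s x = polyFun r x
  node_interior : ∀ x ∈ T.lagrangeNodes, x ∈ Ω →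
    s x = (1 / ((T.elemsAt x).card : ℝ)) * ∑ K ∈ T.elemsAt x, polyFun (q K) x
  node_boundary : ∀ x ∈ T.lagrangeNodes, x ∈ frontier Ω → s x = 0

/-- The squared elementwise estimator `η_K²`. -/
def estimatorSq (Ω : Set (E d)) (f : E d → ℝ) (uh : E d → E d) (s : E d → ℝ)
    (K : Finset (E d)) : ℝ :=
  l2Norm (cell K) (fun x => uh x + weakGrad Ω s x) ^ 2 +
    Metric.diam (cell K) ^ 2 / Real.pi ^ 2 *
      l2Norm (cell K) (fun x => f x - cellMean K f) ^ 2

end Mesh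

end FVPoisson

end

open MeasureTheory
open scoped ContDiff

namespace FVPoisson

/-! Put `g = ∇p + u_h`, so that `‖u - u_h‖ = ‖g‖`, and `v = p - s_h`, an element of `H¹₀(Ω)`. Then
`u_h + ∇s_h = g - ∇v`, and expanding the square gives `‖g‖² = ‖u_h + ∇s_h‖² + 2 (g, ∇v) - ‖∇v‖²`. By
the weak equation, `(g, ∇v) = (f, v) + (u_h, ∇v)`. Since `u_h` has the divergence `f_K` (the mean of
`f`) on each `K`, this residual equals `∑_K (f - f_K, v - v_K)_K`, and the Poincaré inequality with
constant `h_K / π` bounds it by `osc ‖∇v‖`. Finally `2ab - b² ≤ a²` gives `‖g‖² ≤ ‖u_h + ∇s_h‖² +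
osc²` (`error_sq_le`).

Poincaré inequality (`poincare_cell`). On the corner simplex the Jacobi operator has spectral gap `d
+ 1` (`poincare_cornerMeasure`, by induction on the dimension over slices). Its carré du champ at a
point is the variance, with the barycentric coordinates as weights, of the derivatives towards the
vertices; Popoviciu's inequality bounds it by `h² |∇φ|² / 4`. Hence the constant `h² / (4 (d + 1))`,
which is at most `h² / π²` once `d ≥ 2`; for `d = 1` Wirtinger's inequality is used instead.

Divergence (`integral_fluxReconstruction`). Tested with `∇φ`, a Raviart-Thomas basis field gives the
mean of `φ` on its face minus the mean on the element. The fluxes on the two sides of a shared face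
are opposite, and a face that belongs to one element only is disjoint from `Ω`, where `φ` vanishes.

Conformity of `s_h` (`IsPotentialReconstruction.memH10`). The boundary of `Ω` is covered by unshared
faces, and on these `s_h` is a quadratic that vanishes at all nodes. So `s_h`, extended by zero, is
Lipschitz, and truncation followed by mollification puts it in `H¹₀`. The residual bound is proved
for test functions and passes to `H¹₀` by density (`residual_le`). -/

/-! ### The corner simplex: slicing and normalized measure. -/

/-- The simplex in `ℝⁿ` spanned by the origin and the standard basis vectors. -/
def cornerSimplex (n : ℕ) : Set (Fin n → ℝ) := {x | (∀ i, 0 ≤ x i) ∧ ∑ i, x i ≤ 1}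

theorem isCompact_cornerSimplex (n : ℕ) : IsCompact (cornerSimplex n) := by
  have hc : IsClosed (cornerSimplex n) := by
    have : cornerSimplex n = (⋂ i, {x | 0 ≤ x i}) ∩ {x | ∑ i, x i ≤ 1} := by
      ext x; simp [cornerSimplex]
    rw [this]
    refine IsClosed.inter (isClosed_iInter fun i => isClosed_le (by fun_prop) (by fun_prop))
      (isClosed_le (by fun_prop) (by fun_prop))
  refine (isCompact_Icc (a := (0 : Fin n → ℝ)) (b := 1)).of_isClosed_subset hc ?_
  intro x hx
  refine ⟨fun i => hx.1 i, fun i => ?_⟩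
  exact (Finset.single_le_sum (f := x) (fun j _ => hx.1 j) (Finset.mem_univ i)).trans hx.2

theorem measurableSet_cornerSimplex (n : ℕ) : MeasurableSet (cornerSimplex n) :=
  (isCompact_cornerSimplex n).isClosed.measurableSet

theorem cons_mem_cornerSimplex {n : ℕ} {r : ℝ} (hr : 0 < r) (hr' : r ≤ 1) (y : Fin n → ℝ) :
    (Fin.cons (1 - r) (r • y) : Fin (n + 1) → ℝ) ∈ cornerSimplex (n + 1) ↔
      y ∈ cornerSimplex n := by
  simp only [cornerSimplex, Set.mem_ofPred_eq, Fin.forall_fin_succ, Fin.cons_zero, Fin.cons_succ,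
    Fin.sum_univ_succ, Pi.smul_apply, smul_eq_mul, ← Finset.mul_sum]
  constructor
  · rintro ⟨⟨-, h1⟩, h2⟩
    exact ⟨fun i => nonneg_of_mul_nonneg_right (h1 i) hr, by nlinarith⟩
  · rintro ⟨h1, h2⟩
    exact ⟨⟨by linarith, fun i => mul_nonneg hr.le (h1 i)⟩, by nlinarith⟩

theorem cons_not_mem_cornerSimplex {n : ℕ} {t : ℝ} (ht : t < 0 ∨ 1 < t) (z : Fin n → ℝ) :
    (Fin.cons t z : Fin (n + 1) → ℝ) ∉ cornerSimplex (n + 1) := by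
  intro h
  have h0 := h.1 0
  have h1 := h.2
  have h2 : 0 ≤ ∑ i : Fin n, z i := Finset.sum_nonneg fun i _ => by simpa using h.1 i.succ
  simp only [Fin.cons_zero, Fin.sum_univ_succ, Fin.cons_succ] at h0 h1
  rcases ht with ht | ht <;> linarith

/-- Integration over the corner simplex by slices parallel to a facet. -/
theorem setIntegral_cornerSimplex_succ {n : ℕ} {F : (Fin (n + 1) → ℝ) → ℝ} (hF : Continuous F) :
    ∫ x in cornerSimplex (n + 1), F x =
      ∫ r in (0 : ℝ)..1, r ^ n * ∫ y in cornerSimplex n, F (Fin.cons (1 - r) (r • y)) := by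
  set g := (cornerSimplex (n + 1)).indicator F with hg
  have hint : Integrable g := by
    rw [hg, integrable_indicator_iff (measurableSet_cornerSimplex _)]
    exact hF.continuousOn.integrableOn_compact (isCompact_cornerSimplex _)
  have hmp := volume_preserving_piFinSuccAbove (fun _ : Fin (n + 1) => ℝ) 0
  have hmp' := hmp.symm
  have h1 : ∫ x, g x = ∫ t : ℝ, ∫ z : Fin n → ℝ, g (Fin.cons t z) := by
    rw [← hmp'.integral_comp (MeasurableEquiv.measurableEmbedding _)]
    rw [Measure.volume_eq_prod, integral_prod]
    · simp [MeasurableEquiv.piFinSuccAbove_symm_apply, Fin.insertNthEquiv]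
    · exact (hmp'.integrable_comp_emb (MeasurableEquiv.measurableEmbedding _)).2 hint
  rw [← integral_indicator (measurableSet_cornerSimplex _), ← hg, h1]
  -- The two excluded heights form a null set: at `t = 1` the slice cannot be rescaled, and at `t =
  -- 0` it is a full facet although `Ioc` omits that endpoint.
  have h2 : ∀ t : ℝ, t ≠ 0 → t ≠ 1 → ∫ z : Fin n → ℝ, g (Fin.cons t z) =
      (Set.Ioc (0 : ℝ) 1).indicator (fun t => (1 - t) ^ n *
        ∫ y in cornerSimplex n, F (Fin.cons t ((1 - t) • y))) t := by
    intro t ht0 ht1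
    by_cases ht : t ∈ Set.Ioc (0 : ℝ) 1
    · rw [Set.indicator_of_mem ht]
      have hr : 0 < 1 - t := by
        have := lt_of_le_of_ne ht.2 ht1
        linarith
      have := Measure.integral_comp_smul (volume : Measure (Fin n → ℝ))
        (fun z => g (Fin.cons t z)) (1 - t)
      simp only [Module.finrank_fin_fun, smul_eq_mul, abs_inv,
        abs_of_pos (pow_pos hr n)] at this
      rw [inv_mul_eq_div, eq_div_iff (pow_pos hr n).ne'] at this
      rw [← this, mul_comm, ← integral_indicator (measurableSet_cornerSimplex n)]
      congr 2
      ext y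
      have key := cons_mem_cornerSimplex hr (by linarith [ht.1]) y
      rw [sub_sub_cancel] at key
      by_cases hy : y ∈ cornerSimplex n
      · rw [Set.indicator_of_mem hy, hg, Set.indicator_of_mem (key.2 hy)]
      · rw [Set.indicator_of_notMem hy, hg, Set.indicator_of_notMem (fun h => hy (key.1 h))]
    · rw [Set.indicator_of_notMem ht]
      have : t < 0 ∨ 1 < t := by
        simp only [Set.mem_Ioc, not_and_or, not_lt, not_le] at ht
        exact ht.imp_left fun h => lt_of_le_of_ne h ht0
      simp [hg, cons_not_mem_cornerSimplex this]
  have h3 : (fun t : ℝ => ∫ z : Fin n → ℝ, g (Fin.cons t z)) =ᵐ[volume]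
      (Set.Ioc (0 : ℝ) 1).indicator (fun t => (1 - t) ^ n *
        ∫ y in cornerSimplex n, F (Fin.cons t ((1 - t) • y))) := by
    filter_upwards [Measure.ae_ne volume (0 : ℝ), Measure.ae_ne volume (1 : ℝ)] with t h h'
    exact h2 t h h'
  rw [integral_congr_ae h3, integral_indicator measurableSet_Ioc,
    ← intervalIntegral.integral_of_le zero_le_one]
  have := intervalIntegral.integral_comp_sub_left (a := 0) (b := 1) (fun r : ℝ => r ^ n *
    ∫ y in cornerSimplex n, F (Fin.cons (1 - r) (r • y))) 1
  simpa using this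

theorem volume_real_cornerSimplex_succ (n : ℕ) :
    ((n : ℝ) + 1) * volume.real (cornerSimplex (n + 1)) = volume.real (cornerSimplex n) := by
  have := setIntegral_cornerSimplex_succ (n := n) (F := fun _ => 1) continuous_const
  simp only [integral_const, MeasurableSet.univ, measureReal_restrict_apply, Set.univ_inter,
    smul_eq_mul, mul_one, intervalIntegral.integral_mul_const, integral_pow] at this
  rw [this]
  have : (n : ℝ) + 1 ≠ 0 := by positivity
  field_simp
  simp

theorem volume_real_cornerSimplex_pos (n : ℕ) : 0 < volume.real (cornerSimplex n) := by
  induction n with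
  | zero =>
    have : cornerSimplex 0 = Set.univ := by ext; simp [cornerSimplex]
    rw [this]; simp [Measure.real, volume_pi]
  | succ n ih =>
    rw [← volume_real_cornerSimplex_succ] at ih
    exact pos_of_mul_pos_right ih (by positivity)

/-- The normalized Lebesgue measure on the corner simplex. -/
noncomputable def cornerMeasure (n : ℕ) : Measure (Fin n → ℝ) :=
  (volume (cornerSimplex n))⁻¹ • volume.restrict (cornerSimplex n)

theorem volume_cornerSimplex_ne_top (n : ℕ) : volume (cornerSimplex n) ≠ ⊤ :=
  (isCompact_cornerSimplex n).measure_ne_top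

theorem volume_cornerSimplex_ne_zero (n : ℕ) : volume (cornerSimplex n) ≠ 0 := fun h => by
  have := volume_real_cornerSimplex_pos n
  simp [Measure.real, h] at this

instance (n : ℕ) : IsProbabilityMeasure (cornerMeasure n) := by
  constructor
  simp [cornerMeasure,
    ENNReal.inv_mul_cancel (volume_cornerSimplex_ne_zero n) (volume_cornerSimplex_ne_top n)]

theorem integral_cornerMeasure {n : ℕ} (F : (Fin n → ℝ) → ℝ) :
    ∫ x, F x ∂cornerMeasure n =
      (volume.real (cornerSimplex n))⁻¹ * ∫ x in cornerSimplex n, F x := by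
  rw [cornerMeasure, integral_smul_measure, ENNReal.toReal_inv, smul_eq_mul, Measure.real]

theorem ae_cornerMeasure_mem (n : ℕ) : ∀ᵐ x ∂cornerMeasure n, x ∈ cornerSimplex n :=
  Measure.ae_smul_measure (ae_restrict_mem (measurableSet_cornerSimplex n)) _

theorem integrable_cornerMeasure {n : ℕ} {F : (Fin n → ℝ) → ℝ} (hF : Continuous F) :
    Integrable F (cornerMeasure n) := by
  refine Integrable.smul_measure ?_ (by simp [volume_cornerSimplex_ne_zero])
  exact hF.continuousOn.integrableOn_compact (isCompact_cornerSimplex n)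

theorem integral_cornerMeasure_succ {n : ℕ} {F : (Fin (n + 1) → ℝ) → ℝ} (hF : Continuous F) :
    ∫ x, F x ∂cornerMeasure (n + 1) =
      ∫ r in (0 : ℝ)..1, ((n + 1) * r ^ n) *
        ∫ y, F (Fin.cons (1 - r) (r • y)) ∂cornerMeasure n := by
  simp only [integral_cornerMeasure]
  rw [setIntegral_cornerSimplex_succ hF, ← volume_real_cornerSimplex_succ n,
    ← intervalIntegral.integral_const_mul]
  refine intervalIntegral.integral_congr fun r _ => ?_
  have h1 := (volume_real_cornerSimplex_pos (n + 1)).ne'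
  have h2 : (n : ℝ) + 1 ≠ 0 := by positivity
  field_simp

/-- Parametric integrals over the corner simplex are continuous. -/
theorem continuous_integral_cornerMeasure {n : ℕ} {F : ℝ → (Fin n → ℝ) → ℝ}
    (hF : Continuous (Function.uncurry F)) :
    Continuous fun r => ∫ y, F r y ∂cornerMeasure n := by
  simp only [integral_cornerMeasure]
  exact continuous_const.mul
    (continuous_parametric_integral_of_continuous hF (isCompact_cornerSimplex n))

theorem hasDerivAt_integral_cornerMeasure {n : ℕ} {F F' : ℝ → (Fin n → ℝ) → ℝ}
    (hF : Continuous (Function.uncurry F)) (hF' : Continuous (Function.uncurry F'))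
    (h : ∀ r y, HasDerivAt (fun r => F r y) (F' r y) r) (r : ℝ) :
    HasDerivAt (fun r => ∫ y, F r y ∂cornerMeasure n) (∫ y, F' r y ∂cornerMeasure n) r := by
  have hc : ∀ s, Continuous (F s) := fun s => hF.comp (Continuous.prodMk_right s)
  have hc' : ∀ s, Continuous (F' s) := fun s => hF'.comp (Continuous.prodMk_right s)
  obtain ⟨C, hC⟩ := ((isCompact_closedBall r 1).prod
    (isCompact_cornerSimplex n)).exists_bound_of_continuousOn hF'.continuousOn
  refine (hasDerivAt_integral_of_dominated_loc_of_deriv_le (bound := fun _ => C)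
    (Metric.ball_mem_nhds r one_pos)
    (Filter.Eventually.of_forall fun s => (hc s).aestronglyMeasurable)
    (integrable_cornerMeasure (hc r)) (hc' r).aestronglyMeasurable ?_ (integrable_const C)
    (Filter.Eventually.of_forall fun y s _ => h s y)).2
  filter_upwards [ae_cornerMeasure_mem n] with y hy s hs
  exact hC (s, y) ⟨Metric.ball_subset_closedBall hs, hy⟩


/-! ### Sharp Poincaré inequalities for Jacobi weights, on the interval and on the corner simplex.
-/

theorem sq_intervalIntegral_le {b : ℝ → ℝ} (hb : Continuous b) (x y : ℝ) :
    (∫ r in x..y, b r) ^ 2 ≤ (y - x) * ∫ r in x..y, b r ^ 2 := by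
  -- For reversed endpoints both factors on the right change sign, so the inequality survives.
  wlog hxy : x ≤ y generalizing x y
  · have := this y x (le_of_not_ge hxy)
    rw [intervalIntegral.integral_symm x y, intervalIntegral.integral_symm x y] at this
    linarith
  rcases hxy.eq_or_lt with rfl | hlt
  · simp
  set I := ∫ r in x..y, b r
  set H := ∫ r in x..y, b r ^ 2
  have h0 : 0 ≤ ∫ r in x..y, (b r - I / (y - x)) ^ 2 :=
    intervalIntegral.integral_nonneg hxy fun r _ => sq_nonneg _
  have h1 : ∫ r in x..y, (b r - I / (y - x)) ^ 2 =
      H - 2 * (I / (y - x)) * I + (y - x) * (I / (y - x)) ^ 2 := by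
    have : ∀ r, (b r - I / (y - x)) ^ 2 =
        b r ^ 2 - (2 * (I / (y - x))) * b r + (I / (y - x)) ^ 2 := fun r => by ring
    simp only [this]
    rw [intervalIntegral.integral_add, intervalIntegral.integral_sub,
      intervalIntegral.integral_const_mul, intervalIntegral.integral_const, smul_eq_mul]
    all_goals exact Continuous.intervalIntegrable (by fun_prop) _ _
  rw [h1] at h0
  have hpos : 0 < y - x := sub_pos.2 hlt
  have : H - 2 * (I / (y - x)) * I + (y - x) * (I / (y - x)) ^ 2 = H - I ^ 2 / (y - x) := by
    field_simp; ring
  rw [this, sub_nonneg, div_le_iff₀ hpos] at h0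
  linarith

/-- The sharp weighted Poincaré inequality on `[0, 1]` for the weight `(n + 1) rⁿ`. -/
theorem weighted_poincare_interval (n : ℕ) {a b : ℝ → ℝ} (hab : ∀ r, HasDerivAt a (b r) r)
    (hb : Continuous b) :
    ((n : ℝ) + 2) * ((∫ r in (0 : ℝ)..1, ((n + 1) * r ^ n) * a r ^ 2) -
        (∫ r in (0 : ℝ)..1, ((n + 1) * r ^ n) * a r) ^ 2) ≤
      ∫ r in (0 : ℝ)..1, ((n + 1) * r ^ n) * (r * (1 - r) * b r ^ 2) := by
  have ha : Continuous a := continuous_iff_continuousAt.2 fun r => (hab r).continuousAt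
  -- `M` is the mean of `r` under the weight. The variance is at most the second moment about `a M`,
  -- and this centre makes the boundary terms below vanish.
  set M : ℝ := (n + 1) / (n + 2) with hM
  set H : ℝ → ℝ := fun r => ∫ t in M..r, b t ^ 2 with hH
  have hHd : ∀ r, HasDerivAt H (b r ^ 2) r := fun r =>
    intervalIntegral.integral_hasDerivAt_right (Continuous.intervalIntegrable (by fun_prop) _ _)
      (hb.pow 2).aestronglyMeasurable.stronglyMeasurableAtFilter (hb.pow 2).continuousAt
  have hHc : Continuous H := continuous_iff_continuousAt.2 fun r => (hHd r).continuousAt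
  have hψ : ∀ r, (a r - a M) ^ 2 ≤ (r - M) * H r := fun r => by
    have := sq_intervalIntegral_le hb M r
    rwa [intervalIntegral.integral_eq_sub_of_hasDerivAt (fun x _ => hab x)
      (hb.intervalIntegrable _ _)] at this
  -- The antiderivative of the weight times `M - r` that vanishes at both ends. It equals the weight
  -- times `r (1 - r) / (n + 2)`, which produces the Dirichlet form and the constant `n + 2`.
  set m : ℝ → ℝ := fun r => (n + 1) / (n + 2) * ((1 - r) * r ^ (n + 1)) with hm
  have hmd : ∀ r, HasDerivAt m (((n + 1) * r ^ n) * (M - r)) r := fun r => by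
    have h1 := (((hasDerivAt_id r).const_sub 1).mul (hasDerivAt_pow (n + 1) r)).const_mul
      (((n : ℝ) + 1) / (n + 2))
    refine h1.congr_deriv ?_
    have : (n : ℝ) + 2 ≠ 0 := by positivity
    simp only [hM, id, Nat.add_sub_cancel]
    field_simp
    push_cast
    ring
  have hibp := intervalIntegral.integral_mul_deriv_eq_deriv_mul (a := 0) (b := 1)
    (u := H) (v := m) (fun x _ => hHd x) (fun x _ => hmd x)
    (Continuous.intervalIntegrable (by fun_prop) _ _)
    (Continuous.intervalIntegrable (by fun_prop) _ _)
  have hm0 : m 0 = 0 := by simp [hm]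
  have hm1 : m 1 = 0 := by simp [hm]
  rw [hm0, hm1, mul_zero, mul_zero, sub_zero, zero_sub] at hibp
  have hρ : ∫ r in (0 : ℝ)..1, ((n : ℝ) + 1) * r ^ n = 1 := by
    rw [intervalIntegral.integral_const_mul, integral_pow]
    have : (n : ℝ) + 1 ≠ 0 := by positivity
    field_simp; simp
  have hle : ∫ r in (0 : ℝ)..1, ((n + 1) * r ^ n) * (a r - a M) ^ 2 ≤
      ∫ r in (0 : ℝ)..1, b r ^ 2 * m r := by
    rw [← neg_neg (∫ r in (0 : ℝ)..1, b r ^ 2 * m r), ← hibp, ← intervalIntegral.integral_neg]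
    refine intervalIntegral.integral_mono_on zero_le_one
      (Continuous.intervalIntegrable (by fun_prop) _ _)
      (Continuous.intervalIntegrable (by fun_prop) _ _) fun r hr => ?_
    have h1 : 0 ≤ ((n : ℝ) + 1) * r ^ n := mul_nonneg (by positivity) (pow_nonneg hr.1 n)
    have := mul_le_mul_of_nonneg_left (hψ r) h1
    linarith
  have hexp : ∫ r in (0 : ℝ)..1, ((n + 1) * r ^ n) * (a r - a M) ^ 2 =
      (∫ r in (0 : ℝ)..1, ((n + 1) * r ^ n) * a r ^ 2) -
        2 * a M * (∫ r in (0 : ℝ)..1, ((n + 1) * r ^ n) * a r) + a M ^ 2 := by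
    have : ∀ r, ((n + 1) * r ^ n) * (a r - a M) ^ 2 = ((n + 1) * r ^ n) * a r ^ 2 -
        2 * a M * (((n + 1) * r ^ n) * a r) + a M ^ 2 * ((n + 1) * r ^ n) := fun r => by ring
    simp only [this]
    rw [intervalIntegral.integral_add, intervalIntegral.integral_sub,
      intervalIntegral.integral_const_mul, intervalIntegral.integral_const_mul (a M ^ 2), hρ,
      mul_one]
    all_goals exact Continuous.intervalIntegrable (by fun_prop) _ _
  have hfin : ∫ r in (0 : ℝ)..1, ((n + 1) * r ^ n) * (r * (1 - r) * b r ^ 2) =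
      (n + 2) * ∫ r in (0 : ℝ)..1, b r ^ 2 * m r := by
    rw [← intervalIntegral.integral_const_mul]
    refine intervalIntegral.integral_congr fun r _ => ?_
    have : (n : ℝ) + 2 ≠ 0 := by positivity
    simp only [hm]
    field_simp
    ring
  rw [hfin]
  refine mul_le_mul_of_nonneg_left (le_trans ?_ hle) (by positivity)
  rw [hexp]
  nlinarith [sq_nonneg ((∫ r in (0 : ℝ)..1, ((n + 1) * r ^ n) * a r) - a M)]

/-- The carré du champ of the Jacobi operator of the corner simplex. -/
noncomputable def simplexGamma {n : ℕ} (u : (Fin n → ℝ) → ℝ) (x : Fin n → ℝ) : ℝ :=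
  ∑ i, x i * fderiv ℝ u x (Pi.single i 1) ^ 2 - fderiv ℝ u x x ^ 2

theorem continuous_simplexGamma {n : ℕ} {u : (Fin n → ℝ) → ℝ} (hu : ContDiff ℝ 1 u) :
    Continuous (simplexGamma u) := by
  have := hu.continuous_fderiv one_ne_zero
  unfold simplexGamma
  fun_prop

/-- The right-hand side is the variance of `w - c v`, expanded. -/
theorem cov_le {n : ℕ} {v w : (Fin n → ℝ) → ℝ} (hv : Continuous v) (hw : Continuous w) (c : ℝ) :
    0 ≤ ((∫ y, w y ^ 2 ∂cornerMeasure n) - (∫ y, w y ∂cornerMeasure n) ^ 2) -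
      2 * c * ((∫ y, v y * w y ∂cornerMeasure n) -
        (∫ y, v y ∂cornerMeasure n) * ∫ y, w y ∂cornerMeasure n) +
      c ^ 2 * ((∫ y, v y ^ 2 ∂cornerMeasure n) - (∫ y, v y ∂cornerMeasure n) ^ 2) := by
  set A := ∫ y, v y ∂cornerMeasure n
  set B := ∫ y, w y ∂cornerMeasure n
  have h0 : 0 ≤ ∫ y, ((w y - B) - c * (v y - A)) ^ 2 ∂cornerMeasure n :=
    integral_nonneg fun y => sq_nonneg _
  have h1 : ∀ y, ((w y - B) - c * (v y - A)) ^ 2 = w y ^ 2 + (-2 * c) * (v y * w y) +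
      c ^ 2 * v y ^ 2 + (-2 * (B - c * A)) * w y + (2 * c * (B - c * A)) * v y +
      (B - c * A) ^ 2 := fun y => by ring
  simp only [h1] at h0
  rw [integral_add, integral_add, integral_add, integral_add, integral_add,
    integral_const_mul, integral_const_mul, integral_const_mul, integral_const_mul,
    integral_const, probReal_univ] at h0
  · change 0 ≤ _ + -2 * (B - c * A) * B + 2 * c * (B - c * A) * A + _ at h0
    simp only [one_smul] at h0
    linarith
  all_goals exact integrable_cornerMeasure (by fun_prop)


/-- The parametrization of the corner simplex by slices parallel to a facet. -/
def coneSlice {n : ℕ} (r : ℝ) (y : Fin n → ℝ) : Fin (n + 1) → ℝ := Fin.cons (1 - r) (r • y)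

theorem contDiff_coneSlice (n : ℕ) :
    ContDiff ℝ ∞ (fun p : ℝ × (Fin n → ℝ) => coneSlice p.1 p.2) := by
  refine contDiff_pi.2 fun i => ?_
  refine Fin.cases ?_ (fun j => ?_) i
  · simp only [coneSlice, Fin.cons_zero]; fun_prop
  · simp only [coneSlice, Fin.cons_succ, Pi.smul_apply, smul_eq_mul]
    exact contDiff_fst.mul ((contDiff_apply ℝ ℝ j).comp contDiff_snd)

theorem continuous_coneSlice (n : ℕ) :
    Continuous (fun p : ℝ × (Fin n → ℝ) => coneSlice p.1 p.2) := (contDiff_coneSlice n).continuous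

theorem hasDerivAt_coneSlice {n : ℕ} (r : ℝ) (y : Fin n → ℝ) :
    HasDerivAt (fun r => coneSlice r y) (Fin.cons (-1) y) r := by
  refine hasDerivAt_pi.2 fun i => ?_
  refine Fin.cases ?_ (fun j => ?_) i
  · simpa [coneSlice] using (hasDerivAt_id r).const_sub 1
  · simpa [coneSlice] using (hasDerivAt_id r).mul_const (y j)

theorem hasFDerivAt_coneSlice {n : ℕ} (r : ℝ) (y : Fin n → ℝ) :
    HasFDerivAt (fun y => coneSlice r y)
      (ContinuousLinearMap.pi (Fin.cons 0 fun i => r • ContinuousLinearMap.proj i :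
        Fin (n + 1) → (Fin n → ℝ) →L[ℝ] ℝ)) y := by
  refine hasFDerivAt_pi.2 fun i => ?_
  refine Fin.cases ?_ (fun j => ?_) i
  · simpa [coneSlice] using hasFDerivAt_const (𝕜 := ℝ) (1 - r) y
  · simpa [coneSlice] using
      ((ContinuousLinearMap.proj (R := ℝ) (φ := fun _ : Fin n => ℝ) j).hasFDerivAt
        (x := y)).const_mul r

section

variable {n : ℕ} {u : (Fin (n + 1) → ℝ) → ℝ}

theorem hasDerivAt_comp_coneSlice (hu : ContDiff ℝ 1 u) (r : ℝ) (y : Fin n → ℝ) :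
    HasDerivAt (fun r => u (coneSlice r y)) (fderiv ℝ u (coneSlice r y) (Fin.cons (-1) y)) r :=
  ((hu.differentiable one_ne_zero).differentiableAt.hasFDerivAt).comp_hasDerivAt r
    (hasDerivAt_coneSlice r y)

theorem fderiv_comp_coneSlice (hu : ContDiff ℝ 1 u) (r : ℝ) (y v : Fin n → ℝ) :
    fderiv ℝ (fun y => u (coneSlice r y)) y v =
      r * fderiv ℝ u (coneSlice r y) (Fin.cons 0 v) := by
  have := ((hu.differentiable one_ne_zero).differentiableAt.hasFDerivAt).comp y
    (hasFDerivAt_coneSlice r y)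
  have h2 : ∀ f : (Fin (n + 1) → ℝ) → ℝ, f ∘ (fun y => coneSlice r y) =
    fun y => f (coneSlice r y) := fun f => rfl
  rw [h2] at this
  rw [this.fderiv, ContinuousLinearMap.comp_apply, ← smul_eq_mul, ← map_smul]
  congr 1
  ext i
  refine Fin.cases ?_ (fun j => ?_) i <;> simp

theorem continuous_deriv_coneSlice (hu : ContDiff ℝ 1 u) :
    Continuous (Function.uncurry fun (r : ℝ) (y : Fin n → ℝ) =>
      fderiv ℝ u (coneSlice r y) (Fin.cons (-1) y)) := by
  have h1 : Continuous fun p : ℝ × (Fin n → ℝ) => (Fin.cons (-1) p.2 : Fin (n + 1) → ℝ) := by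
    refine continuous_pi fun i => ?_
    refine Fin.cases ?_ (fun j => ?_) i
    · simpa using continuous_const
    · simp only [Fin.cons_succ]; fun_prop
  exact ((hu.continuous_fderiv one_ne_zero).comp (continuous_coneSlice n)).clm_apply h1

/-- Splitting a direction into its part inside the slice and the radial direction `(-1, y)`
diagonalizes the carré du champ: no cross term remains. The powers of `r` come from the slice being
a copy of the lower-dimensional simplex scaled by `r`. -/
theorem simplexGamma_coneSlice (hu : ContDiff ℝ 1 u) (r : ℝ) (y : Fin n → ℝ) :
    r * simplexGamma u (coneSlice r y) = simplexGamma (fun y => u (coneSlice r y)) y +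
      r ^ 2 * (1 - r) * fderiv ℝ u (coneSlice r y) (Fin.cons (-1) y) ^ 2 := by
  set D := fderiv ℝ u (coneSlice r y) with hD
  have e0 : ∀ (c : ℝ) (v : Fin n → ℝ), (Fin.cons c v : Fin (n + 1) → ℝ) =
      c • Pi.single 0 1 + Fin.cons 0 v := fun c v => by
    ext i; refine Fin.cases ?_ (fun j => ?_) i <;> simp
  have e1 : ∀ j : Fin n, (Pi.single j.succ 1 : Fin (n + 1) → ℝ) =
      Fin.cons 0 (Pi.single j (1 : ℝ) : Fin n → ℝ) := fun j => by
    ext i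
    refine Fin.cases ?_ (fun k => ?_) i
    · simp
    · simp [Pi.single_apply, Fin.succ_inj]
  have e2 : (Fin.cons 0 (r • y) : Fin (n + 1) → ℝ) = r • Fin.cons 0 y := by
    ext i; refine Fin.cases ?_ (fun j => ?_) i <;> simp
  have hP : D (coneSlice r y) = (1 - r) * D (Pi.single 0 1) + r * D (Fin.cons 0 y) := by
    rw [coneSlice, e0, e2, map_add, map_smul, map_smul, smul_eq_mul, smul_eq_mul]
  have hU : D (Fin.cons (-1) y) = - D (Pi.single 0 1) + D (Fin.cons 0 y) := by
    rw [e0, map_add, map_smul, smul_eq_mul, neg_one_mul]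
  simp only [simplexGamma, fderiv_comp_coneSlice hu, ← hD, hU, hP, Fin.sum_univ_succ, e1]
  simp only [coneSlice, Fin.cons_zero, Fin.cons_succ, Pi.smul_apply, smul_eq_mul]
  have h3 : ∑ i, r * y i * D (Fin.cons 0 (Pi.single i 1)) ^ 2 =
    r * ∑ i, y i * D (Fin.cons 0 (Pi.single i 1)) ^ 2 := by
    rw [Finset.mul_sum]; exact Finset.sum_congr rfl fun i _ => by ring
  have h4 : ∑ i, y i * (r * D (Fin.cons 0 (Pi.single i 1))) ^ 2 =
    r ^ 2 * ∑ i, y i * D (Fin.cons 0 (Pi.single i 1)) ^ 2 := by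
    rw [Finset.mul_sum]; exact Finset.sum_congr rfl fun i _ => by ring
  rw [h3, h4]
  ring

/-- The divergence theorem for radial fields: the mean flux density through the facet opposite
to the apex of the cone. -/
theorem integral_radial_divergence (hu : ContDiff ℝ 1 u) :
    ∫ x, (fderiv ℝ u x (x - Pi.single 0 1) + (n + 1) * u x) ∂cornerMeasure (n + 1) =
      (n + 1) * ∫ y, u (Fin.cons 0 y) ∂cornerMeasure n := by
  have hc := hu.continuous_fderiv one_ne_zero
  have hc0 := hu.continuous
  rw [integral_cornerMeasure_succ (by fun_prop)]
  set a : ℝ → ℝ := fun r => ∫ y, u (coneSlice r y) ∂cornerMeasure n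
  set b : ℝ → ℝ := fun r => ∫ y, fderiv ℝ u (coneSlice r y) (Fin.cons (-1) y) ∂cornerMeasure n
  have hU : Continuous (Function.uncurry fun (r : ℝ) (y : Fin n → ℝ) => u (coneSlice r y)) :=
    hc0.comp (continuous_coneSlice n)
  have hU' := continuous_deriv_coneSlice hu
  have hab : ∀ r, HasDerivAt a (b r) r := hasDerivAt_integral_cornerMeasure hU hU'
    (hasDerivAt_comp_coneSlice hu)
  have hb : Continuous b := continuous_integral_cornerMeasure hU'
  have ha : Continuous a := continuous_integral_cornerMeasure hU
  have key : ∀ r : ℝ, ∫ y, (fderiv ℝ u (Fin.cons (1 - r) (r • y))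
      ((Fin.cons (1 - r) (r • y) : Fin (n + 1) → ℝ) - Pi.single 0 1) +
        (n + 1) * u (Fin.cons (1 - r) (r • y))) ∂cornerMeasure n = r * b r + (n + 1) * a r := by
    intro r
    have h1 : ∀ y : Fin n → ℝ,
        (Fin.cons (1 - r) (r • y) : Fin (n + 1) → ℝ) - Pi.single 0 1 = r • Fin.cons (-1) y := by
      intro y; ext i; refine Fin.cases ?_ (fun j => ?_) i <;> simp
    simp only [h1, map_smul, smul_eq_mul]
    rw [integral_add, integral_const_mul, integral_const_mul]
    · rfl
    · exact (integrable_cornerMeasure (hU'.comp (Continuous.prodMk_right r))).const_mul r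
    · exact (integrable_cornerMeasure (hU.comp (Continuous.prodMk_right r))).const_mul _
  simp only [key]
  -- At a point of the slice, `x - e₀` is `r` times the radial direction, so the weighted integrand
  -- is an exact derivative in `r`; only the facet `r = 1` contributes.
  have hder : ∀ r : ℝ, HasDerivAt (fun r => (n + 1) * (r ^ (n + 1) * a r))
      ((n + 1) * r ^ n * (r * b r + (n + 1) * a r)) r := fun r => by
    refine (((hasDerivAt_pow (n + 1) r).mul (hab r)).const_mul ((n : ℝ) + 1)).congr_deriv ?_
    push_cast
    ring
  rw [intervalIntegral.integral_eq_sub_of_hasDerivAt (fun r _ => hder r)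
    (Continuous.intervalIntegrable (by fun_prop) _ _)]
  simp [a, coneSlice]

end

/-- Induction on the dimension. The total variance is the mean of the variances `h r` on the slices
plus the variance of the slice means `a r`. The latter is controlled by
`weighted_poincare_interval`, the former by the induction hypothesis and by what remains of the
radial derivative, namely its variance `k r - b r ^ 2` on the slice. Affine functions give equality
at each stage, so nothing is lost in the constant. -/
theorem poincare_cornerMeasure (n : ℕ) {u : (Fin n → ℝ) → ℝ} (hu : ContDiff ℝ 1 u) :
    ((n : ℝ) + 1) * ((∫ x, u x ^ 2 ∂cornerMeasure n) - (∫ x, u x ∂cornerMeasure n) ^ 2) ≤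
      ∫ x, simplexGamma u x ∂cornerMeasure n := by
  induction n with
  | zero =>
    have h1 : ∀ x, u x = u 0 := fun x => by rw [Subsingleton.elim x 0]
    have h2 : ∀ x, simplexGamma u x = 0 := fun x => by
      rw [Subsingleton.elim x 0, simplexGamma, map_zero]; simp
    rw [integral_congr_ae (Filter.Eventually.of_forall h1),
      integral_congr_ae (Filter.Eventually.of_forall h2),
      integral_congr_ae (Filter.Eventually.of_forall fun x => congrArg (· ^ 2) (h1 x))]
    simp
  | succ n ih =>
    have hc0 := hu.continuous
    set U : ℝ → (Fin n → ℝ) → ℝ := fun r y => u (coneSlice r y) with hUdef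
    set V : ℝ → (Fin n → ℝ) → ℝ := fun r y =>
      fderiv ℝ u (coneSlice r y) (Fin.cons (-1) y) with hVdef
    have hU : Continuous (Function.uncurry U) := hc0.comp (continuous_coneSlice n)
    have hV : Continuous (Function.uncurry V) := continuous_deriv_coneSlice hu
    have hUV : ∀ r y, HasDerivAt (fun r => U r y) (V r y) r := hasDerivAt_comp_coneSlice hu
    have hUr : ∀ r, Continuous (U r) := fun r => hU.comp (Continuous.prodMk_right r)
    have hVr : ∀ r, Continuous (V r) := fun r => hV.comp (Continuous.prodMk_right r)
    have hUs : ∀ r, ContDiff ℝ 1 (U r) := fun r =>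
      (hu.comp ((contDiff_coneSlice n).of_le (by simp))).comp (contDiff_prodMk_right r)
    set a : ℝ → ℝ := fun r => ∫ y, U r y ∂cornerMeasure n with hadef
    set b : ℝ → ℝ := fun r => ∫ y, V r y ∂cornerMeasure n with hbdef
    set a2 : ℝ → ℝ := fun r => ∫ y, U r y ^ 2 ∂cornerMeasure n with ha2def
    set k : ℝ → ℝ := fun r => ∫ y, V r y ^ 2 ∂cornerMeasure n with hkdef
    set c : ℝ → ℝ := fun r => ∫ y, V r y * U r y ∂cornerMeasure n with hcdef
    set G : ℝ → ℝ := fun r => ∫ y, simplexGamma u (coneSlice r y) ∂cornerMeasure n with hGdef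
    have hU2 : Continuous (Function.uncurry fun r y => U r y ^ 2) := hU.pow 2
    have hV2 : Continuous (Function.uncurry fun r y => V r y ^ 2) := hV.pow 2
    have hVU : Continuous (Function.uncurry fun r y => V r y * U r y) := hV.mul hU
    have hab : ∀ r, HasDerivAt a (b r) r := hasDerivAt_integral_cornerMeasure hU hV hUV
    have ha : Continuous a := continuous_integral_cornerMeasure hU
    have hb : Continuous b := continuous_integral_cornerMeasure hV
    have ha2 : Continuous a2 := continuous_integral_cornerMeasure hU2
    have hk : Continuous k := continuous_integral_cornerMeasure hV2
    have hcc : Continuous c := continuous_integral_cornerMeasure hVU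
    have hG : Continuous G := continuous_integral_cornerMeasure
      ((continuous_simplexGamma hu).comp (continuous_coneSlice n))
    have ha2d : ∀ r, HasDerivAt a2 (2 * c r) r := fun r => by
      have := hasDerivAt_integral_cornerMeasure (F := fun r y => U r y ^ 2)
        (F' := fun r y => 2 * (V r y * U r y)) hU2
        (show Continuous fun p : ℝ × (Fin n → ℝ) => 2 * Function.uncurry (fun r y => V r y * U r y) p
          from continuous_const.mul hVU) (fun r y => by
          refine ((hUV r y).pow 2).congr_deriv ?_
          simp only [Nat.cast_ofNat, Nat.add_one_sub_one, pow_one]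
          ring) r
      simpa only [integral_const_mul] using this
    have hkb : ∀ r, b r ^ 2 ≤ k r := fun r => by
      have := cov_le (hVr r) (hVr r) 0
      simp only [mul_zero, zero_mul, sub_zero, ne_eq, OfNat.ofNat_ne_zero, not_false_eq_true,
        zero_pow, add_zero] at this
      exact sub_nonneg.1 this
    have hJ := weighted_poincare_interval n hab hb
    rw [integral_cornerMeasure_succ hc0, integral_cornerMeasure_succ (F := fun x => u x ^ 2) (hc0.pow 2),
      integral_cornerMeasure_succ (continuous_simplexGamma hu)]
    change ((n + 1 : ℕ) + 1 : ℝ) * ((∫ r in (0 : ℝ)..1, ((n + 1) * r ^ n) * a2 r) -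
      (∫ r in (0 : ℝ)..1, ((n + 1) * r ^ n) * a r) ^ 2) ≤
        ∫ r in (0 : ℝ)..1, ((n + 1) * r ^ n) * G r
    set h : ℝ → ℝ := fun r => a2 r - a r ^ 2 with hhdef
    have hh : Continuous h := ha2.sub (ha.pow 2)
    have hGk : ∀ r, r * G r = (∫ y, simplexGamma (U r) y ∂cornerMeasure n) +
        r ^ 2 * (1 - r) * k r := fun r => by
      simp only [hGdef, hkdef]
      rw [← integral_const_mul, ← integral_const_mul, ← integral_add]
      · exact integral_congr_ae (Filter.Eventually.of_forall fun y => simplexGamma_coneSlice hu r y)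
      · exact integrable_cornerMeasure (continuous_simplexGamma (hUs r))
      · exact (integrable_cornerMeasure ((hVr r).pow 2)).const_mul _
    have hih : ∀ r, ((n : ℝ) + 1) * h r ≤ ∫ y, simplexGamma (U r) y ∂cornerMeasure n :=
      fun r => ih (hUs r)
    -- the contribution of the variances on the slices
    suffices hmain : ((n : ℝ) + 2) * (∫ r in (0 : ℝ)..1, r ^ n * h r) +
        (∫ r in (0 : ℝ)..1, r ^ n * (r * (1 - r) * b r ^ 2)) ≤
        ∫ r in (0 : ℝ)..1, r ^ n * G r by
      have e1 : ∀ F : ℝ → ℝ, ∫ r in (0 : ℝ)..1, ((n + 1) * r ^ n) * F r =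
          (n + 1) * ∫ r in (0 : ℝ)..1, r ^ n * F r := fun F => by
        rw [← intervalIntegral.integral_const_mul]
        exact intervalIntegral.integral_congr fun r _ => by ring
      have e2 : ∫ r in (0 : ℝ)..1, r ^ n * h r =
          (∫ r in (0 : ℝ)..1, r ^ n * a2 r) - ∫ r in (0 : ℝ)..1, r ^ n * a r ^ 2 := by
        rw [← intervalIntegral.integral_sub]
        · exact intervalIntegral.integral_congr fun r _ => by simp only [hhdef]; ring
        all_goals exact Continuous.intervalIntegrable (by fun_prop) _ _
      have hpos : (0 : ℝ) ≤ n + 1 := by positivity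
      have := mul_le_mul_of_nonneg_left hmain hpos
      rw [e1 (fun r => a r ^ 2), e1 (fun r => r * (1 - r) * b r ^ 2)] at hJ
      rw [e1 a2, e1 G]
      rw [e2] at this
      push_cast
      linarith
    -- Zero-dimensional slices carry no variance; they are separated because the general argument
    -- divides the weight `r ^ n` by `r`.
    rcases n with _ | n
    · have hh0 : ∀ r, h r = 0 := fun r => by
        have h1 : ∀ y, U r y = U r 0 := fun y => by rw [Subsingleton.elim y 0]
        simp only [hhdef, ha2def, hadef]
        rw [integral_congr_ae (Filter.Eventually.of_forall h1),
          integral_congr_ae (Filter.Eventually.of_forall fun x => congrArg (· ^ 2) (h1 x))]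
        simp
      simp only [hh0, pow_zero, one_mul, mul_zero, intervalIntegral.integral_zero, zero_add]
      refine intervalIntegral.integral_mono_on_of_le_Ioo zero_le_one
        (Continuous.intervalIntegrable (by fun_prop) _ _)
        (Continuous.intervalIntegrable (by fun_prop) _ _) fun r hr => ?_
      have h1 := hih r
      rw [hh0 r, mul_zero] at h1
      have h2 := mul_le_mul_of_nonneg_left (hkb r)
        (mul_nonneg (sq_nonneg r) (sub_nonneg.2 hr.2.le))
      have h3 : r * (r * (1 - r) * b r ^ 2) ≤ r * G r := by rw [hGk r]; linarith
      exact le_of_mul_le_mul_left h3 hr.1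
    · have hhd : ∀ r, HasDerivAt h (2 * (c r - b r * a r)) r := fun r => by
        refine ((ha2d r).sub ((hab r).pow 2)).congr_deriv ?_
        simp only [Nat.cast_ofNat, Nat.add_one_sub_one, pow_one]
        ring
      -- This is `Var (U r - r V r) ≥ 0`, the variance of the linear extrapolation to the apex.
      -- Since `h' = 2 (c - b a)`, it reads `r² (k - b²) ≥ r h' - h`.
      have hcov : ∀ r, 0 ≤ h r - 2 * r * (c r - b r * a r) + r ^ 2 * (k r - b r ^ 2) :=
        fun r => cov_le (hVr r) (hUr r) r
      have hwd : ∀ r : ℝ, HasDerivAt (fun r : ℝ => (1 - r) * r ^ (n + 1))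
          ((n + 1) * (1 - r) * r ^ n - r ^ (n + 1)) r := fun r => by
        refine (((hasDerivAt_id r).const_sub 1).mul (hasDerivAt_pow (n + 1) r)).congr_deriv ?_
        simp only [id, Nat.add_sub_cancel]
        push_cast
        ring
      -- Integration by parts trades `h'` for `h`, without boundary terms as the factor `(1 - r) r ^
      -- (n + 1)` vanishes at both ends. The coefficients of `h` then add up to exactly `(n + 3) r ^
      -- (n + 1)`.
      have hibp := intervalIntegral.integral_mul_deriv_eq_deriv_mul (a := 0) (b := 1)
        (u := fun r : ℝ => (1 - r) * r ^ (n + 1)) (v := h) (fun x _ => hwd x) (fun x _ => hhd x)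
        (Continuous.intervalIntegrable (by fun_prop) _ _)
        (Continuous.intervalIntegrable (by fun_prop) _ _)
      simp only [sub_self, zero_mul, ne_eq, Nat.add_eq_zero_iff, one_ne_zero, and_false,
        not_false_eq_true, zero_pow, mul_zero, sub_zero, zero_sub] at hibp
      have hlow : ∫ r in (0 : ℝ)..1, ((n + 2) * (r ^ n * h r) +
          ((1 - r) * r ^ (n + 1) * (2 * (c r - b r * a r)) - (1 - r) * r ^ n * h r) +
          r ^ (n + 1) * (r * (1 - r) * b r ^ 2)) ≤ ∫ r in (0 : ℝ)..1, r ^ (n + 1) * G r := by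
        refine intervalIntegral.integral_mono_on zero_le_one
          (Continuous.intervalIntegrable (by fun_prop) _ _)
          (Continuous.intervalIntegrable (by fun_prop) _ _) fun r hr => ?_
        have hrn : 0 ≤ r ^ n := pow_nonneg hr.1 n
        have h1 := mul_le_mul_of_nonneg_left (hih r) hrn
        have h2 := mul_nonneg (mul_nonneg hrn (sub_nonneg.2 hr.2)) (hcov r)
        have h3 : r ^ (n + 1) * G r = r ^ n * ((∫ y, simplexGamma (U r) y ∂cornerMeasure (n + 1)) +
          r ^ 2 * (1 - r) * k r) := by rw [← hGk r]; ring
        rw [h3]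
        push_cast at h1
        ring_nf at h1 h2 ⊢
        linarith
      refine le_trans (le_of_eq ?_) hlow
      have i1 : IntervalIntegrable (fun r : ℝ => (n + 2) * (r ^ n * h r)) volume 0 1 :=
        Continuous.intervalIntegrable (by fun_prop) _ _
      have i2 : IntervalIntegrable (fun r : ℝ => (1 - r) * r ^ (n + 1) * (2 * (c r - b r * a r)))
        volume 0 1 := Continuous.intervalIntegrable (by fun_prop) _ _
      have i3 : IntervalIntegrable (fun r : ℝ => (1 - r) * r ^ n * h r) volume 0 1 :=
        Continuous.intervalIntegrable (by fun_prop) _ _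
      have i4 : IntervalIntegrable (fun r : ℝ => r ^ (n + 1) * (r * (1 - r) * b r ^ 2))
        volume 0 1 := Continuous.intervalIntegrable (by fun_prop) _ _
      rw [intervalIntegral.integral_add (i1.add (i2.sub i3)) i4,
        intervalIntegral.integral_add i1 (i2.sub i3), intervalIntegral.integral_sub i2 i3, hibp]
      rw [add_left_inj, ← intervalIntegral.integral_neg,
        ← intervalIntegral.integral_sub (Continuous.intervalIntegrable (by fun_prop) _ _) i3,
        ← intervalIntegral.integral_add i1 (Continuous.intervalIntegrable (by fun_prop) _ _),
        ← intervalIntegral.integral_const_mul]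
      refine intervalIntegral.integral_congr fun r _ => ?_
      push_cast
      ring


/-! ### Wirtinger's inequality, for the one-dimensional case. -/

/-- Wirtinger's inequality on a half interval, for functions vanishing at one end. -/
theorem wirtinger_half {a b : ℝ → ℝ} (hab : ∀ r, HasDerivAt a (b r) r) (hb : Continuous b)
    (h0 : a 0 = 0) :
    Real.pi ^ 2 * ∫ r in (0 : ℝ)..(1 / 2), a r ^ 2 ≤ ∫ r in (0 : ℝ)..(1 / 2), b r ^ 2 := by
  have ha : Continuous a := continuous_iff_continuousAt.2 fun r => (hab r).continuousAt
  have hpi := Real.pi_pos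
  have hsin : ∀ r ∈ Set.Ioc (0 : ℝ) (1 / 2), 0 < Real.sin (Real.pi * r) := fun r hr =>
    Real.sin_pos_of_pos_of_lt_pi (mul_pos hpi hr.1) (by nlinarith [hr.2])
  -- Jacobi's trick: `F = π a² cot(π r)` completes the square, `b² - π² a² = F' + (b - π a cot(π
  -- r))²`, and `F` vanishes at both ends, so the integral of the left-hand side is nonnegative.
  set F : ℝ → ℝ := fun r => Real.pi * (a r ^ 2 * Real.cos (Real.pi * r) / Real.sin (Real.pi * r))
    with hF
  have hFd : ∀ r ∈ Set.Ioc (0 : ℝ) (1 / 2), HasDerivAt F (b r ^ 2 - Real.pi ^ 2 * a r ^ 2 -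
      (b r - Real.pi * a r * Real.cos (Real.pi * r) / Real.sin (Real.pi * r)) ^ 2) r := by
    intro r hr
    have hs := (hsin r hr).ne'
    have h1 : HasDerivAt (fun r : ℝ => Real.pi * r) Real.pi r := by
      simpa using (hasDerivAt_id r).const_mul Real.pi
    have h2 := ((((hab r).pow 2).mul h1.cos).div h1.sin hs).const_mul Real.pi
    refine h2.congr_deriv ?_
    simp only [Nat.cast_ofNat, Nat.add_one_sub_one, pow_one, Pi.mul_apply, Pi.pow_apply]
    field_simp
    ring
  -- The value at `0` comes from division by zero being `0`; it is also the limit, because `a t =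
  -- O(t)` and `t ≤ sin(π t)`, as the continuity proof shows.
  have hF0 : F 0 = 0 := by simp [hF]
  have hF1 : F (1 / 2) = 0 := by
    simp only [hF, mul_one_div, Real.cos_pi_div_two]; simp
  have hcont : ContinuousOn F (Set.Icc 0 (1 / 2)) := by
    intro r hr
    rcases hr.1.eq_or_lt with rfl | hpos
    · obtain ⟨C, hC⟩ := (isCompact_Icc (a := (0 : ℝ)) (b := 1 / 2)).exists_bound_of_continuousOn
        hb.continuousOn
      have hC0 : 0 ≤ C := (norm_nonneg _).trans (hC 0 ⟨le_rfl, by norm_num⟩)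
      have hbound : ∀ t ∈ Set.Icc (0 : ℝ) (1 / 2), |F t| ≤ Real.pi * C ^ 2 * t := by
        intro t ht
        rcases ht.1.eq_or_lt with rfl | htpos
        · simp [hF0]
        have h1 : |a t| ≤ C * t := by
          have := norm_image_sub_le_of_norm_deriv_le_segment' (f := a) (f' := b) (a := 0) (b := t)
            (C := C) (fun x _ => (hab x).hasDerivWithinAt)
            (fun x hx => hC x ⟨hx.1, hx.2.le.trans ht.2⟩) t ⟨htpos.le, le_rfl⟩
          simpa [h0] using this
        have h2 : t ≤ Real.sin (Real.pi * t) := by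
          have := Real.mul_le_sin (x := Real.pi * t) (by positivity) (by nlinarith [ht.2])
          have e : 2 / Real.pi * (Real.pi * t) = 2 * t := by field_simp
          rw [e] at this
          linarith
        have hs : 0 < Real.sin (Real.pi * t) := lt_of_lt_of_le htpos h2
        rw [hF, abs_mul, abs_div, abs_mul, abs_of_pos hpi, abs_of_pos hs, mul_assoc]
        refine mul_le_mul_of_nonneg_left ?_ hpi.le
        rw [div_le_iff₀ hs, abs_pow]
        have h3 : |a t| ^ 2 ≤ (C * t) ^ 2 := pow_le_pow_left₀ (abs_nonneg _) h1 2
        have h4 : |a t| ^ 2 * |Real.cos (Real.pi * t)| ≤ |a t| ^ 2 * 1 :=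
          mul_le_mul_of_nonneg_left (Real.abs_cos_le_one _) (sq_nonneg _)
        have h5 : C ^ 2 * t * t ≤ C ^ 2 * t * Real.sin (Real.pi * t) :=
          mul_le_mul_of_nonneg_left h2 (mul_nonneg (sq_nonneg _) htpos.le)
        nlinarith
      rw [ContinuousWithinAt, hF0, tendsto_zero_iff_abs_tendsto_zero]
      refine squeeze_zero' (Filter.Eventually.of_forall fun _ => abs_nonneg _)
        (eventually_nhdsWithin_of_forall hbound) ?_
      have : Continuous fun t : ℝ => Real.pi * C ^ 2 * t := by fun_prop
      simpa using (this.tendsto 0).mono_left nhdsWithin_le_nhds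
    · exact (hFd r ⟨hpos, hr.2⟩).continuousAt.continuousWithinAt
  -- The one-sided form of the fundamental theorem needs only the upper bound on `F'`, not its
  -- integrability near `0`.
  have key := intervalIntegral.sub_le_integral_of_hasDeriv_right_of_le (a := 0) (b := 1 / 2)
    (by norm_num) hcont (fun x hx => (hFd x ⟨hx.1, hx.2.le⟩).hasDerivWithinAt)
    (φ := fun r => b r ^ 2 - Real.pi ^ 2 * a r ^ 2)
    (Continuous.integrableOn_Icc (by fun_prop))
    (fun x _ => sub_le_self _ (sq_nonneg _))
  rw [hF0, hF1, sub_zero, intervalIntegral.integral_sub, intervalIntegral.integral_const_mul] at key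
  · linarith
  all_goals exact Continuous.intervalIntegrable (by fun_prop) _ _

/-- The Poincaré–Wirtinger inequality on `[0, 1]` with the sharp constant. -/
theorem wirtinger_interval {a b : ℝ → ℝ} (hab : ∀ r, HasDerivAt a (b r) r) (hb : Continuous b) :
    Real.pi ^ 2 * ((∫ r in (0 : ℝ)..1, a r ^ 2) - (∫ r in (0 : ℝ)..1, a r) ^ 2) ≤
      ∫ r in (0 : ℝ)..1, b r ^ 2 := by
  have ha : Continuous a := continuous_iff_continuousAt.2 fun r => (hab r).continuousAt
  -- Subtracting the midpoint value makes the function vanish at one end of each half. The extremal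
  -- `cos(π r)` vanishes there, so the split costs nothing.
  set m := a (1 / 2) with hm
  have h1 := wirtinger_half (a := fun r => a (1 / 2 + r) - m) (b := fun r => b (1 / 2 + r))
    (fun r => ((hab (1 / 2 + r)).comp_const_add (1 / 2) r).sub_const m) (by fun_prop)
    (by simp [hm])
  have h2 := wirtinger_half (a := fun r => a (1 / 2 - r) - m) (b := fun r => - b (1 / 2 - r))
    (fun r => ((hab (1 / 2 - r)).comp_const_sub (1 / 2) r).sub_const m) (by fun_prop)
    (by simp [hm])
  rw [intervalIntegral.integral_comp_add_left (fun r => (a r - m) ^ 2),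
    intervalIntegral.integral_comp_add_left (fun r => b r ^ 2)] at h1
  simp only [neg_sq] at h2
  rw [intervalIntegral.integral_comp_sub_left (fun r => (a r - m) ^ 2),
    intervalIntegral.integral_comp_sub_left (fun r => b r ^ 2)] at h2
  norm_num at h1 h2
  have hi : ∀ f : ℝ → ℝ, Continuous f → (∫ r in (0 : ℝ)..(1 / 2), f r) +
      ∫ r in (1 / 2 : ℝ)..1, f r = ∫ r in (0 : ℝ)..1, f r := fun f hf =>
    intervalIntegral.integral_add_adjacent_intervals (hf.intervalIntegrable _ _)
      (hf.intervalIntegrable _ _)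
  have e1 := hi (fun r => (a r - m) ^ 2) (by fun_prop)
  have e2 := hi (fun r => b r ^ 2) (by fun_prop)
  have e3 : ∫ r in (0 : ℝ)..1, (a r - m) ^ 2 = (∫ r in (0 : ℝ)..1, a r ^ 2) -
      2 * m * (∫ r in (0 : ℝ)..1, a r) + m ^ 2 := by
    have : ∀ r, (a r - m) ^ 2 = a r ^ 2 - 2 * m * a r + m ^ 2 := fun r => by ring
    simp only [this]
    rw [intervalIntegral.integral_add, intervalIntegral.integral_sub,
      intervalIntegral.integral_const_mul, intervalIntegral.integral_const]
    · simp
    all_goals exact Continuous.intervalIntegrable (by fun_prop) _ _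
  have h3 : (∫ r in (0 : ℝ)..1, a r ^ 2) - (∫ r in (0 : ℝ)..1, a r) ^ 2 ≤
      ∫ r in (0 : ℝ)..1, (a r - m) ^ 2 := by
    rw [e3]; nlinarith [sq_nonneg ((∫ r in (0 : ℝ)..1, a r) - m)]
  have h4 := mul_le_mul_of_nonneg_left h3 (sq_nonneg Real.pi)
  rw [← e1] at h4
  rw [← e2]
  norm_num at h4 ⊢
  linarith

/-- The Poincaré inequality with the sharp constant on the one-dimensional corner simplex. -/
theorem poincare_cornerMeasure_one {u : (Fin 1 → ℝ) → ℝ} (hu : ContDiff ℝ 1 u) :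
    Real.pi ^ 2 * ((∫ x, u x ^ 2 ∂cornerMeasure 1) - (∫ x, u x ∂cornerMeasure 1) ^ 2) ≤
      ∫ x, fderiv ℝ u x (Pi.single 0 1) ^ 2 ∂cornerMeasure 1 := by
  have hc := hu.continuous
  have hc' := hu.continuous_fderiv one_ne_zero
  rw [integral_cornerMeasure_succ hc,
    integral_cornerMeasure_succ (F := fun x => u x ^ 2) (by fun_prop),
    integral_cornerMeasure_succ (F := fun x => fderiv ℝ u x (Pi.single 0 1) ^ 2) (by fun_prop)]
  have e : ∀ (F : (Fin 1 → ℝ) → ℝ) (r : ℝ), ((0 : ℕ) + 1 : ℝ) * r ^ 0 *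
      ∫ y, F (Fin.cons (1 - r) (r • y)) ∂cornerMeasure 0 = F (coneSlice r 0) := fun F r => by
    have : ∀ y : Fin 0 → ℝ, F (Fin.cons (1 - r) (r • y)) = F (coneSlice r 0) := fun y => by
      rw [Subsingleton.elim y 0]; rfl
    rw [integral_congr_ae (Filter.Eventually.of_forall this), integral_const, probReal_univ,
      one_smul, Nat.cast_zero, zero_add, pow_zero, one_mul, one_mul]
  have e1 : ∀ F : (Fin 1 → ℝ) → ℝ, ∫ r in (0 : ℝ)..1, ((0 : ℕ) + 1 : ℝ) * r ^ 0 *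
      ∫ y, F (Fin.cons (1 - r) (r • y)) ∂cornerMeasure 0 =
      ∫ r in (0 : ℝ)..1, F (coneSlice r 0) := fun F => by simp only [e F]
  rw [e1 (fun x => u x ^ 2), e1 u, e1 (fun x => fderiv ℝ u x (Pi.single 0 1) ^ 2)]
  have hcs : Continuous fun r : ℝ => (coneSlice r 0 : Fin 1 → ℝ) :=
    (continuous_coneSlice 0).comp (Continuous.prodMk_left 0)
  refine (wirtinger_interval (hasDerivAt_comp_coneSlice hu · 0)
    ((continuous_deriv_coneSlice hu).comp (Continuous.prodMk_left 0))).trans (le_of_eq ?_)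
  refine intervalIntegral.integral_congr fun r _ => ?_
  have : (Fin.cons (-1) 0 : Fin 1 → ℝ) = - Pi.single 0 1 := by
    ext i; refine Fin.cases ?_ (fun j => j.elim0) i; simp
  simp only [this, map_neg, neg_sq]


/-! ### Affine charts of simplices and the Poincaré inequality on a mesh element. -/

section Apex

variable {V : Type*} {n : ℕ}

/-- The vertices `v` of a face, completed by the opposite vertex `a`. -/
def addApex (a : V) (v : Fin (n + 1) → V) : Fin (n + 2) → V :=
  Fin.cons (v 0) (Fin.cons a (Fin.tail v))

theorem range_addApex (a : V) (v : Fin (n + 1) → V) :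
    Set.range (addApex a v) = insert a (Set.range v) := by
  ext x
  simp only [Set.mem_range, Set.mem_insert_iff, Fin.exists_fin_succ, addApex, Fin.cons_zero,
    Fin.cons_succ, Fin.tail, eq_comm (a := x)]
  tauto

end Apex

section Chart

variable {V : Type*} [NormedAddCommGroup V] [NormedSpace ℝ V] {n : ℕ}

/-- The affine parametrization of the simplex with vertices `w` over the corner simplex. -/
def simplexChart (w : Fin (n + 1) → V) (x : Fin n → ℝ) : V :=
  w 0 + ∑ i, x i • (w i.succ - w 0)

theorem contDiff_simplexChart (w : Fin (n + 1) → V) {k : WithTop ℕ∞} :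
    ContDiff ℝ k (simplexChart w) := by
  unfold simplexChart; fun_prop

theorem simplexChart_sub (w : Fin (n + 1) → V) (x y : Fin n → ℝ) :
    simplexChart w x - simplexChart w y = ∑ i, (x - y) i • (w i.succ - w 0) := by
  simp [simplexChart, sub_smul, Finset.sum_sub_distrib]

theorem simplexChart_eq_sum (w : Fin (n + 1) → V) (x : Fin n → ℝ) :
    simplexChart w x = ∑ i, (Fin.cons (1 - ∑ j, x j) x : Fin (n + 1) → ℝ) i • w i := by
  simp only [simplexChart, Fin.sum_univ_succ, Fin.cons_zero, Fin.cons_succ, smul_sub,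
    Finset.sum_sub_distrib, sub_smul, one_smul, Finset.sum_smul]
  abel

theorem simplexChart_zero (w : Fin (n + 1) → V) : simplexChart w 0 = w 0 := by
  simp [simplexChart]

theorem simplexChart_single (w : Fin (n + 1) → V) (i : Fin n) :
    simplexChart w (Pi.single i 1) = w i.succ := by
  simp [simplexChart, Pi.single_apply]

theorem fderiv_simplexChart (w : Fin (n + 1) → V) (x v : Fin n → ℝ) :
    fderiv ℝ (simplexChart w) x v = ∑ i, v i • (w i.succ - w 0) := by
  let L : (Fin n → ℝ) →L[ℝ] V :=
    ∑ i, (ContinuousLinearMap.proj (R := ℝ) (φ := fun _ : Fin n => ℝ) i).smulRight (w i.succ - w 0)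
  have h : simplexChart w = fun x => w 0 + L x := by
    ext x; simp [simplexChart, L]
  have h2 : HasFDerivAt (simplexChart w) L x := by
    rw [h]; exact L.hasFDerivAt.const_add (w 0)
  rw [h2.fderiv]
  simp [L]

theorem image_simplexChart (w : Fin (n + 1) → V) :
    simplexChart w '' cornerSimplex n = convexHull ℝ (Set.range w) := by
  refine Set.Subset.antisymm ?_ (convexHull_min ?_ ?_)
  · rintro _ ⟨x, hx, rfl⟩
    rw [simplexChart_eq_sum]
    refine (convex_convexHull ℝ _).sum_mem (fun i _ => ?_) ?_
      (fun i _ => subset_convexHull ℝ _ ⟨i, rfl⟩)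
    · refine Fin.cases ?_ (fun j => ?_) i
      · simpa using hx.2
      · simpa using hx.1 j
    · simp [Fin.sum_univ_succ]
  · rintro _ ⟨i, rfl⟩
    refine Fin.cases ?_ (fun j => ?_) i
    · exact ⟨0, by simp [cornerSimplex], simplexChart_zero w⟩
    · exact ⟨Pi.single j 1, ⟨fun i => by
        by_cases h : i = j
        · subst h; simp
        · simp [h], by simp⟩, simplexChart_single w j⟩
  · rintro _ ⟨x, hx, rfl⟩ _ ⟨y, hy, rfl⟩ a b ha hb hab
    refine ⟨a • x + b • y, ⟨fun i => ?_, ?_⟩, ?_⟩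
    · have := mul_nonneg ha (hx.1 i)
      have := mul_nonneg hb (hy.1 i)
      simp only [Pi.add_apply, Pi.smul_apply, smul_eq_mul]
      linarith
    · simp only [Pi.add_apply, Pi.smul_apply, smul_eq_mul, Finset.sum_add_distrib,
        ← Finset.mul_sum]
      nlinarith [hx.2, hy.2]
    · have : w 0 = a • w 0 + b • w 0 := by rw [← add_smul, hab, one_smul]
      simp only [simplexChart, Pi.add_apply, Pi.smul_apply, smul_eq_mul, add_smul, mul_smul,
        Finset.sum_add_distrib, ← Finset.smul_sum, smul_add]
      nth_rewrite 1 [this]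
      abel

/-- This is the reason for placing the apex second in `addApex`: the origin of the chart stays on
the face, and the facet `x₀ = 0`, opposite to the corner `e₀` that is sent to `a`, carries the chart
of the face itself. -/
theorem simplexChart_addApex (a : V) (v : Fin (n + 1) → V) (y : Fin n → ℝ) :
    simplexChart (addApex a v) (Fin.cons 0 y) = simplexChart v y := by
  simp [simplexChart, addApex, Fin.sum_univ_succ, Fin.tail]

end Chart

section Cell

variable {d : ℕ}

/-- Mean values over a simplex in the coordinates of its chart. -/
theorem mean_convexHull_range {w : Fin (d + 1) → E d} (hw : AffineIndependent ℝ w) :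
    0 < volume.real (convexHull ℝ (Set.range w)) ∧ ∀ F : E d → ℝ,
      (∫ x in convexHull ℝ (Set.range w), F x) / volume.real (convexHull ℝ (Set.range w)) =
        ∫ x, F (simplexChart w x) ∂cornerMeasure d := by
  set C := convexHull ℝ (Set.range w) with hC
  have li : LinearIndependent ℝ (fun i : Fin d => w i.succ - w 0) :=
    ((affineIndependent_iff_linearIndependent_vsub ℝ w 0).1 hw).comp
      (fun i : Fin d => (⟨i.succ, Fin.succ_ne_zero i⟩ : {x : Fin (d + 1) // x ≠ 0}))
      (fun i j h => by simpa using h)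
  rw [linearIndependent_iff_injective_fintypeLinearCombination] at li
  let L : (Fin d → ℝ) ≃L[ℝ] E d :=
    (LinearMap.linearEquivOfInjective _ li (by simp)).toContinuousLinearEquiv
  let A : (Fin d → ℝ) ≃ₜ E d := L.toHomeomorph.trans (Homeomorph.addLeft (w 0))
  have hA : ∀ x, A x = simplexChart w x := fun x => by
    simp [A, L, simplexChart, Fintype.linearCombination_apply]
  have hme : MeasurableEmbedding A := A.measurableEmbedding
  -- The Jacobian is never computed: uniqueness of Haar measure gives some constant, and it cancels
  -- in a mean value.
  have hmap : ∃ c : NNReal, (volume : Measure (Fin d → ℝ)).map A =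
      c • (volume : Measure (E d)) := by
    refine ⟨Measure.addHaarScalarFactor ((volume : Measure (Fin d → ℝ)).map L) volume, ?_⟩
    have h1 : (volume : Measure (Fin d → ℝ)).map A =
        ((volume : Measure (Fin d → ℝ)).map L).map (w 0 + ·) := by
      rw [Measure.map_map (by fun_prop) L.continuous.measurable]; rfl
    rw [h1, map_add_left_eq_self]
    exact Measure.isAddLeftInvariant_eq_smul _ _
  obtain ⟨c, hc⟩ := hmap
  have hpre : A ⁻¹' C = cornerSimplex d := by
    have : (A : (Fin d → ℝ) → E d) = simplexChart w := funext hA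
    rw [hC, ← image_simplexChart w, ← this, Set.preimage_image_eq _ A.injective]
  have key : ∀ F : E d → ℝ, (c : ℝ) * ∫ x in C, F x =
      ∫ x in cornerSimplex d, F (simplexChart w x) := fun F => by
    have := hme.setIntegral_map (μ := volume) F C
    rw [hpre, hc, Measure.restrict_smul, integral_smul_nnreal_measure] at this
    simp only [hA] at this
    rw [← this]; rfl
  have hvol := key (fun _ => 1)
  simp only [integral_const, MeasurableSet.univ, measureReal_restrict_apply, Set.univ_inter,
    smul_eq_mul, mul_one] at hvol
  have hS := volume_real_cornerSimplex_pos d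
  rw [← hvol] at hS
  have hCpos : 0 < volume.real C := pos_of_mul_pos_right hS c.2
  refine ⟨hCpos, fun F => ?_⟩
  have hcpos : (c : ℝ) ≠ 0 := fun h => by rw [h, zero_mul] at hS; exact lt_irrefl _ hS
  rw [integral_cornerMeasure, ← key, ← hvol]
  field_simp

theorem fderiv_comp_simplexChart {n : ℕ} {φ : E d → ℝ} (hφ : ContDiff ℝ 1 φ)
    (w : Fin (n + 1) → E d) (x v : Fin n → ℝ) :
    fderiv ℝ (fun x => φ (simplexChart w x)) x v =
      inner ℝ (gradient φ (simplexChart w x)) (∑ i, v i • (w i.succ - w 0)) := by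
  have h1 := (hφ.differentiable one_ne_zero).differentiableAt (x := simplexChart w x)
  have h2 := ((contDiff_simplexChart w (k := 1)).differentiable one_ne_zero).differentiableAt
    (x := x)
  have := fderiv_comp x h1 h2
  have e : φ ∘ simplexChart w = fun x => φ (simplexChart w x) := rfl
  rw [e] at this
  rw [this, ContinuousLinearMap.comp_apply, fderiv_simplexChart, gradient,
    InnerProductSpace.toDual_symm_apply]

/-- With `z i` the largest and `z j` the smallest value, averaging `(z i - z k) (z k - z j) ≥ 0`
bounds the variance by the product of the distances from the mean to the two extremes, hence by a
quarter of the squared range. -/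
theorem popoviciu_le {ι : Type*} [Fintype ι] {c z : ι → ℝ} (hc : ∀ i, 0 ≤ c i)
    (hc1 : ∑ i, c i = 1) {D : ℝ} (hz : ∀ i j, z i - z j ≤ D) :
    ∑ i, c i * z i ^ 2 - (∑ i, c i * z i) ^ 2 ≤ D ^ 2 / 4 := by
  have : Nonempty ι := by
    by_contra h
    rw [not_nonempty_iff] at h
    simp at hc1
  obtain ⟨i, hi⟩ := Finite.exists_max z
  obtain ⟨j, hj⟩ := Finite.exists_min z
  set zb := ∑ i, c i * z i with hzb
  have h0 : 0 ≤ ∑ k, c k * ((z i - z k) * (z k - z j)) := Finset.sum_nonneg fun k _ =>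
    mul_nonneg (hc k) (mul_nonneg (sub_nonneg.2 (hi k)) (sub_nonneg.2 (hj k)))
  have h1 : ∑ k, c k * ((z i - z k) * (z k - z j)) =
      (z i + z j) * zb - z i * z j - ∑ k, c k * z k ^ 2 := by
    have : ∀ k, c k * ((z i - z k) * (z k - z j)) =
        (z i + z j) * (c k * z k) - (z i * z j) * c k - c k * z k ^ 2 := fun k => by ring
    simp only [this, Finset.sum_sub_distrib, ← Finset.mul_sum, hc1, mul_one, hzb]
  have h2 : (z i - z j) ^ 2 ≤ D ^ 2 :=
    pow_le_pow_left₀ (sub_nonneg.2 (hj i)) (hz i j) 2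
  nlinarith [sq_nonneg (z i + z j - 2 * zb)]

/-- The Poincaré inequality on a simplex with the constant `diam / π`, in mean value form. -/
theorem poincare_simplexChart (hd : 1 ≤ d) (w : Fin (d + 1) → E d) {D : ℝ}
    (hD : ∀ i j, dist (w i) (w j) ≤ D) {φ : E d → ℝ} (hφ : ContDiff ℝ 1 φ) :
    (∫ x, φ (simplexChart w x) ^ 2 ∂cornerMeasure d) -
        (∫ x, φ (simplexChart w x) ∂cornerMeasure d) ^ 2 ≤
      D ^ 2 / Real.pi ^ 2 *
        ∫ x, ‖gradient φ (simplexChart w x)‖ ^ 2 ∂cornerMeasure d := by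
  have hpi := Real.pi_pos
  have hA : ContDiff ℝ 1 (simplexChart w) := contDiff_simplexChart w
  have hu : ContDiff ℝ 1 (fun x => φ (simplexChart w x)) := hφ.comp hA
  have hg : Continuous fun x => gradient φ (simplexChart w x) :=
    ((InnerProductSpace.toDual ℝ (E d)).symm.continuous.comp
      (hφ.continuous_fderiv one_ne_zero)).comp hA.continuous
  have hD0 : 0 ≤ D := dist_nonneg.trans (hD 0 0)
  have hz : ∀ (g : E d) i j, inner ℝ g (w i - w 0) - inner ℝ g (w j - w 0) ≤ ‖g‖ * D :=
    fun g i j => by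
      rw [← inner_sub_right, sub_sub_sub_cancel_right]
      refine (real_inner_le_norm _ _).trans (mul_le_mul_of_nonneg_left ?_ (norm_nonneg _))
      rw [← dist_eq_norm]; exact hD i j
  have hsing : ∀ x (i : Fin d), fderiv ℝ (fun x => φ (simplexChart w x)) x (Pi.single i 1) =
      inner ℝ (gradient φ (simplexChart w x)) (w i.succ - w 0) := fun x i => by
    rw [fderiv_comp_simplexChart hφ]
    congr 1
    simp [Pi.single_apply]
  -- The general route yields `D² / (4 (d + 1))`. For `d ≥ 2` the denominator is at least `12 > π²`,
  -- but for `d = 1` it is `8 < π²`.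
  rcases hd.eq_or_lt with rfl | hd2
  · have h1 := poincare_cornerMeasure_one hu
    rw [div_mul_eq_mul_div, le_div_iff₀ (by positivity), mul_comm]
    refine h1.trans ?_
    rw [← integral_const_mul]
    have hu' := hu.continuous_fderiv one_ne_zero
    refine integral_mono (integrable_cornerMeasure (by fun_prop))
      (integrable_cornerMeasure (by fun_prop)) fun x => ?_
    simp only [hsing]
    rw [← mul_pow, ← sq_abs (inner ℝ _ _)]
    refine pow_le_pow_left₀ (abs_nonneg _) ((abs_real_inner_le_norm _ _).trans ?_) 2
    rw [mul_comm]
    refine mul_le_mul_of_nonneg_right ?_ (norm_nonneg _)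
    rw [← dist_eq_norm]; exact hD _ _
  · have h1 := poincare_cornerMeasure d hu
    have h2 : ∫ x, simplexGamma (fun x => φ (simplexChart w x)) x ∂cornerMeasure d ≤
        D ^ 2 / 4 * ∫ x, ‖gradient φ (simplexChart w x)‖ ^ 2 ∂cornerMeasure d := by
      rw [← integral_const_mul]
      refine integral_mono_ae (integrable_cornerMeasure (continuous_simplexGamma hu))
        (integrable_cornerMeasure (by fun_prop)) ?_
      filter_upwards [ae_cornerMeasure_mem d] with x hx
      -- The carré du champ at `x` is the variance of the derivatives along `w i - w 0`, weighted by
      -- the barycentric coordinates of the point; the vertex `w 0` contributes the value `0`. Their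
      -- range is at most `‖∇φ‖ D`.
      have hp := popoviciu_le (c := (Fin.cons (1 - ∑ j, x j) x : Fin (d + 1) → ℝ))
        (z := fun i => inner ℝ (gradient φ (simplexChart w x)) (w i - w 0))
        (fun i => by
          refine Fin.cases ?_ (fun j => ?_) i
          · simpa using hx.2
          · simpa using hx.1 j) (by simp [Fin.sum_univ_succ]) (hz (gradient φ (simplexChart w x)))
      simp only [Fin.sum_univ_succ, Fin.cons_zero, Fin.cons_succ, sub_self, inner_zero_right] at hp
      simp only [simplexGamma, hsing, fderiv_comp_simplexChart hφ, inner_sum, real_inner_smul_right]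
      refine (le_of_eq ?_).trans (hp.trans (le_of_eq ?_)) <;> ring
    have h3 : 0 ≤ ∫ x, ‖gradient φ (simplexChart w x)‖ ^ 2 ∂cornerMeasure d :=
      integral_nonneg fun x => sq_nonneg _
    have hd3 : (3 : ℝ) ≤ d + 1 := by
      have : (2 : ℝ) ≤ d := by exact_mod_cast hd2
      linarith
    have h4 := h1.trans h2
    rw [← le_div_iff₀' (by linarith)] at h4
    refine h4.trans ?_
    rw [mul_div_right_comm]
    refine mul_le_mul_of_nonneg_right ?_ h3
    rw [div_div]
    refine div_le_div_of_nonneg_left (sq_nonneg _) (by positivity) ?_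
    nlinarith [Real.pi_lt_d2]

theorem exists_vertices (K : Finset (E d)) {m : ℕ} (hcard : K.card = m) :
    ∃ w : Fin m → E d, Function.Injective w ∧ Set.range w = (K : Set (E d)) := by
  subst hcard
  refine ⟨fun i => K.equivFin.symm i, fun i j h => ?_, ?_⟩
  · exact K.equivFin.symm.injective (Subtype.ext h)
  · ext x
    constructor
    · rintro ⟨i, rfl⟩; exact (K.equivFin.symm i).2
    · intro hx; exact ⟨K.equivFin ⟨x, hx⟩, by simp⟩

theorem affineIndependent_of_range_eq {K : Finset (E d)}
    (hK : AffineIndependent ℝ ((↑) : K → E d)) {m : ℕ} {w : Fin m → E d}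
    (hw : Function.Injective w) (hr : Set.range w = (K : Set (E d))) : AffineIndependent ℝ w := by
  have hmem : ∀ i, w i ∈ K := fun i => by
    have : w i ∈ (K : Set (E d)) := hr ▸ ⟨i, rfl⟩
    exact this
  exact hK.comp_embedding ⟨fun i => (⟨w i, hmem i⟩ : K), fun i j h => hw (Subtype.ext_iff.1 h)⟩

theorem volume_real_cell_pos {K : Finset (E d)} (hcard : K.card = d + 1)
    (hK : AffineIndependent ℝ ((↑) : K → E d)) : 0 < volume.real (cell K) := by
  obtain ⟨w, hw, hr⟩ := exists_vertices K hcard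
  have := (mean_convexHull_range (affineIndependent_of_range_eq hK hw hr)).1
  rwa [hr] at this

theorem isCompact_cell (K : Finset (E d)) : IsCompact (cell K) :=
  K.finite_toSet.isCompact_convexHull ℝ

theorem continuous_gradient {φ : E d → ℝ} (hφ : ContDiff ℝ 1 φ) : Continuous (gradient φ) :=
  (InnerProductSpace.toDual ℝ (E d)).symm.continuous.comp (hφ.continuous_fderiv one_ne_zero)

/-- The Poincaré inequality on a simplex with the constant `diam / π`. -/
theorem poincare_cell (hd : 1 ≤ d) {K : Finset (E d)} (hcard : K.card = d + 1)
    (hK : AffineIndependent ℝ ((↑) : K → E d)) {φ : E d → ℝ} (hφ : ContDiff ℝ 1 φ) :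
    ∫ x in cell K, (φ x - cellMean K φ) ^ 2 ≤
      Metric.diam (cell K) ^ 2 / Real.pi ^ 2 * ∫ x in cell K, ‖gradient φ x‖ ^ 2 := by
  obtain ⟨w, hw, hr⟩ := exists_vertices K hcard
  obtain ⟨hpos, hmean⟩ := mean_convexHull_range (affineIndependent_of_range_eq hK hw hr)
  rw [hr] at hpos hmean
  change 0 < volume.real (cell K) at hpos
  change ∀ F : E d → ℝ, (∫ x in cell K, F x) / volume.real (cell K) = _ at hmean
  have hc := isCompact_cell K
  have hmem : ∀ i, w i ∈ cell K := fun i => subset_convexHull ℝ _ (hr ▸ ⟨i, rfl⟩)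
  have h := poincare_simplexChart hd w
    (fun i j => Metric.dist_le_diam_of_mem hc.isBounded (hmem i) (hmem j)) hφ
  rw [← hmean (fun x => φ x ^ 2), ← hmean φ, ← hmean (fun x => ‖gradient φ x‖ ^ 2)] at h
  have hi : ∀ F : E d → ℝ, Continuous F → IntegrableOn F (cell K) := fun F hF =>
    hF.continuousOn.integrableOn_compact hc
  have hφc := hφ.continuous
  have e : ∫ x in cell K, (φ x - cellMean K φ) ^ 2 =
      volume.real (cell K) * ((∫ x in cell K, φ x ^ 2) / volume.real (cell K) -
        ((∫ x in cell K, φ x) / volume.real (cell K)) ^ 2) := by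
    have : ∀ x, (φ x - cellMean K φ) ^ 2 =
        φ x ^ 2 - 2 * cellMean K φ * φ x + cellMean K φ ^ 2 := fun x => by ring
    simp only [this]
    rw [integral_add, integral_sub, integral_const_mul, setIntegral_const, cellMean, smul_eq_mul]
    · field_simp; ring
    · exact hi _ (by fun_prop)
    · exact hi _ (by fun_prop)
    · exact hi _ (by fun_prop)
    · exact hi _ (by fun_prop)
  rw [e]
  refine (mul_le_mul_of_nonneg_left h hpos.le).trans (le_of_eq ?_)
  field_simp

end Cell

/-! ### Raviart-Thomas fields tested with gradients. -/

section Face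

variable {n : ℕ}

/-- The mean flux of a Raviart-Thomas basis field tested with `φ` is the mean value of `φ` on the
face. -/
theorem integral_rtBasis {K : Finset (E (n + 1))} {a : E (n + 1)} {v : Fin (n + 1) → E (n + 1)}
    (hK : AffineIndependent ℝ ((↑) : K → E (n + 1))) (hinj : Function.Injective (addApex a v))
    (hr : Set.range (addApex a v) = (K : Set (E (n + 1)))) {φ : E (n + 1) → ℝ}
    (hφ : ContDiff ℝ 1 φ) :
    ∫ x in cell K, (inner ℝ (rtBasis K a x) (gradient φ x) + φ x / volume.real (cell K)) =
      ∫ y, φ (simplexChart v y) ∂cornerMeasure n := by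
  obtain ⟨hpos, hmean⟩ := mean_convexHull_range (affineIndependent_of_range_eq hK hinj hr)
  rw [hr] at hpos hmean
  change 0 < volume.real (cell K) at hpos
  change ∀ F : E (n + 1) → ℝ, (∫ x in cell K, F x) / volume.real (cell K) = _ at hmean
  have hu : ContDiff ℝ 1 (fun x => φ (simplexChart (addApex a v) x)) :=
    hφ.comp (contDiff_simplexChart _)
  have h := integral_radial_divergence hu
  have ha : simplexChart (addApex a v) (Pi.single 0 1) = a := by
    rw [simplexChart_single]; simp [addApex]
  simp only [fderiv_comp_simplexChart hφ, ← simplexChart_sub, ha, simplexChart_addApex] at h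
  rw [← hmean (fun x => inner ℝ (gradient φ x) (x - a) + (n + 1) * φ x)] at h
  have hn : (n : ℝ) + 1 ≠ 0 := by positivity
  rw [← mul_right_inj' hn, ← h, div_eq_mul_inv, ← integral_mul_const, ← integral_const_mul]
  refine integral_congr_ae (Filter.Eventually.of_forall fun x => ?_)
  simp only [rtBasis]
  rw [real_inner_smul_left, real_inner_comm]
  push_cast
  field_simp

end Face


/-! ### Barycentric coordinates and the local shape of a simplex. -/

section Barycentric

variable {d : ℕ} {K : Finset (E d)}

/-- The vertices of a simplex as an affine basis. -/
noncomputable def cellBasis (hcard : K.card = d + 1)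
    (hK : AffineIndependent ℝ ((↑) : K → E d)) : AffineBasis K ℝ (E d) :=
  ⟨(↑), hK, hK.affineSpan_eq_top_iff_card_eq_finrank_add_one.2 (by simp [hcard])⟩

variable (hcard : K.card = d + 1) (hK : AffineIndependent ℝ ((↑) : K → E d))

theorem cellBasis_apply (i : K) : cellBasis hcard hK i = i := rfl

theorem range_cellBasis : Set.range (cellBasis hcard hK) = (K : Set (E d)) :=
  Subtype.range_coe

theorem mem_cell_iff {x : E d} : x ∈ cell K ↔ ∀ i, 0 ≤ (cellBasis hcard hK).coord i x := by
  rw [cell, ← range_cellBasis hcard hK, (cellBasis hcard hK).convexHull_eq_nonneg_coord]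
  rfl

theorem mem_interior_cell_iff {x : E d} :
    x ∈ interior (cell K) ↔ ∀ i, 0 < (cellBasis hcard hK).coord i x := by
  rw [cell, ← range_cellBasis hcard hK, (cellBasis hcard hK).interior_convexHull]
  rfl

theorem coord_eq_zero_of_mem_cell {S : Finset (E d)} (hS : S ⊆ K) {x : E d} (hx : x ∈ cell S)
    {i : K} (hi : (i : E d) ∉ S) : (cellBasis hcard hK).coord i x = 0 := by
  set f := (cellBasis hcard hK).coord i with hf
  have hconv : Convex ℝ (f ⁻¹' {0}) := (convex_singleton (0 : ℝ)).affine_preimage f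
  have hsub : (S : Set (E d)) ⊆ f ⁻¹' {0} := fun y hy => by
    have hyK : y ∈ K := hS hy
    have hne : i ≠ ⟨y, hyK⟩ := fun h => hi (by rw [h]; exact hy)
    have e := (cellBasis hcard hK).coord_apply_ne hne
    rw [cellBasis_apply] at e
    rw [Set.mem_preimage, Set.mem_singleton_iff, hf]
    exact e
  exact convexHull_min hsub hconv hx

theorem mem_cell_of_coord {S : Finset (E d)} {x : E d} (hx : x ∈ cell K)
    (h0 : ∀ i : K, (i : E d) ∉ S → (cellBasis hcard hK).coord i x = 0) : x ∈ cell S := by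
  classical
  set b := cellBasis hcard hK
  have h1 : ∑ i ∈ Finset.univ.filter (fun i : K => (i : E d) ∈ S), b.coord i x • b i = x := by
    rw [Finset.sum_filter_of_ne, b.linear_combination_coord_eq_self]
    intro i _ hi
    by_contra h
    exact hi (by rw [h0 i h, zero_smul])
  have h2 : ∑ i ∈ Finset.univ.filter (fun i : K => (i : E d) ∈ S), b.coord i x = 1 := by
    rw [Finset.sum_filter_of_ne, b.sum_coord_apply_eq_one]
    intro i _ hi
    by_contra h
    exact hi (h0 i h)
  rw [← h1]
  refine (convex_convexHull ℝ _).sum_mem (fun i _ => (mem_cell_iff hcard hK).1 hx i) h2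
    fun i hi => subset_convexHull ℝ _ (Finset.mem_filter.1 hi).2

theorem convex_cell (K : Finset (E d)) : Convex ℝ (cell K) := convex_convexHull ℝ _

theorem cell_mono {S S' : Finset (E d)} (h : S ⊆ S') : cell S ⊆ cell S' :=
  convexHull_mono (by exact_mod_cast h)

theorem isClosed_cell (K : Finset (E d)) : IsClosed (cell K) := (isCompact_cell K).isClosed

theorem interior_cell_nonempty (hcard : K.card = d + 1)
    (hK : AffineIndependent ℝ ((↑) : K → E d)) : (interior (cell K)).Nonempty := by
  refine ⟨Finset.univ.centroid ℝ (cellBasis hcard hK), ?_⟩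
  rw [cell, ← range_cellBasis hcard hK]
  exact (cellBasis hcard hK).centroid_mem_interior_convexHull

theorem cell_subset_closure_interior (hcard : K.card = d + 1)
    (hK : AffineIndependent ℝ ((↑) : K → E d)) : cell K ⊆ closure (interior (cell K)) := by
  rw [(convex_cell K).closure_interior_eq_closure_of_nonempty_interior
    (interior_cell_nonempty hcard hK)]
  exact subset_closure

theorem volume_cell_diff_interior (K : Finset (E d)) :
    volume (cell K \ interior (cell K)) = 0 := by
  rw [← (isClosed_cell K).frontier_eq]
  exact (convex_cell K).addHaar_frontier volume

theorem tendsto_add_smul (x e : E d) :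
    Filter.Tendsto (fun t : ℝ => x + t • e) (nhdsWithin 0 (Set.Ioi 0)) (nhds x) := by
  have : Continuous fun t : ℝ => x + t • e := by fun_prop
  simpa using (this.tendsto 0).mono_left nhdsWithin_le_nhds

theorem coord_add_smul (i : K) (x e : E d) (t : ℝ) :
    (cellBasis hcard hK).coord i (x + t • e) =
      (cellBasis hcard hK).coord i x + t * ((cellBasis hcard hK).coord i).linear e := by
  have := ((cellBasis hcard hK).coord i).map_vadd x (t • e)
  rw [vadd_eq_add, vadd_eq_add, add_comm, map_smul, smul_eq_mul] at this
  rw [this]; ring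

theorem eventually_coord_pos {i : K} {x : E d} (h : 0 < (cellBasis hcard hK).coord i x) (e : E d) :
    ∀ᶠ t in nhdsWithin (0 : ℝ) (Set.Ioi 0), 0 < (cellBasis hcard hK).coord i (x + t • e) :=
  ((((continuous_barycentric_coord (cellBasis hcard hK) i).tendsto x).comp
    (tendsto_add_smul x e)).eventually (lt_mem_nhds h))

/-- Near a point in the relative interior of a facet, a simplex agrees with a half-space. -/
theorem eventually_mem_cell {a : K} {x : E d}
    (hpos : ∀ i, i ≠ a → 0 < (cellBasis hcard hK).coord i x)
    (h0 : (cellBasis hcard hK).coord a x = 0) (e : E d)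
    (he : 0 ≤ ((cellBasis hcard hK).coord a).linear e) :
    ∀ᶠ t in nhdsWithin (0 : ℝ) (Set.Ioi 0), x + t • e ∈ cell K := by
  have h1 : ∀ᶠ t in nhdsWithin (0 : ℝ) (Set.Ioi 0), ∀ i, 0 ≤ (cellBasis hcard hK).coord i
      (x + t • e) := by
    rw [Filter.eventually_all]
    intro i
    by_cases hi : i = a
    · subst hi
      filter_upwards [self_mem_nhdsWithin] with t ht
      rw [coord_add_smul, h0, zero_add]
      exact mul_nonneg (le_of_lt ht) he
    · exact (eventually_coord_pos hcard hK (hpos i hi) e).mono fun t ht => ht.le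
  exact h1.mono fun t ht => (mem_cell_iff hcard hK).2 ht

theorem eventually_mem_interior_cell {a : K} {x : E d}
    (hpos : ∀ i, i ≠ a → 0 < (cellBasis hcard hK).coord i x)
    (h0 : (cellBasis hcard hK).coord a x = 0) (e : E d)
    (he : 0 < ((cellBasis hcard hK).coord a).linear e) :
    ∀ᶠ t in nhdsWithin (0 : ℝ) (Set.Ioi 0), x + t • e ∈ interior (cell K) := by
  have h1 : ∀ᶠ t in nhdsWithin (0 : ℝ) (Set.Ioi 0), ∀ i, 0 < (cellBasis hcard hK).coord i
      (x + t • e) := by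
    rw [Filter.eventually_all]
    intro i
    by_cases hi : i = a
    · subst hi
      filter_upwards [self_mem_nhdsWithin] with t ht
      rw [coord_add_smul, h0, zero_add]
      exact mul_pos ht he
    · exact eventually_coord_pos hcard hK (hpos i hi) e
  exact h1.mono fun t ht => (mem_interior_cell_iff hcard hK).2 ht

end Barycentric

/-! ### Topology of the domain and of the mesh: unshared faces lie outside the open set. -/

section Domain

variable {d : ℕ} {Ω : Set (E d)}

/-- Every boundary point of a Lipschitz domain is a limit of exterior points. -/
theorem IsLipschitzDomain.frontier_subset (hΩ : IsLipschitzDomain Ω) :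
    frontier Ω ⊆ closure (closure Ω)ᶜ := by
  intro x hx
  obtain ⟨e, r, C, g, he, hr, hg, h⟩ := hΩ.lipschitz_boundary x hx
  have hxn : x ∉ Ω := fun h' => by
    rw [frontier, hΩ.isOpen.interior_eq] at hx
    exact hx.2 h'
  have hinner : ∀ t : ℝ, inner ℝ e (x + t • (-e)) = inner ℝ e x - t := fun t => by
    rw [inner_add_right, real_inner_smul_right, inner_neg_right, real_inner_self_eq_norm_sq, he]
    ring
  have hx0 : inner ℝ e x ≤ g (x - inner ℝ e x • e) := by
    rw [h x (Metric.mem_ball_self hr)] at hxn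
    exact not_lt.1 hxn
  refine mem_closure_of_tendsto (tendsto_add_smul x (-e)) ?_
  have h1 : ∀ᶠ t in nhdsWithin (0 : ℝ) (Set.Ioi 0), x + t • (-e) ∈ Metric.ball x r :=
    (tendsto_add_smul x (-e)).eventually (Metric.ball_mem_nhds x hr)
  filter_upwards [h1, self_mem_nhdsWithin] with t ht ht0
  have hgc := hg.continuous
  -- Moving along `-e` keeps the component orthogonal to `e` and goes strictly below the graph.
  -- Being strictly below is an open condition and excludes `Ω` inside the ball, so the moved point
  -- is not even in the closure.
  have hopen : IsOpen {y : E d | inner ℝ e y < g (y - inner ℝ e y • e)} :=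
    isOpen_lt (by fun_prop) (by fun_prop)
  rw [Set.mem_compl_iff, mem_closure_iff]
  push Not
  refine ⟨_, hopen.inter (Metric.isOpen_ball (x := x) (ε := r)), ⟨?_, ht⟩, ?_⟩
  · change inner ℝ e (x + t • -e) < g (x + t • -e - inner ℝ e (x + t • -e) • e)
    have : x + t • -e - inner ℝ e (x + t • -e) • e = x - inner ℝ e x • e := by
      rw [hinner, smul_neg, sub_smul]; abel
    rw [this, hinner]
    have : (0 : ℝ) < t := ht0
    linarith
  · rw [← Set.disjoint_iff_inter_eq_empty, Set.disjoint_left]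
    rintro y ⟨hy1, hy2⟩ hyΩ
    exact lt_asymm hy1 ((h y hy2).1 hyΩ)

/-- A Lipschitz domain has no slits. Thus element interiors, a priori only inside the closure of
`Ω`, lie in `Ω`. -/
theorem IsLipschitzDomain.interior_closure_subset (hΩ : IsLipschitzDomain Ω) :
    interior (closure Ω) ⊆ Ω := by
  intro x hx
  by_contra h
  have hf : x ∈ frontier Ω := by
    rw [frontier, hΩ.isOpen.interior_eq]
    exact ⟨interior_subset hx, h⟩
  have := hΩ.frontier_subset hf
  rw [closure_compl] at this
  exact this hx

end Domain

section Mesh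

variable {d : ℕ} {Ω : Set (E d)} (T : SimplicialMesh Ω)

theorem SimplicialMesh.cell_subset {K : Finset (E d)} (hK : K ∈ T.elems) : cell K ⊆ closure Ω := by
  rw [← T.iUnion_eq]
  exact Set.subset_biUnion_of_mem (u := fun K => cell K) hK

theorem SimplicialMesh.exists_mem_cell {x : E d} (hx : x ∈ closure Ω) :
    ∃ K ∈ T.elems, x ∈ cell K := by
  rw [← T.iUnion_eq] at hx
  simpa using hx

theorem SimplicialMesh.interior_cell_subset (hΩ : IsLipschitzDomain Ω) {K : Finset (E d)}
    (hK : K ∈ T.elems) : interior (cell K) ⊆ Ω :=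
  (interior_mono (T.cell_subset hK)).trans hΩ.interior_closure_subset

theorem SimplicialMesh.exists_mem_not_mem {K L : Finset (E d)} (hK : K ∈ T.elems)
    (hL : L ∈ T.elems) (hne : K ≠ L) : ∃ i ∈ K, i ∉ L := by
  by_contra! h
  exact hne (Finset.eq_of_subset_of_card_le h (by rw [T.card_eq K hK, T.card_eq L hL]))

/-- Some vertex of `K` is not in `L`, and its barycentric coordinate vanishes on the hull of the
common vertices. -/
theorem SimplicialMesh.inter_cell_subset {K L : Finset (E d)} (hK : K ∈ T.elems)
    (hL : L ∈ T.elems) (hne : K ≠ L) :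
    cell K ∩ cell L ⊆ cell K \ interior (cell K) := by
  classical
  intro x hx
  refine ⟨hx.1, fun hi => ?_⟩
  rw [T.inter_eq K hK L hL hne] at hx
  obtain ⟨i, hiK, hiL⟩ := T.exists_mem_not_mem hK hL hne
  have h1 := (mem_interior_cell_iff (T.card_eq K hK) (T.affineIndependent K hK)).1 hi ⟨i, hiK⟩
  rw [coord_eq_zero_of_mem_cell (T.card_eq K hK) (T.affineIndependent K hK) (S := K ∩ L)
    Finset.inter_subset_left (by convert hx) (by simp [hiL])] at h1
  exact lt_irrefl _ h1

theorem SimplicialMesh.disjoint_interior {K L : Finset (E d)} (hK : K ∈ T.elems)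
    (hL : L ∈ T.elems) (hne : K ≠ L) : Disjoint (interior (cell K)) (interior (cell L)) := by
  rw [Set.disjoint_left]
  intro x hx hx'
  exact (T.inter_cell_subset hK hL hne ⟨interior_subset hx, interior_subset hx'⟩).2 hx

open Classical in
/-- The face of `K` opposite to `a` belongs to no other element. -/
def SimplicialMesh.IsUnsharedFace (K : Finset (E d)) (a : E d) : Prop :=
  K ∈ T.elems ∧ a ∈ K ∧ ∀ L ∈ T.elems, L ≠ K → ¬ K.erase a ⊆ L

-- If the face met `Ω`, so would its relative interior; near such a point, `Ω` continues beyond the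
-- face and is covered there by elements other than `K`. By closedness one of these contains the
-- point, and conformity then forces it to contain every vertex of the face.
open Classical in
theorem SimplicialMesh.IsUnsharedFace.disjoint (hd : 1 ≤ d) (hΩ : IsOpen Ω)
    {T : SimplicialMesh Ω} {K : Finset (E d)} {a : E d} (h : T.IsUnsharedFace K a) {x : E d}
    (hx : x ∈ cell (K.erase a)) : x ∉ Ω := by
  intro hxΩ
  obtain ⟨hK, ha, hL⟩ := h
  have hcard := T.card_eq K hK
  have hind := T.affineIndependent K hK
  set b := cellBasis hcard hind with hb
  set a' : K := ⟨a, ha⟩ with ha'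
  -- The barycentre of the face; a short move towards it from `x` makes all coordinates but the one
  -- of `a` positive without leaving `Ω`.
  set m := (Finset.univ.erase a').centroid ℝ b with hm
  have hne : (Finset.univ.erase a' : Finset K).Nonempty := by
    rw [← Finset.card_pos, Finset.card_erase_of_mem (Finset.mem_univ _)]
    simp [hcard]; omega
  have hm0 : b.coord a' m = 0 := by
    rw [hm, Finset.centroid_def]
    exact b.coord_apply_combination_of_notMem (by simp)
      (Finset.sum_centroidWeights_eq_one_of_nonempty ℝ _ hne)
  have hmpos : ∀ i, i ≠ a' → 0 < b.coord i m := fun i hi => by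
    rw [hm, b.coord_apply_centroid (by simp [hi])]
    exact inv_pos.2 (by exact_mod_cast Finset.card_pos.2 hne)
  have hxK : x ∈ cell K := cell_mono (Finset.erase_subset a K) hx
  have hx0 : b.coord a' x = 0 := coord_eq_zero_of_mem_cell hcard hind (Finset.erase_subset a K) hx
    (by simp [ha'])
  have hxnn := (mem_cell_iff hcard hind).1 hxK
  obtain ⟨t, ht1, ht0, htΩ⟩ : ∃ t : ℝ, t < 1 ∧ 0 < t ∧ x + t • (m - x) ∈ Ω := by
    have h1 := (tendsto_add_smul x (m - x)).eventually (hΩ.mem_nhds hxΩ)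
    have h2 : ∀ᶠ t in nhdsWithin (0 : ℝ) (Set.Ioi 0), t < 1 :=
      nhdsWithin_le_nhds (gt_mem_nhds one_pos)
    obtain ⟨t, ht, ht', ht''⟩ := (h1.and (h2.and self_mem_nhdsWithin)).exists
    exact ⟨t, ht', ht'', ht⟩
  set x' := x + t • (m - x) with hx'
  have hlin : ∀ i (p q : E d), (b.coord i).linear (p - q) = b.coord i p - b.coord i q :=
    fun i p q => (b.coord i).linearMap_vsub p q
  have hc : ∀ i, b.coord i x' = (1 - t) * b.coord i x + t * b.coord i m := fun i => by
    rw [hx', hb, coord_add_smul, ← hb, hlin]; ring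
  have hx'0 : b.coord a' x' = 0 := by rw [hc, hx0, hm0]; ring
  have hx'pos : ∀ i, i ≠ a' → 0 < b.coord i x' := fun i hi => by
    rw [hc]
    have := mul_nonneg (sub_nonneg.2 ht1.le) (hxnn i)
    have := mul_pos ht0 (hmpos i hi)
    linarith
  -- points beyond the face lie in other elements
  set C : Set (E d) := ⋃ L ∈ T.elems.erase K, cell L with hC
  have hCclosed : IsClosed C :=
    (T.elems.erase K).finite_toSet.isClosed_biUnion fun L _ => isClosed_cell L
  have hx'C : x' ∈ C := by
    refine hCclosed.mem_of_tendsto (tendsto_add_smul x' (x' - a)) ?_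
    filter_upwards [(tendsto_add_smul x' (x' - a)).eventually (hΩ.mem_nhds htΩ),
      self_mem_nhdsWithin] with s hs hs0
    obtain ⟨L, hLT, hLm⟩ := T.exists_mem_cell (subset_closure hs)
    refine Set.mem_biUnion (Finset.mem_coe.2 (Finset.mem_erase.2 ⟨?_, hLT⟩)) hLm
    rintro rfl
    have h1 := (mem_cell_iff hcard hind).1 hLm a'
    rw [coord_add_smul, ← hb, hlin, hx'0] at h1
    have h2 : b.coord a' a = 1 := b.coord_apply_eq a'
    rw [h2] at h1
    have : (0 : ℝ) < s := hs0
    linarith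
  simp only [hC, Set.mem_iUnion, Finset.mem_erase, exists_prop] at hx'C
  obtain ⟨L, ⟨hLK, hLT⟩, hLm⟩ := hx'C
  refine hL L hLT hLK fun i hi => ?_
  have hiK := Finset.mem_of_mem_erase hi
  by_contra hiL
  have hx'K : x' ∈ cell K := (mem_cell_iff hcard hind).2 fun i => by
    by_cases hi : i = a'
    · rw [hi, ← hb, hx'0]
    · exact (hx'pos i hi).le
  have hint : x' ∈ cell (K ∩ L) := by
    rw [← T.inter_eq K hK L hLT hLK.symm]; exact ⟨hx'K, hLm⟩
  have h1 := coord_eq_zero_of_mem_cell hcard hind (i := ⟨i, hiK⟩) Finset.inter_subset_left hint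
    (by simp [hiL])
  have h2 := hx'pos ⟨i, hiK⟩ (fun h => Finset.ne_of_mem_erase hi (Subtype.ext_iff.1 h))
  exact h2.ne' h1

end Mesh


/-! ### The boundary of the domain is covered by unshared faces. -/

section Frontier

variable {d : ℕ} {Ω : Set (E d)}

theorem affineSpan_ne_top_of_card_le {S : Finset (E d)} (h : S.card ≤ d) :
    affineSpan ℝ (S : Set (E d)) ≠ ⊤ := by
  intro htop
  obtain ⟨m, hm⟩ : ∃ m, S.card = m + 1 := by
    refine Nat.exists_eq_succ_of_ne_zero fun h0 => ?_
    rw [Finset.card_eq_zero.1 h0] at htop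
    simp at htop
  have h1 := finrank_vectorSpan_range_le ℝ (fun i : S => (i : E d)) (n := m) (by simp [hm])
  have h2 : Set.range (fun i : S => (i : E d)) = (S : Set (E d)) := Subtype.range_coe
  rw [h2, ← direction_affineSpan, htop, AffineSubspace.direction_top, finrank_top] at h1
  simp at h1
  omega

/-- The boundary of a Lipschitz domain is covered by the faces that belong to one element only. -/
theorem SimplicialMesh.exists_isUnsharedFace (T : SimplicialMesh Ω) (hd : 1 ≤ d)
    (hΩ : IsLipschitzDomain Ω) {x : E d} (hx : x ∈ frontier Ω) :
    ∃ K a, T.IsUnsharedFace K a ∧ x ∈ cell (open Classical in K.erase a) := by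
  classical
  set C := closure Ω with hC
  have hCcl : IsClosed C := isClosed_closure
  have hcellC : ∀ K ∈ T.elems, cell K ⊆ C := fun K hK => T.cell_subset hK
  set W : Set (E d) := ⋃ K ∈ T.elems, ⋃ a ∈ K, {w | T.IsUnsharedFace K a ∧ w ∈ cell (K.erase a)}
    with hW
  have hWcl : IsClosed W := by
    refine T.elems.finite_toSet.isClosed_biUnion fun K _ => K.finite_toSet.isClosed_biUnion
      fun a _ => ?_
    by_cases h : T.IsUnsharedFace K a
    · simpa [h] using isClosed_cell (K.erase a)
    · simp [h]
  -- `W` is closed, so it is enough to find its points arbitrarily near `x`. Such a point is where a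
  -- generic segment from an element interior to the exterior leaves the mesh for the last time.
  suffices hxW : x ∈ W by
    simp only [hW, Set.mem_iUnion] at hxW
    obtain ⟨K, -, a, -, h1, h2⟩ := hxW
    exact ⟨K, a, h1, by convert h2⟩
  rw [← hWcl.closure_eq, Metric.mem_closure_iff]
  intro ε hε
  -- an interior point of an element and an exterior point in general position
  obtain ⟨K, hK, hxK⟩ := T.exists_mem_cell (frontier_subset_closure hx)
  have hKcl := cell_subset_closure_interior (T.card_eq K hK) (T.affineIndependent K hK) hxK
  obtain ⟨z, hzK, hzx⟩ := Metric.mem_closure_iff.1 hKcl ε hε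
  obtain ⟨y₀, hy₀, hy₀x⟩ := Metric.mem_closure_iff.1 (hΩ.frontier_subset hx) ε hε
  have hzC : z ∈ interior C := interior_mono (hcellC K hK) hzK
  -- The joins of `z` with the faces of codimension two: each is spanned by at most `d` points,
  -- hence null. A segment from `z` to a point outside `B` cannot meet such a face after leaving
  -- `z`.
  set B : Set (E d) := ⋃ L ∈ T.elems, ⋃ a ∈ L, ⋃ b ∈ L.erase a,
    (affineSpan ℝ ((insert z ((L.erase a).erase b) : Finset (E d)) : Set (E d)) : Set (E d))
    with hB
  have hB0 : volume B = 0 := by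
    refine (measure_biUnion_null_iff T.elems.countable_toSet).2 fun L hL =>
      (measure_biUnion_null_iff L.countable_toSet).2 fun a ha =>
      (measure_biUnion_null_iff (L.erase a).countable_toSet).2 fun b hb => ?_
    refine Measure.addHaar_affineSubspace volume _ (affineSpan_ne_top_of_card_le ?_)
    refine (Finset.card_insert_le _ _).trans ?_
    rw [Finset.card_erase_of_mem hb, Finset.card_erase_of_mem ha, T.card_eq L hL]
    omega
  obtain ⟨y, ⟨hyC, hyx⟩, hyB⟩ : ((Cᶜ ∩ Metric.ball x ε) \ B).Nonempty := by
    refine nonempty_of_measure_ne_zero (μ := volume) ?_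
    rw [measure_sdiff_null hB0]
    refine ((hCcl.isOpen_compl.inter Metric.isOpen_ball).measure_pos volume
      ⟨y₀, hy₀, ?_⟩).ne'
    rwa [Metric.mem_ball, dist_comm]
  -- the last point of the mesh on the segment
  set e := y - z with he
  set A : Set ℝ := Set.Icc 0 1 ∩ (fun t : ℝ => z + t • e) ⁻¹' C with hA
  have hAc : IsCompact A := isCompact_Icc.inter_right (hCcl.preimage (by fun_prop))
  have hAne : A.Nonempty := ⟨0, by simp, by simpa using interior_subset hzC⟩
  have htA := hAc.sSup_mem hAne
  set t := sSup A with ht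
  have ht1 : t < 1 := by
    refine lt_of_le_of_ne htA.1.2 fun h => hyC ?_
    have := htA.2
    rw [Set.mem_preimage, h] at this
    simpa [he] using this
  set w := z + t • e with hw
  have hwC : w ∈ C := htA.2
  -- By maximality of `t`, going on from `w` towards `y` immediately leaves the closure of `Ω`.
  have hafter : ∀ᶠ s in nhdsWithin (0 : ℝ) (Set.Ioi 0), w + s • e ∉ C := by
    have h2 : ∀ᶠ s in nhdsWithin (0 : ℝ) (Set.Ioi 0), s < 1 - t :=
      nhdsWithin_le_nhds (gt_mem_nhds (sub_pos.2 ht1))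
    filter_upwards [h2, self_mem_nhdsWithin] with s hs hs0 hmem
    have hs0' : (0 : ℝ) < s := hs0
    have : t + s ∈ A := by
      refine ⟨⟨by linarith [htA.1.1], by linarith⟩, ?_⟩
      rw [Set.mem_preimage, add_smul, ← add_assoc]
      exact hmem
    have := le_csSup hAc.bddAbove this
    linarith
  have hwint : w ∉ interior C := fun h => by
    obtain ⟨s, hs, hs'⟩ := (((tendsto_add_smul w e).eventually
      (mem_interior_iff_mem_nhds.1 h)).and hafter).exists
    exact hs' hs
  have ht0 : t ≠ 0 := fun h => hwint (by simpa [hw, h] using hzC)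
  have hyw : y = AffineMap.lineMap z w t⁻¹ := by
    rw [AffineMap.lineMap_apply, hw, vsub_eq_sub, add_sub_cancel_left, smul_smul,
      inv_mul_cancel₀ ht0, one_smul, vadd_eq_add, he]
    abel
  -- each element that contains the last point has it in the relative interior of a face
  have hface : ∀ (L) (hL : L ∈ T.elems), w ∈ cell L → ∃ c : L,
      (cellBasis (T.card_eq L hL) (T.affineIndependent L hL)).coord c w = 0 ∧ ∀ i, i ≠ c →
      0 < (cellBasis (T.card_eq L hL) (T.affineIndependent L hL)).coord i w := by
    intro L hL hwL
    have hnn := (mem_cell_iff (T.card_eq L hL) (T.affineIndependent L hL)).1 hwL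
    have hex : ∃ c, ¬ 0 < (cellBasis (T.card_eq L hL) (T.affineIndependent L hL)).coord c w := by
      by_contra! h
      exact hwint (interior_mono (hcellC L hL)
        ((mem_interior_cell_iff (T.card_eq L hL) (T.affineIndependent L hL)).2 h))
    obtain ⟨c, hc⟩ := hex
    have hc0 := le_antisymm (not_lt.1 hc) (hnn c)
    refine ⟨c, hc0, fun i hi => lt_of_le_of_ne (hnn i) fun h0 => hyB ?_⟩
    have hwS : w ∈ cell ((L.erase c).erase i) := by
      refine mem_cell_of_coord (T.card_eq L hL) (T.affineIndependent L hL) hwL fun j hj => ?_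
      by_cases hji : j = i
      · rw [hji, ← h0]
      by_cases hjc : j = c
      · rw [hjc, hc0]
      · exfalso
        refine hj (Finset.mem_erase.2 ⟨fun h => hji (Subtype.ext h),
          Finset.mem_erase.2 ⟨fun h => hjc (Subtype.ext h), j.2⟩⟩)
    refine Set.mem_biUnion hL (Set.mem_biUnion c.2 (Set.mem_biUnion
      (Finset.mem_coe.2 (Finset.mem_erase.2 ⟨fun h => hi (Subtype.ext h), i.2⟩)) ?_))
    rw [hyw]
    refine AffineMap.lineMap_mem _ ?_ ?_
    · exact subset_affineSpan ℝ _ (by simp)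
    · refine affineSpan_mono ℝ ?_ (convexHull_subset_affineSpan _ hwS)
      simp [Set.subset_insert]
  -- The direction `e` must decrease the vanishing coordinate, since otherwise the segment would
  -- stay in `L` beyond `w`. So going backwards from `w` enters the interior of every element that
  -- contains `w`.
  have hback : ∀ L ∈ T.elems, w ∈ cell L →
      ∀ᶠ s in nhdsWithin (0 : ℝ) (Set.Ioi 0), w + s • (-e) ∈ interior (cell L) := by
    intro L hL hwL
    obtain ⟨c, hc0, hpos⟩ := hface L hL hwL
    refine eventually_mem_interior_cell (T.card_eq L hL) (T.affineIndependent L hL) hpos hc0 _ ?_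
    rw [map_neg, neg_pos]
    by_contra! hle
    obtain ⟨s, hs, hs'⟩ := ((eventually_mem_cell (T.card_eq L hL) (T.affineIndependent L hL)
      hpos hc0 e hle).and hafter).exists
    exact hs' (hcellC L hL hs)
  obtain ⟨L, hL, hwL⟩ := T.exists_mem_cell hwC
  obtain ⟨c, hc0, hpos⟩ := hface L hL hwL
  have hwc : w ∈ cell (L.erase c) :=
    mem_cell_of_coord (T.card_eq L hL) (T.affineIndependent L hL) hwL fun j hj => by
      have : j = c := by
        by_contra h
        exact hj (Finset.mem_erase.2 ⟨fun h' => h (Subtype.ext h'), j.2⟩)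
      rw [this, hc0]
  refine ⟨w, ?_, ?_⟩
  · refine Set.mem_biUnion hL (Set.mem_biUnion c.2 ⟨⟨hL, c.2, fun L' hL' hne hsub => ?_⟩, hwc⟩)
    have hwL' : w ∈ cell L' := cell_mono (by convert hsub) hwc
    -- A second element with this face would contain the same points of the segment in its interior,
    -- but interiors are disjoint.
    obtain ⟨s, hs, hs'⟩ := ((hback L hL hwL).and (hback L' hL' hwL')).exists
    exact Set.disjoint_left.1 (T.disjoint_interior hL hL' hne.symm) hs hs'
  · have hz : z ∈ Metric.ball x ε := by rwa [Metric.mem_ball, dist_comm]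
    have := (convex_ball x ε).add_smul_sub_mem hz hyx htA.1
    rw [dist_comm]
    exact this

end Frontier

/-! ### Quadratics determined by their Lagrange nodes, and zero boundary values of the averaged
potential. -/

section Quadratic

variable {d : ℕ}

theorem finsupp_degree_le_two {m : Fin d →₀ ℕ} (h : m.degree ≤ 2) :
    m = 0 ∨ (∃ i, m = Finsupp.single i 1) ∨
      ∃ i j, m = Finsupp.single i 1 + Finsupp.single j 1 := by
  have step : ∀ k : Fin d →₀ ℕ, k ≠ 0 → ∃ i k', k = Finsupp.single i 1 + k' ∧
      k.degree = 1 + k'.degree := by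
    intro k hk
    obtain ⟨i, hi⟩ := Finsupp.ne_iff.1 hk
    have hle : Finsupp.single i 1 ≤ k := by
      rw [Finsupp.single_le_iff]
      exact Nat.one_le_iff_ne_zero.2 hi
    refine ⟨i, k - Finsupp.single i 1, (add_tsub_cancel_of_le hle).symm, ?_⟩
    nth_rewrite 1 [← add_tsub_cancel_of_le hle]
    rw [map_add, Finsupp.degree_single]
  by_cases h0 : m = 0
  · exact Or.inl h0
  obtain ⟨i, k, rfl, hk⟩ := step m h0
  by_cases hk0 : k = 0
  · exact Or.inr (Or.inl ⟨i, by rw [hk0, add_zero]⟩)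
  obtain ⟨j, l, rfl, hl⟩ := step k hk0
  have hl0 : l = 0 := by
    rw [← Finsupp.degree_eq_zero_iff]; omega
  exact Or.inr (Or.inr ⟨i, j, by rw [hl0, add_zero]⟩)

/-- A quadratic polynomial on a simplex in terms of its values at vertices and edge midpoints. -/
theorem polyFun_sum {q : MvPolynomial (Fin d) ℝ} (hq : q.totalDegree ≤ 2) {ι : Type*}
    (S : Finset ι) (c : ι → ℝ) (v : ι → E d) (hc : ∑ i ∈ S, c i = 1) :
    polyFun q (∑ i ∈ S, c i • v i) = ∑ i ∈ S, ∑ j ∈ S, c i * c j *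
      (2 * polyFun q (midpoint ℝ (v i) (v j)) - polyFun q (v i) / 2 - polyFun q (v j) / 2) := by
  have hmid : ∀ i j k, (midpoint ℝ (v i) (v j)) k = (v i k + v j k) / 2 := fun i j k => by
    rw [midpoint_eq_smul_add]; simp; ring
  -- Polarization: for `q` of degree at most two, `2 q((v + w)/2) - q(v)/2 - q(w)/2` is the
  -- symmetric bilinear form of the homogenized `q`. It suffices to check the monomials `1`, `x_k`
  -- and `x_k x_l`, using that the weights sum to one.
  have hmono : ∀ m : Fin d →₀ ℕ, m.degree ≤ 2 → ∀ F : E d → ℝ,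
      (F = fun x => m.prod fun i e => x i ^ e) → F (∑ i ∈ S, c i • v i) =
      ∑ i ∈ S, ∑ j ∈ S, c i * c j *
        (2 * F (midpoint ℝ (v i) (v j)) - F (v i) / 2 - F (v j) / 2) := by
    have hsum : ∀ k, (∑ i ∈ S, c i • v i) k = ∑ i ∈ S, c i * v i k := fun k => by simp
    have hfac : ∀ a b : ι → ℝ, ∑ i ∈ S, ∑ j ∈ S, a i * b j = (∑ i ∈ S, a i) * ∑ j ∈ S, b j :=
      fun a b => (Finset.sum_mul_sum _ _ _ _).symm
    intro m hm F hF
    rcases finsupp_degree_le_two hm with rfl | ⟨k, rfl⟩ | ⟨k, l, rfl⟩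
    · simp only [hF, Finsupp.prod_zero_index]
      have : ∀ i j, c i * c j * (2 - 1 / 2 - 1 / 2) = c i * c j := fun i j => by ring
      simp only [mul_one, this, hfac, hc]
    · have hF' : ∀ x, F x = x k := fun x => by rw [hF]; simp
      simp only [hF', hmid, hsum]
      have : ∀ i j, c i * c j * (2 * ((v i k + v j k) / 2) - v i k / 2 - v j k / 2) =
          (c i * v i k / 2) * c j + c i * (c j * v j k / 2) := fun i j => by ring
      simp only [this, Finset.sum_add_distrib, hfac, hc, ← Finset.sum_div]
      ring
    · have hF' : ∀ x, F x = x k * x l := fun x => by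
        rw [hF]
        dsimp only
        rw [Finsupp.prod_add_index' (by simp) (by intros; rw [pow_add])]; simp
      simp only [hF', hmid, hsum]
      have : ∀ i j, c i * c j * (2 * ((v i k + v j k) / 2 * ((v i l + v j l) / 2)) -
          v i k * v i l / 2 - v j k * v j l / 2) =
          (c i * v i k / 2) * (c j * v j l) + (c i * v i l) * (c j * v j k / 2) :=
        fun i j => by ring
      simp only [this, Finset.sum_add_distrib, hfac, ← Finset.sum_div]
      ring
  have hdeg : ∀ m ∈ q.support, m.degree ≤ 2 := fun m hm => by
    have := MvPolynomial.le_totalDegree hm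
    rw [Finsupp.degree_eq_sum] 
    rw [Finsupp.sum_fintype _ _ (by simp)] at this
    exact this.trans hq
  have hpoly : ∀ x, polyFun q x = ∑ m ∈ q.support, q.coeff m * m.prod fun i e => x i ^ e :=
    fun x => by
      rw [polyFun, MvPolynomial.eval_eq]
      rfl
  simp only [hpoly]
  have h1 : ∀ i j, c i * c j * (2 * (∑ m ∈ q.support, q.coeff m *
      m.prod fun k e => (midpoint ℝ (v i) (v j)) k ^ e) -
      (∑ m ∈ q.support, q.coeff m * m.prod fun k e => (v i) k ^ e) / 2 -
      (∑ m ∈ q.support, q.coeff m * m.prod fun k e => (v j) k ^ e) / 2) =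
      ∑ m ∈ q.support, q.coeff m * (c i * c j * (2 * (m.prod fun k e =>
        (midpoint ℝ (v i) (v j)) k ^ e) - (m.prod fun k e => (v i) k ^ e) / 2 -
        (m.prod fun k e => (v j) k ^ e) / 2)) := fun i j => by
    rw [Finset.sum_div, Finset.sum_div, Finset.mul_sum, ← Finset.sum_sub_distrib,
      ← Finset.sum_sub_distrib, Finset.mul_sum]
    exact Finset.sum_congr rfl fun m _ => by ring
  simp only [h1]
  simp_rw [Finset.sum_comm (s := S) (t := q.support)]
  refine Finset.sum_congr rfl fun m hm => ?_
  rw [hmono m (hdeg m hm) _ rfl, Finset.mul_sum]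
  exact Finset.sum_congr rfl fun i _ => by rw [Finset.mul_sum]

theorem polyFun_eq_zero_of_nodes {q : MvPolynomial (Fin d) ℝ} (hq : q.totalDegree ≤ 2)
    {S : Finset (E d)} (h : ∀ a ∈ S, ∀ b ∈ S, polyFun q (midpoint ℝ a b) = 0) {x : E d}
    (hx : x ∈ cell S) : polyFun q x = 0 := by
  obtain ⟨c, -, hc1, rfl⟩ := Finset.mem_convexHull'.1 hx
  rw [polyFun_sum hq S c _ hc1]
  refine Finset.sum_eq_zero fun i hi => Finset.sum_eq_zero fun j hj => ?_
  have hi' := h i hi i hi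
  have hj' := h j hj j hj
  rw [midpoint_self] at hi' hj'
  rw [h i hi j hj, hi', hj']
  ring

theorem midpoint_mem_cell {S : Finset (E d)} {a b : E d} (ha : a ∈ S) (hb : b ∈ S) :
    midpoint ℝ a b ∈ cell S :=
  (convex_convexHull ℝ _).midpoint_mem (subset_convexHull ℝ _ ha) (subset_convexHull ℝ _ hb)

/-- The point lies on an unshared face. All nodes of that face are boundary nodes because the whole
face avoids `Ω`, and a quadratic that vanishes at the nodes of a face vanishes on the face. -/
theorem IsPotentialReconstruction.eq_zero_of_mem_frontier {Ω : Set (E d)} (hd : 1 ≤ d)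
    (hΩ : IsLipschitzDomain Ω) {T : SimplicialMesh Ω}
    {q : Finset (E d) → MvPolynomial (Fin d) ℝ} {s : E d → ℝ}
    (hs : IsPotentialReconstruction T q s) {x : E d} (hx : x ∈ frontier Ω) : s x = 0 := by
  classical
  obtain ⟨K, a, hKa, hxK⟩ := T.exists_isUnsharedFace hd hΩ hx
  obtain ⟨r, hr, hsr⟩ := hs.piecewise_quadratic K hKa.1
  have hsub : cell (K.erase a) ⊆ cell K := cell_mono (Finset.erase_subset _ _)
  have hxK' : x ∈ cell (K.erase a) := by convert hxK
  rw [hsr x (hsub hxK')]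
  refine polyFun_eq_zero_of_nodes hr (fun b hb c hc => ?_) hxK'
  have hm := midpoint_mem_cell hb hc
  rw [← hsr _ (hsub hm)]
  refine hs.node_boundary _ ⟨K, hKa.1, b, Finset.mem_of_mem_erase hb, c,
    Finset.mem_of_mem_erase hc, rfl⟩ ?_
  rw [frontier, hΩ.isOpen.interior_eq]
  exact ⟨T.cell_subset hKa.1 (hsub hm), hKa.disjoint hd hΩ.isOpen (by convert hm)⟩

end Quadratic


/-! ### Square integrable functions, gradients and mollification. -/

section L2

variable {d : ℕ} {F : Type*} [NormedAddCommGroup F] {S : Set (E d)}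

theorem l2Norm_nonneg (S : Set (E d)) (v : E d → F) : 0 ≤ l2Norm S v := Real.sqrt_nonneg _

theorem l2Norm_sq (S : Set (E d)) (v : E d → F) : l2Norm S v ^ 2 = ∫ x in S, ‖v x‖ ^ 2 :=
  Real.sq_sqrt (integral_nonneg fun _ => sq_nonneg _)

/-- Bridge to the library norm. Square integrability is needed because the integral in `l2Norm`
defaults to `0`. -/
theorem l2Norm_eq_toReal {v : E d → F} (hv : MemLp v 2 (volume.restrict S)) :
    l2Norm S v = (eLpNorm v 2 (volume.restrict S)).toReal := by
  rw [hv.eLpNorm_eq_integral_rpow_norm two_ne_zero ENNReal.ofNat_ne_top, l2Norm,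
    ENNReal.toReal_ofReal (by positivity), Real.sqrt_eq_rpow]
  simp

theorem l2Norm_add_le {v w : E d → F} (hv : MemLp v 2 (volume.restrict S))
    (hw : MemLp w 2 (volume.restrict S)) :
    l2Norm S (fun x => v x + w x) ≤ l2Norm S v + l2Norm S w := by
  have h : MemLp (fun x => v x + w x) 2 (volume.restrict S) := hv.add hw
  rw [l2Norm_eq_toReal hv, l2Norm_eq_toReal hw, l2Norm_eq_toReal h,
    ← ENNReal.toReal_add hv.eLpNorm_ne_top hw.eLpNorm_ne_top]
  exact ENNReal.toReal_mono (ENNReal.add_ne_top.2 ⟨hv.eLpNorm_ne_top, hw.eLpNorm_ne_top⟩)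
    (eLpNorm_add_le hv.1 hw.1 one_le_two)

theorem l2Norm_sub_le {v w z : E d → F} (hv : MemLp v 2 (volume.restrict S))
    (hw : MemLp w 2 (volume.restrict S)) (hz : MemLp z 2 (volume.restrict S)) :
    l2Norm S (fun x => v x - z x) ≤
      l2Norm S (fun x => v x - w x) + l2Norm S (fun x => w x - z x) := by
  have := l2Norm_add_le (hv.sub hw) (hw.sub hz)
  simp only [Pi.sub_apply, sub_add_sub_cancel] at this
  exact this

theorem l2Norm_congr {v w : E d → F} (h : v =ᵐ[volume.restrict S] w) :
    l2Norm S v = l2Norm S w := by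
  unfold l2Norm
  rw [integral_congr_ae (h.mono fun x hx => by rw [hx])]

theorem abs_integral_inner_le [InnerProductSpace ℝ F] {v w : E d → F}
    (hv : MemLp v 2 (volume.restrict S)) (hw : MemLp w 2 (volume.restrict S)) :
    |∫ x in S, inner ℝ (v x) (w x)| ≤ l2Norm S v * l2Norm S w := by
  have h1 := abs_real_inner_le_norm (hv.toLp v) (hw.toLp w)
  rw [L2.inner_def, Lp.norm_toLp, Lp.norm_toLp, ← l2Norm_eq_toReal hv, ← l2Norm_eq_toReal hw] at h1
  refine le_trans (le_of_eq ?_) h1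
  congr 1
  refine integral_congr_ae ?_
  filter_upwards [hv.coeFn_toLp, hw.coeFn_toLp] with x h1 h2
  rw [h1, h2]

theorem integrable_inner [InnerProductSpace ℝ F] {v w : E d → F}
    (hv : MemLp v 2 (volume.restrict S)) (hw : MemLp w 2 (volume.restrict S)) :
    Integrable (fun x => inner ℝ (v x) (w x)) (volume.restrict S) := by
  have := L2.integrable_inner (𝕜 := ℝ) (hv.toLp v) (hw.toLp w)
  refine this.congr ?_
  filter_upwards [hv.coeFn_toLp, hw.coeFn_toLp] with x h1 h2
  rw [h1, h2]

theorem memLp_two_of_bounded {v : E d → F} (hS : volume S ≠ ⊤)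
    (hv : AEStronglyMeasurable v (volume.restrict S)) {C : ℝ} (hC : ∀ x, ‖v x‖ ≤ C) :
    MemLp v 2 (volume.restrict S) := by
  have : IsFiniteMeasure (volume.restrict S) := ⟨by simpa using hS.lt_top⟩
  exact MemLp.of_bound hv C (Filter.Eventually.of_forall hC)

/-- Dominated convergence in `L²` on a set of finite measure. -/
theorem tendsto_l2Norm_zero {v : ℕ → E d → F} {w : E d → F} (hS : volume S ≠ ⊤)
    (hv : ∀ n, AEStronglyMeasurable (v n) (volume.restrict S))
    (hw : AEStronglyMeasurable w (volume.restrict S)) {C : ℝ}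
    (hC : ∀ n x, ‖v n x‖ ≤ C) (hCw : ∀ x, ‖w x‖ ≤ C)
    (h : ∀ᵐ x ∂volume.restrict S, Filter.Tendsto (fun n => v n x) Filter.atTop (nhds (w x))) :
    Filter.Tendsto (fun n => l2Norm S (fun x => w x - v n x)) Filter.atTop (nhds 0) := by
  have : IsFiniteMeasure (volume.restrict S) := ⟨by simpa using hS.lt_top⟩
  have h1 : Filter.Tendsto (fun n => ∫ x in S, ‖w x - v n x‖ ^ 2) Filter.atTop
      (nhds (∫ _ in S, (0 : ℝ))) := by
    refine tendsto_integral_of_dominated_convergence (fun _ => (C + C) ^ 2)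
      (fun n => ((hw.sub (hv n)).norm.pow 2)) (integrable_const _)
      (fun n => Filter.Eventually.of_forall fun x => ?_) ?_
    · rw [Real.norm_eq_abs, abs_of_nonneg (sq_nonneg _)]
      exact pow_le_pow_left₀ (norm_nonneg _)
        ((norm_sub_le _ _).trans (add_le_add (hCw x) (hC n x))) 2
    · filter_upwards [h] with x hx
      have := ((tendsto_const_nhds (x := w x)).sub hx).norm.pow 2
      simpa using this
  have h2 := h1.sqrt
  simpa [l2Norm] using h2

end L2

section Gradient

variable {d : ℕ}

theorem gradient_apply (φ : E d → ℝ) (x : E d) (i : Fin d) :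
    gradient φ x i = fderiv ℝ φ x (EuclideanSpace.single i 1) := by
  have := InnerProductSpace.toDual_symm_apply (𝕜 := ℝ) (x := EuclideanSpace.single i (1 : ℝ))
    (y := fderiv ℝ φ x)
  rw [← this, EuclideanSpace.inner_single_right]
  simp [gradient]

theorem norm_gradient_sub (φ ψ : E d → ℝ) (x : E d) :
    ‖gradient φ x - gradient ψ x‖ = ‖fderiv ℝ φ x - fderiv ℝ ψ x‖ := by
  rw [gradient, gradient, ← map_sub, LinearIsometryEquiv.norm_map]

theorem norm_gradient (φ : E d → ℝ) (x : E d) : ‖gradient φ x‖ = ‖fderiv ℝ φ x‖ := by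
  rw [gradient, LinearIsometryEquiv.norm_map]

theorem measurable_gradient (φ : E d → ℝ) : Measurable (gradient φ) :=
  (InnerProductSpace.toDual ℝ (E d)).symm.continuous.measurable.comp (measurable_fderiv ℝ φ)

theorem norm_gradient_le {φ : E d → ℝ} {C : NNReal} (h : LipschitzWith C φ) (x : E d) :
    ‖gradient φ x‖ ≤ C := by
  rw [norm_gradient]; exact norm_fderiv_le_of_lipschitz ℝ h

theorem IsTestFunction.contDiff_one {Ω : Set (E d)} {φ : E d → ℝ} (h : IsTestFunction Ω φ) :
    ContDiff ℝ 1 φ := h.1.of_le (by simp)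

theorem IsTestFunction.exists_lipschitz {Ω : Set (E d)} {φ : E d → ℝ} (h : IsTestFunction Ω φ) :
    ∃ C, LipschitzWith C φ :=
  h.contDiff_one.lipschitzWith_of_hasCompactSupport h.2.1 one_ne_zero

theorem IsTestFunction.exists_bound {Ω : Set (E d)} {φ : E d → ℝ} (h : IsTestFunction Ω φ) :
    ∃ C : ℝ, (∀ x, ‖φ x‖ ≤ C) ∧ ∀ x, ‖gradient φ x‖ ≤ C := by
  obtain ⟨C, hC⟩ := h.2.1.exists_bound_of_continuous h.1.continuous
  obtain ⟨D, hD⟩ := h.exists_lipschitz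
  exact ⟨max C D, fun x => (hC x).trans (le_max_left _ _),
    fun x => (norm_gradient_le hD x).trans (le_max_right _ _)⟩

theorem IsTestFunction.eq_zero {Ω : Set (E d)} {φ : E d → ℝ} (h : IsTestFunction Ω φ) {x : E d}
    (hx : x ∉ Ω) : φ x = 0 := image_eq_zero_of_notMem_tsupport fun h' => hx (h.2.2 h')

theorem IsTestFunction.gradient_eq_zero {Ω : Set (E d)} {φ : E d → ℝ} (h : IsTestFunction Ω φ)
    {x : E d} (hx : x ∉ Ω) : gradient φ x = 0 := by
  have : fderiv ℝ φ x = 0 := image_eq_zero_of_notMem_tsupport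
    fun h' => hx (h.2.2 (tsupport_fderiv_subset ℝ h'))
  rw [gradient, this, map_zero]

theorem IsTestFunction.memLp {Ω : Set (E d)} {φ : E d → ℝ} (h : IsTestFunction Ω φ)
    {S : Set (E d)} (hS : volume S ≠ ⊤) :
    MemLp φ 2 (volume.restrict S) ∧ MemLp (gradient φ) 2 (volume.restrict S) := by
  obtain ⟨C, h1, h2⟩ := h.exists_bound
  exact ⟨memLp_two_of_bounded hS h.1.continuous.aestronglyMeasurable h1,
    memLp_two_of_bounded hS (measurable_gradient φ).aestronglyMeasurable h2⟩

/-- Integration by parts for Lipschitz functions against test functions. -/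
theorem integral_mul_gradient {Ω : Set (E d)} {η : E d → ℝ} {C : NNReal} (hη : LipschitzWith C η)
    {φ : E d → ℝ} (hφ : IsTestFunction Ω φ) (i : Fin d) :
    ∫ x in Ω, η x * gradient φ x i = -∫ x in Ω, gradient η x i * φ x := by
  obtain ⟨D, hD⟩ := hφ.exists_lipschitz
  have h := hη.integral_lineDeriv_mul_eq (μ := volume) hD hφ.2.1 (EuclideanSpace.single i 1)
  rw [setIntegral_eq_integral_of_forall_compl_eq_zero,
    setIntegral_eq_integral_of_forall_compl_eq_zero]
  · have h1 : ∫ x, lineDeriv ℝ η x (EuclideanSpace.single i 1) * φ x =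
        ∫ x, gradient η x i * φ x := by
      refine integral_congr_ae ?_
      filter_upwards [hη.ae_differentiableAt (μ := volume)] with x hx
      rw [gradient_apply, hx.lineDeriv_eq_fderiv]
    have h2 : ∀ x, lineDeriv ℝ φ x (-EuclideanSpace.single i 1) * η x =
        -(η x * gradient φ x i) := fun x => by
      rw [gradient_apply, ((hφ.contDiff_one.differentiable one_ne_zero) x).lineDeriv_eq_fderiv,
        map_neg]
      ring
    rw [h1] at h
    simp only [h2] at h
    rw [integral_neg] at h
    rw [h, neg_neg]
  · intro x hx; rw [hφ.eq_zero hx, mul_zero]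
  · intro x hx; rw [hφ.gradient_eq_zero hx]; simp

end Gradient

section Mollify

variable {d : ℕ} {Ω : Set (E d)}

open scoped Convolution

/-- Lipschitz functions with compact support are limits of test functions in `H¹`. -/
theorem exists_isTestFunction_near (hΩ : IsOpen Ω) (hΩb : volume Ω ≠ ⊤) {η : E d → ℝ} {C : NNReal}
    (hη : LipschitzWith C η) (hc : HasCompactSupport η) (hs : tsupport η ⊆ Ω) {ε : ℝ}
    (hε : 0 < ε) : ∃ φ, IsTestFunction Ω φ ∧ l2Norm Ω (fun x => η x - φ x) < ε ∧
      l2Norm Ω (fun x => gradient η x - gradient φ x) < ε := by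
  obtain ⟨δ, hδ, hδΩ⟩ := (IsCompact.exists_cthickening_subset_open hc hΩ hs)
  -- The outer radii tend to zero and stay at most `δ`, which keeps the supports in `Ω`. Their ratio
  -- to the inner radii is fixed at `2`, as the almost everywhere convergence of the mollified
  -- gradients requires.
  let b : ℕ → ContDiffBump (0 : E d) := fun n =>
    ⟨δ / (2 * (n + 1)), δ / (n + 1), by positivity, by
      have h1 : (0 : ℝ) < n + 1 := by positivity
      exact div_lt_div_of_pos_left hδ h1 (by linarith)⟩
  have hbr : Filter.Tendsto (fun n => (b n).rOut) Filter.atTop (nhds 0) :=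
    tendsto_const_div_atTop_nhds_zero_nat δ |>.comp (Filter.tendsto_add_atTop_nat 1) |>.congr
      fun n => by simp [b]
  set ρ : ℕ → E d → ℝ := fun n => (b n).normed volume with hρ
  set ψ : ℕ → E d → ℝ := fun n => ρ n ⋆[ContinuousLinearMap.lsmul ℝ ℝ, volume] η with hψ
  have hρint : ∀ n, Integrable (ρ n) := fun n => (b n).integrable_normed
  have hρ1 : ∀ n, ∫ t, ρ n t = 1 := fun n => (b n).integral_normed
  have hρ0 : ∀ n t, 0 ≤ ρ n t := fun n t => (b n).nonneg_normed t
  obtain ⟨M, hM⟩ := hc.exists_bound_of_continuous hη.continuous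
  have hψapp : ∀ n x, ψ n x = ∫ t, ρ n t * η (x - t) := fun n x => rfl
  have hdiff : ∀ n, ContDiff ℝ ∞ (ψ n) := fun n =>
    (b n).hasCompactSupport_normed.contDiff_convolution_left _ (b n).contDiff_normed
      hη.continuous.locallyIntegrable
  have hsupp : ∀ n, tsupport (ψ n) ⊆ Ω := fun n => by
    refine Set.Subset.trans ?_ hδΩ
    refine closure_minimal (fun x hx => ?_) Metric.isClosed_cthickening
    obtain ⟨y, hy, z, hz, rfl⟩ := support_convolution_subset_swap _ hx
    rw [hρ, (b n).support_normed_eq, Metric.mem_ball, dist_zero_right] at hz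
    refine Metric.mem_cthickening_of_dist_le _ y δ _ (subset_tsupport η hy) ?_
    rw [dist_eq_norm, add_sub_cancel_left]
    refine hz.le.trans ?_
    have : (1 : ℝ) ≤ n + 1 := by simp
    exact div_le_self hδ.le this
  have htest : ∀ n, IsTestFunction Ω (ψ n) := fun n =>
    ⟨hdiff n, (b n).hasCompactSupport_normed.convolution _ hc, hsupp n⟩
  have hfm : ∀ x, AEStronglyMeasurable (fun t => fderiv ℝ η (x - t)) volume := fun x =>
    ((measurable_fderiv ℝ η).comp (measurable_const.sub measurable_id)).aestronglyMeasurable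
  -- The derivative is moved onto `η`, which is only Lipschitz: Rademacher's theorem gives
  -- differentiability for almost all `t`, and the Lipschitz constant gives the domination.
  have hgrad : ∀ n x, fderiv ℝ (ψ n) x = ∫ t, ρ n t • fderiv ℝ η (x - t) := fun n x => by
    refine HasFDerivAt.fderiv ?_
    refine (hasFDerivAt_integral_of_dominated_loc_of_lip (F := fun x t => ρ n t * η (x - t))
      (bound := fun t => ρ n t * C) Filter.univ_mem (Filter.Eventually.of_forall fun y => ?_) ?_ ?_
      (Filter.Eventually.of_forall fun t => ?_) ((hρint n).mul_const _) ?_).2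
    · exact ((b n).continuous_normed.mul
        (hη.continuous.comp (by fun_prop))).aestronglyMeasurable
    · refine (hρint n).mul_bdd (c := M) (hη.continuous.comp (by fun_prop)).aestronglyMeasurable
        (Filter.Eventually.of_forall fun t => hM _)
    · exact (hρint n).aestronglyMeasurable.smul (hfm x)
    · refine LipschitzOnWith.of_dist_le_mul fun y _ z _ => ?_
      rw [Real.dist_eq, ← mul_sub, abs_mul, abs_of_nonneg (hρ0 n t), Real.coe_nnabs, abs_mul,
        abs_of_nonneg (hρ0 n t), NNReal.abs_eq, mul_assoc]
      refine mul_le_mul_of_nonneg_left ?_ (hρ0 n t)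
      have := hη.dist_le_mul (y - t) (z - t)
      rwa [Real.dist_eq, dist_sub_right] at this
    · have h1 := (quasiMeasurePreserving_sub_left_of_right_invariant (volume : Measure (E d))
        x).ae hη.ae_differentiableAt
      filter_upwards [h1] with t ht
      have h2 : HasFDerivAt (fun y => η (y - t)) (fderiv ℝ η (x - t)) x := by
        have := ht.hasFDerivAt.comp x ((hasFDerivAt_id x).sub_const t)
        rw [ContinuousLinearMap.comp_id] at this
        exact this
      exact h2.const_mul (ρ n t)
  have hb1 : ∀ n x, ‖ψ n x‖ ≤ M := fun n x => by
    rw [hψapp]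
    refine (norm_integral_le_of_norm_le ((hρint n).mul_const M)
      (Filter.Eventually.of_forall fun t => ?_)).trans (le_of_eq ?_)
    · rw [norm_mul, Real.norm_of_nonneg (hρ0 n t)]
      exact mul_le_mul_of_nonneg_left (hM _) (hρ0 n t)
    · rw [integral_mul_const, hρ1, one_mul]
  have hb2 : ∀ n x, ‖fderiv ℝ (ψ n) x‖ ≤ C := fun n x => by
    rw [hgrad]
    refine (norm_integral_le_of_norm_le ((hρint n).mul_const (C : ℝ))
      (Filter.Eventually.of_forall fun t => ?_)).trans (le_of_eq ?_)
    · rw [norm_smul, Real.norm_of_nonneg (hρ0 n t)]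
      exact mul_le_mul_of_nonneg_left (norm_fderiv_le_of_lipschitz ℝ hη) (hρ0 n t)
    · rw [integral_mul_const, hρ1, one_mul]
  have hconv : ∀ x, Filter.Tendsto (fun n => ψ n x) Filter.atTop (nhds (η x)) := fun x =>
    ContDiffBump.convolution_tendsto_right_of_continuous hbr hη.continuous x
  have hli : LocallyIntegrable (fderiv ℝ η) (volume : Measure (E d)) := by
    refine (locallyIntegrable_const (C : ℝ)).mono
      (measurable_fderiv ℝ η).aestronglyMeasurable (Filter.Eventually.of_forall fun x => ?_)
    exact (norm_fderiv_le_of_lipschitz ℝ hη).trans (le_abs_self _)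
  have hconv2 : ∀ᵐ x, Filter.Tendsto (fun n => fderiv ℝ (ψ n) x) Filter.atTop
      (nhds (fderiv ℝ η x)) := by
    have := ContDiffBump.ae_convolution_tendsto_right_of_locallyIntegrable (φ := b) (K := 2)
      (μ := volume) hbr (Filter.Eventually.of_forall fun n => le_of_eq (by
        have h1 : (n : ℝ) + 1 ≠ 0 := by positivity
        simp only [b]; field_simp)) hli
    filter_upwards [this] with x hx
    refine hx.congr fun n => ?_
    rw [hgrad]; rfl
  have hT1 := tendsto_l2Norm_zero hΩb (fun n => (hdiff n).continuous.aestronglyMeasurable)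
    hη.continuous.aestronglyMeasurable hb1 hM
    (Filter.Eventually.of_forall hconv)
  have hT2 := tendsto_l2Norm_zero hΩb
    (fun n => (measurable_fderiv ℝ (ψ n)).aestronglyMeasurable)
    (measurable_fderiv ℝ η).aestronglyMeasurable hb2
    (fun x => norm_fderiv_le_of_lipschitz ℝ hη) (ae_restrict_of_ae hconv2)
  obtain ⟨n, hn1, hn2⟩ := ((hT1.eventually (gt_mem_nhds hε)).and
    (hT2.eventually (gt_mem_nhds hε))).exists
  refine ⟨ψ n, htest n, hn1, lt_of_le_of_lt (le_of_eq ?_) hn2⟩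
  simp only [l2Norm, norm_gradient_sub]

end Mollify


/-! ### From Lipschitz functions to `H¹₀`, and its basic operations. -/

section Truncate

/-- A Lipschitz truncation that vanishes on `[-ε, ε]` and is the identity off `[-2ε, 2ε]`. -/
noncomputable def truncate (ε x : ℝ) : ℝ :=
  2 * (max (x - ε) 0 - max (-x - ε) 0) - (max (x - 2 * ε) 0 - max (-x - 2 * ε) 0)

theorem truncate_eq_zero {ε x : ℝ} (hε : 0 ≤ ε) (h : |x| ≤ ε) : truncate ε x = 0 := by
  obtain ⟨h1, h2⟩ := abs_le.1 h
  rw [truncate, max_eq_right, max_eq_right, max_eq_right, max_eq_right] <;> linarith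

theorem truncate_eq_self {ε x : ℝ} (hε : 0 ≤ ε) (h : 2 * ε ≤ |x|) : truncate ε x = x := by
  rcases le_abs'.1 h with h | h
  · rw [truncate, max_eq_right, max_eq_left, max_eq_right, max_eq_left] <;> linarith
  · rw [truncate, max_eq_left, max_eq_right, max_eq_left, max_eq_right] <;> linarith

/-- The four positive parts are 1-Lipschitz with weights `2, 2, 1, 1`. The constant is not optimal;
only its independence of `ε` matters. -/
theorem lipschitzWith_truncate (ε : ℝ) : LipschitzWith 6 (truncate ε) := by
  refine LipschitzWith.of_dist_le_mul fun x y => ?_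
  have h1 : ∀ c : ℝ, |max (x - c) 0 - max (y - c) 0| ≤ |x - y| := fun c => by
    refine (abs_max_sub_max_le_abs _ _ _).trans (le_of_eq ?_)
    congr 1; ring
  have h2 : ∀ c : ℝ, |max (-x - c) 0 - max (-y - c) 0| ≤ |x - y| := fun c => by
    refine (abs_max_sub_max_le_abs _ _ _).trans (le_of_eq ?_)
    rw [← abs_neg]; congr 1; ring
  rw [Real.dist_eq, Real.dist_eq]
  have a1 := abs_le.1 (h1 ε)
  have a2 := abs_le.1 (h1 (2 * ε))
  have a3 := abs_le.1 (h2 ε)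
  have a4 := abs_le.1 (h2 (2 * ε))
  have : ((6 : NNReal) : ℝ) = 6 := rfl
  rw [truncate, truncate, this, abs_le]
  constructor <;> linarith [a1.1, a1.2, a2.1, a2.2, a3.1, a3.2, a4.1, a4.2]

end Truncate

section Sobolev

variable {d : ℕ} {Ω : Set (E d)}

theorem norm_apply_le (x : E d) (i : Fin d) : |x i| ≤ ‖x‖ := by
  simpa using PiLp.norm_apply_le x i

/-- A Lipschitz function that vanishes off a bounded open set belongs to `H¹₀`. -/
theorem memH10_of_lipschitz (hΩ : IsOpen Ω) (hb : Bornology.IsBounded Ω) {f : E d → ℝ}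
    {C : NNReal} (hf : LipschitzWith C f) (h0 : ∀ x ∉ Ω, f x = 0) : MemH10 Ω f := by
  classical
  have hvol : volume Ω ≠ ⊤ := hb.measure_lt_top.ne
  have hfin : IsFiniteMeasure (volume.restrict Ω) := ⟨by simpa using hvol.lt_top⟩
  have hsupp : Function.support f ⊆ Ω := fun x hx => by
    by_contra h; exact hx (h0 x h)
  have hfc : HasCompactSupport f := (hb.subset hsupp).isCompact_closure
  obtain ⟨M, hM⟩ := hfc.exists_bound_of_continuous hf.continuous
  set ε : ℕ → ℝ := fun n => 1 / ((n : ℝ) + 1) with hε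
  have hεpos : ∀ n, 0 < ε n := fun n => by positivity
  have hεlim : Filter.Tendsto ε Filter.atTop (nhds 0) := tendsto_one_div_add_atTop_nhds_zero_nat
  have hε2 : Filter.Tendsto (fun n => 2 * ε n) Filter.atTop (nhds 0) := by
    simpa using hεlim.const_mul 2
  set η : ℕ → E d → ℝ := fun n x => truncate (ε n) (f x) with hη
  have hηl : ∀ n, LipschitzWith (6 * C) (η n) := fun n => (lipschitzWith_truncate (ε n)).comp hf
  have hηM : ∀ n x, ‖η n x‖ ≤ 6 * M := fun n x => by
    have := (lipschitzWith_truncate (ε n)).dist_le_mul (f x) 0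
    have h00 : truncate (ε n) 0 = 0 :=
      truncate_eq_zero (hεpos n).le (by simpa using (hεpos n).le)
    rw [h00, dist_zero_right, dist_zero_right] at this
    exact this.trans (mul_le_mul_of_nonneg_left (hM x) (by positivity))
  have hts : ∀ n, tsupport (η n) ⊆ {x | ε n ≤ |f x|} := fun n => by
    refine closure_minimal (fun x hx => ?_)
      (isClosed_le continuous_const hf.continuous.abs)
    by_contra h
    exact hx (truncate_eq_zero (hεpos n).le (not_le.1 h).le)
  -- Vanishing of `f` off `Ω` does not confine its closed support to `Ω`, but the closed set `{ε ≤
  -- |f|}` is inside `Ω`. This is the purpose of the truncation.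
  have htsΩ : ∀ n, tsupport (η n) ⊆ Ω := fun n => (hts n).trans fun x hx => hsupp fun h => by
    have : ε n ≤ |f x| := hx
    rw [h, abs_zero] at this
    exact absurd (hεpos n) (not_lt.2 this)
  have hηc : ∀ n, HasCompactSupport (η n) := fun n =>
    Metric.isCompact_of_isClosed_isBounded (isClosed_tsupport _) (hb.subset (htsΩ n))
  -- Setting the gradient to zero on `{f = 0}` makes it the limit of the gradients of the
  -- truncations at every point: where `f` vanishes they are zero, elsewhere they eventually equal
  -- the gradient of `f`.
  set G : E d → E d := fun x => if f x = 0 then 0 else gradient f x with hG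
  have hGm : Measurable G := Measurable.ite
    (hf.continuous.measurable (measurableSet_singleton 0)) measurable_const (measurable_gradient f)
  have hGb : ∀ x, ‖G x‖ ≤ 6 * C := fun x => by
    simp only [hG]
    split_ifs
    · rw [norm_zero]; positivity
    · refine (norm_gradient_le hf x).trans ?_
      have := C.2
      have h : (C : ℝ) = 1 * C := (one_mul _).symm
      nth_rewrite 1 [h]
      exact mul_le_mul_of_nonneg_right (by norm_num) C.2
  have hηg : ∀ n x, ‖gradient (η n) x‖ ≤ 6 * C := fun n x => norm_gradient_le (hηl n) x
  have hlim1 : ∀ x, Filter.Tendsto (fun n => η n x) Filter.atTop (nhds (f x)) := fun x => by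
    by_cases hx : f x = 0
    · refine tendsto_const_nhds.congr fun n => ?_
      rw [hη]
      simp only [hx]
      rw [truncate_eq_zero (hεpos n).le (by simpa using (hεpos n).le)]
    · have h1 := hε2.eventually (gt_mem_nhds (abs_pos.2 hx))
      refine tendsto_const_nhds.congr' (h1.mono fun n hn => ?_)
      exact (truncate_eq_self (hεpos n).le (le_of_lt hn)).symm
  have hlim2 : ∀ x, Filter.Tendsto (fun n => gradient (η n) x) Filter.atTop (nhds (G x)) :=
    fun x => by
    by_cases hx : f x = 0
    · refine tendsto_const_nhds.congr fun n => ?_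
      have h1 : ∀ᶠ y in nhds x, |f y| < ε n :=
        hf.continuous.abs.tendsto x |>.eventually (gt_mem_nhds (by simpa [hx] using hεpos n))
      have h2 : η n =ᶠ[nhds x] fun _ => 0 := h1.mono fun y hy =>
        truncate_eq_zero (hεpos n).le hy.le
      simp only [hG, hx, if_true]
      rw [gradient, h2.fderiv_eq]
      simp
    · have h1 := hε2.eventually (gt_mem_nhds (abs_pos.2 hx))
      refine tendsto_const_nhds.congr' (h1.mono fun n hn => ?_)
      have h1 : ∀ᶠ y in nhds x, 2 * ε n < |f y| :=
        hf.continuous.abs.tendsto x |>.eventually (lt_mem_nhds hn)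
      have h2 : η n =ᶠ[nhds x] f := h1.mono fun y hy =>
        truncate_eq_self (hεpos n).le hy.le
      simp only [hG, hx, if_false]
      rw [gradient, gradient, h2.fderiv_eq]
  have hfL : MemLp f 2 (volume.restrict Ω) :=
    memLp_two_of_bounded hvol hf.continuous.aestronglyMeasurable hM
  have hGL : MemLp G 2 (volume.restrict Ω) :=
    memLp_two_of_bounded hvol hGm.aestronglyMeasurable hGb
  have hηL : ∀ n, MemLp (η n) 2 (volume.restrict Ω) := fun n =>
    memLp_two_of_bounded hvol (hηl n).continuous.aestronglyMeasurable (hηM n)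
  have hηgL : ∀ n, MemLp (gradient (η n)) 2 (volume.restrict Ω) := fun n =>
    memLp_two_of_bounded hvol (measurable_gradient _).aestronglyMeasurable (hηg n)
  refine ⟨G, ⟨hfL, hGL, fun i φ hφ => ?_⟩, fun δ hδ => ?_⟩
  · obtain ⟨D, hD1, hD2⟩ := hφ.exists_bound
    have hev : ∀ v : E d, Measurable fun v : E d => v i := fun _ =>
      (EuclideanSpace.proj (𝕜 := ℝ) i).continuous.measurable
    have t1 : Filter.Tendsto (fun n => ∫ x in Ω, η n x * gradient φ x i) Filter.atTop
        (nhds (∫ x in Ω, f x * gradient φ x i)) := by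
      refine tendsto_integral_of_dominated_convergence (fun _ => 6 * M * D)
        (fun n => (hηl n).continuous.aestronglyMeasurable.mul
          ((hev 0).comp (measurable_gradient φ)).aestronglyMeasurable) (integrable_const _)
        (fun n => Filter.Eventually.of_forall fun x => ?_)
        (Filter.Eventually.of_forall fun x => (hlim1 x).mul_const _)
      rw [norm_mul]
      exact mul_le_mul (hηM n x) ((norm_apply_le _ i).trans (hD2 x)) (norm_nonneg _)
        ((norm_nonneg _).trans (hηM n x))
    have t2 : Filter.Tendsto (fun n => ∫ x in Ω, gradient (η n) x i * φ x) Filter.atTop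
        (nhds (∫ x in Ω, G x i * φ x)) := by
      refine tendsto_integral_of_dominated_convergence (fun _ => 6 * C * D)
        (fun n => ((hev 0).comp (measurable_gradient (η n))).aestronglyMeasurable.mul
          hφ.1.continuous.aestronglyMeasurable) (integrable_const _)
        (fun n => Filter.Eventually.of_forall fun x => ?_)
        (Filter.Eventually.of_forall fun x => ?_)
      · rw [norm_mul]
        exact mul_le_mul ((norm_apply_le _ i).trans (hηg n x)) (hD1 x) (norm_nonneg _)
          (by positivity)
      · exact ((((EuclideanSpace.proj (𝕜 := ℝ) i).continuous.tendsto _).comp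
          (hlim2 x))).mul_const _
    refine tendsto_nhds_unique t1 (t2.neg.congr fun n => ?_)
    exact (integral_mul_gradient (hηl n) hφ i).symm
  · have T1 := tendsto_l2Norm_zero (C := 6 * M) hvol
      (fun n => (hηl n).continuous.aestronglyMeasurable)
      hf.continuous.aestronglyMeasurable hηM
      (fun x => (hM x).trans (by nlinarith [(norm_nonneg (f x)).trans (hM x)]))
      (Filter.Eventually.of_forall hlim1)
    have T2 := tendsto_l2Norm_zero hvol
      (fun n => (measurable_gradient (η n)).aestronglyMeasurable)
      hGm.aestronglyMeasurable hηg hGb (Filter.Eventually.of_forall hlim2)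
    obtain ⟨n, hn1, hn2⟩ := ((T1.eventually (gt_mem_nhds (half_pos hδ))).and
      (T2.eventually (gt_mem_nhds (half_pos hδ)))).exists
    obtain ⟨φ, hφ, h1, h2⟩ := exists_isTestFunction_near hΩ hvol (hηl n) (hηc n) (htsΩ n)
      (half_pos hδ)
    obtain ⟨m1, m2⟩ := hφ.memLp hvol
    refine ⟨φ, hφ, ?_, ?_⟩
    · have := l2Norm_sub_le hfL (hηL n) m1
      linarith
    · have := l2Norm_sub_le hGL (hηgL n) m2
      linarith

/-- Fundamental lemma of the calculus of variations, component by component. It makes the arbitrary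
choice in `weakGrad` harmless. -/
theorem HasWeakGradient.ae_eq (hΩ : IsOpen Ω) (hvol : volume Ω ≠ ⊤) {v : E d → ℝ}
    {G G' : E d → E d} (h : HasWeakGradient Ω v G) (h' : HasWeakGradient Ω v G') :
    G =ᵐ[volume.restrict Ω] G' := by
  have hfin : IsFiniteMeasure (volume.restrict Ω) := ⟨by simpa using hvol.lt_top⟩
  have hint : ∀ {G : E d → E d}, MemLp G 2 (volume.restrict Ω) → ∀ i,
      IntegrableOn (fun x => G x i) Ω := fun hG i =>
    ((EuclideanSpace.proj (𝕜 := ℝ) i).integrable_comp (hG.integrable one_le_two))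
  have key : ∀ i, ∀ᵐ x, x ∈ Ω → G x i - G' x i = 0 := fun i => by
    refine hΩ.ae_eq_zero_of_integral_contDiff_smul_eq_zero
      ((hint h.2.1 i).sub (hint h'.2.1 i)).locallyIntegrableOn fun g hg hgc hgs => ?_
    have htest : IsTestFunction Ω g := ⟨hg, hgc, hgs⟩
    obtain ⟨D, hD, -⟩ := htest.exists_bound
    have e1 := h.2.2 i g htest
    have e2 := h'.2.2 i g htest
    rw [e1, neg_inj] at e2
    rw [← setIntegral_eq_integral_of_forall_compl_eq_zero (s := Ω)
      (fun x hx => by rw [htest.eq_zero hx, zero_smul])]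
    have e3 : ∀ x, g x • (G x i - G' x i) = G x i * g x - G' x i * g x := fun x => by
      rw [smul_eq_mul]; ring
    simp only [e3]
    rw [integral_sub, e2, sub_self]
    · exact (hint h.2.1 i).mul_bdd (c := D) hg.continuous.aestronglyMeasurable
        (Filter.Eventually.of_forall hD)
    · exact (hint h'.2.1 i).mul_bdd (c := D) hg.continuous.aestronglyMeasurable
        (Filter.Eventually.of_forall hD)
  rw [Filter.EventuallyEq, ae_restrict_iff' hΩ.measurableSet]
  filter_upwards [ae_all_iff.2 key] with x hx hxΩ
  ext i
  exact sub_eq_zero.1 (hx i hxΩ)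

theorem HasWeakGradient.weakGrad {v : E d → ℝ} {G : E d → E d} (h : HasWeakGradient Ω v G) :
    HasWeakGradient Ω v (weakGrad Ω v) := by
  have hex : ∃ G, HasWeakGradient Ω v G := ⟨G, h⟩
  rw [FVPoisson.weakGrad, dif_pos hex]
  exact hex.choose_spec

theorem MemH10.hasWeakGradient {v : E d → ℝ} (h : MemH10 Ω v) :
    HasWeakGradient Ω v (weakGrad Ω v) := h.choose_spec.1.weakGrad

/-- The weak gradient in the definition of `MemH10` is existential; uniqueness transfers the
approximation to `weakGrad`. -/
theorem MemH10.exists_near (hΩ : IsOpen Ω) (hvol : volume Ω ≠ ⊤) {v : E d → ℝ}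
    (h : MemH10 Ω v) {ε : ℝ} (hε : 0 < ε) : ∃ φ, IsTestFunction Ω φ ∧
      l2Norm Ω (fun x => v x - φ x) < ε ∧
      l2Norm Ω (fun x => weakGrad Ω v x - gradient φ x) < ε := by
  obtain ⟨G, hG, happ⟩ := h
  obtain ⟨φ, hφ, h1, h2⟩ := happ ε hε
  refine ⟨φ, hφ, h1, lt_of_le_of_lt (le_of_eq (l2Norm_congr ?_)) h2⟩
  filter_upwards [hG.weakGrad.ae_eq hΩ hvol hG] with x hx
  rw [hx]

theorem IsTestFunction.sub {φ ψ : E d → ℝ} (hφ : IsTestFunction Ω φ) (hψ : IsTestFunction Ω ψ) :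
    IsTestFunction Ω (fun x => φ x - ψ x) :=
  ⟨hφ.1.sub hψ.1, hφ.2.1.sub hψ.2.1, (tsupport_sub φ ψ).trans (Set.union_subset hφ.2.2 hψ.2.2)⟩

theorem HasWeakGradient.sub (hvol : volume Ω ≠ ⊤) {v w : E d → ℝ} {G H : E d → E d}
    (hv : HasWeakGradient Ω v G) (hw : HasWeakGradient Ω w H) :
    HasWeakGradient Ω (fun x => v x - w x) (fun x => G x - H x) := by
  have hfin : IsFiniteMeasure (volume.restrict Ω) := ⟨by simpa using hvol.lt_top⟩
  refine ⟨hv.1.sub hw.1, hv.2.1.sub hw.2.1, fun i φ hφ => ?_⟩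
  obtain ⟨D, hD1, hD2⟩ := hφ.exists_bound
  have hgi : Measurable fun x => gradient φ x i :=
    (EuclideanSpace.proj (𝕜 := ℝ) i).continuous.measurable.comp (measurable_gradient φ)
  have i1 : ∀ {v : E d → ℝ}, MemLp v 2 (volume.restrict Ω) →
      Integrable (fun x => v x * gradient φ x i) (volume.restrict Ω) := fun hv =>
    (hv.integrable one_le_two).mul_bdd (c := D) hgi.aestronglyMeasurable
      (Filter.Eventually.of_forall fun x => (norm_apply_le _ i).trans (hD2 x))
  have i2 : ∀ {G : E d → E d}, MemLp G 2 (volume.restrict Ω) →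
      Integrable (fun x => G x i * φ x) (volume.restrict Ω) := fun hG =>
    ((EuclideanSpace.proj (𝕜 := ℝ) i).integrable_comp (hG.integrable one_le_two)).mul_bdd (c := D)
      hφ.1.continuous.aestronglyMeasurable (Filter.Eventually.of_forall hD1)
  simp only [PiLp.sub_apply, sub_mul]
  rw [integral_sub (i1 hv.1) (i1 hw.1), integral_sub (i2 hv.2.1) (i2 hw.2.1), hv.2.2 i φ hφ,
    hw.2.2 i φ hφ]
  ring

theorem MemH10.sub (hΩ : IsOpen Ω) (hvol : volume Ω ≠ ⊤) {v w : E d → ℝ} (hv : MemH10 Ω v)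
    (hw : MemH10 Ω w) : MemH10 Ω (fun x => v x - w x) := by
  have gv := hv.hasWeakGradient
  have gw := hw.hasWeakGradient
  refine ⟨_, gv.sub hvol gw, fun ε hε => ?_⟩
  obtain ⟨φ, hφ, h1, h2⟩ := hv.exists_near hΩ hvol (half_pos hε)
  obtain ⟨ψ, hψ, h3, h4⟩ := hw.exists_near hΩ hvol (half_pos hε)
  obtain ⟨m1, m2⟩ := hφ.memLp hvol
  obtain ⟨m3, m4⟩ := hψ.memLp hvol
  have aux : ∀ {F : Type} [NormedAddCommGroup F] (a b : E d → F),
      MemLp a 2 (volume.restrict Ω) → MemLp b 2 (volume.restrict Ω) →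
      l2Norm Ω (fun x => a x - b x) ≤ l2Norm Ω a + l2Norm Ω b := fun a b ha hb => by
    have h := l2Norm_add_le ha hb.neg
    have e : l2Norm Ω (-b) = l2Norm Ω b := by simp [l2Norm]
    rw [e] at h
    simpa [sub_eq_add_neg] using h
  refine ⟨_, hφ.sub hψ, ?_, ?_⟩
  · have := aux (fun x => v x - φ x) (fun x => w x - ψ x) (gv.1.sub m1) (gw.1.sub m3)
    have e : ∀ x, v x - w x - (φ x - ψ x) = v x - φ x - (w x - ψ x) := fun x => by ring
    simp only [e]
    linarith
  · have := aux (fun x => weakGrad Ω v x - gradient φ x) (fun x => weakGrad Ω w x - gradient ψ x)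
      (gv.2.1.sub m2) (gw.2.1.sub m4)
    have e : ∀ x, weakGrad Ω v x - weakGrad Ω w x - gradient (fun x => φ x - ψ x) x =
        weakGrad Ω v x - gradient φ x - (weakGrad Ω w x - gradient ψ x) := fun x => by
      have : gradient (fun x => φ x - ψ x) x = gradient φ x - gradient ψ x := by
        rw [gradient, gradient, gradient, ← map_sub]
        congr 1
        exact fderiv_sub (hφ.contDiff_one.differentiable one_ne_zero x)
          (hψ.contDiff_one.differentiable one_ne_zero x)
      rw [this]; abel
    simp only [e]
    linarith

theorem MemH10.congr {v w : E d → ℝ} (h : MemH10 Ω v) (hΩ : MeasurableSet Ω)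
    (hvw : ∀ x ∈ Ω, v x = w x) : MemH10 Ω w := by
  obtain ⟨G, ⟨h1, h2, h3⟩, h4⟩ := h
  have hae : v =ᵐ[volume.restrict Ω] w := by
    filter_upwards [ae_restrict_mem hΩ] with x hx using hvw x hx
  refine ⟨G, ⟨h1.ae_eq hae, h2, fun i φ hφ => ?_⟩, fun ε hε => ?_⟩
  · rw [← h3 i φ hφ]
    exact integral_congr_ae (hae.mono fun x hx => by simp only; rw [hx])
  · obtain ⟨φ, hφ, h5, h6⟩ := h4 ε hε
    refine ⟨φ, hφ, lt_of_le_of_lt (le_of_eq (l2Norm_congr ?_)) h5, h6⟩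
    exact hae.mono fun x hx => by simp only; rw [hx]

end Sobolev


/-! ### Gluing Lipschitz pieces; the averaged potential is in `H¹₀`. -/

section Cover

/-- A function that is Lipschitz on each of finitely many closed sets covering an interval is
Lipschitz on the interval. -/
theorem abs_sub_le_of_closed_cover {g : ℝ → ℝ} {C b : ℝ} (n : ℕ) : ∀ (S : Finset (Set ℝ)) (a : ℝ),
    S.card = n → a ≤ b → (∀ A ∈ S, IsClosed A) →
    (∀ A ∈ S, ∀ x ∈ A, ∀ y ∈ A, x ≤ y → |g y - g x| ≤ C * (y - x)) →
    Set.Icc a b ⊆ (⋃ A ∈ S, A) → |g b - g a| ≤ C * (b - a) := by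
  classical
  induction n with
  | zero =>
    intro S a hn hab _ _ hc
    rw [Finset.card_eq_zero.1 hn] at hc
    simpa using hc (Set.left_mem_Icc.2 hab)
  | succ n ih =>
    intro S a hn hab hcl hg hc
    obtain ⟨A, hA, haA⟩ : ∃ A ∈ S, a ∈ A := by simpa using hc (Set.left_mem_Icc.2 hab)
    have hcpt : IsCompact (A ∩ Set.Icc a b) := isCompact_Icc.inter_left (hcl A hA)
    -- With `t` the last point of `A`, the other sets cover `(t, b]`, hence also `[t, b]` as they
    -- are closed, and `A` can be dropped.
    obtain ⟨t, ⟨htA, hat, htb⟩, hmax⟩ :=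
      hcpt.exists_isGreatest ⟨a, haA, Set.left_mem_Icc.2 hab⟩
    have h1 := hg A hA a haA t htA hat
    rcases htb.eq_or_lt with rfl | htb'
    · exact h1
    have hclosed : IsClosed (⋃ B ∈ S.erase A, B) :=
      (S.erase A).finite_toSet.isClosed_biUnion fun B hB => hcl B (Finset.mem_of_mem_erase hB)
    have hcov : Set.Icc t b ⊆ ⋃ B ∈ S.erase A, B := by
      rw [← closure_Ioc htb'.ne]
      refine closure_minimal (fun x hx => ?_) hclosed
      have hxI : x ∈ Set.Icc a b := ⟨hat.trans hx.1.le, hx.2⟩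
      obtain ⟨B, hB, hxB⟩ : ∃ B ∈ S, x ∈ B := by simpa using hc hxI
      refine Set.mem_biUnion (Finset.mem_erase.2 ⟨?_, hB⟩) hxB
      rintro rfl
      exact absurd (hmax ⟨hxB, hxI⟩) (not_le.2 hx.1)
    have h2 := ih (S.erase A) t (by rw [Finset.card_erase_of_mem hA, hn]; rfl) htb
      (fun B hB => hcl B (Finset.mem_of_mem_erase hB))
      (fun B hB => hg B (Finset.mem_of_mem_erase hB)) hcov
    calc |g b - g a| ≤ |g b - g t| + |g t - g a| := abs_sub_le _ _ _
      _ ≤ C * (b - t) + C * (t - a) := add_le_add h2 h1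
      _ = C * (b - a) := by ring

variable {V : Type*} [NormedAddCommGroup V] [NormedSpace ℝ V]

/-- Reduction to an interval by restriction to the segment between the two points. No convexity of
the pieces is needed, since the one-dimensional lemma allows arbitrary closed sets. -/
theorem lipschitzWith_of_closed_cover (S : Finset (Set V)) (hcl : ∀ A ∈ S, IsClosed A)
    (hc : (⋃ A ∈ S, A) = Set.univ) {f : V → ℝ} {C : NNReal}
    (hf : ∀ A ∈ S, LipschitzOnWith C f A) : LipschitzWith C f := by
  classical
  refine LipschitzWith.of_dist_le_mul fun y x => ?_
  set l : ℝ → V := fun t => AffineMap.lineMap x y t with hl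
  have hlc : Continuous l := AffineMap.lineMap_continuous
  have key := abs_sub_le_of_closed_cover (g := fun t => f (l t)) (C := C * dist x y) (b := 1) _
    (S.image fun A => l ⁻¹' A) 0 rfl zero_le_one ?_ ?_ ?_
  · simpa [hl, Real.dist_eq, dist_comm x y] using key
  · intro B hB
    obtain ⟨A, hA, rfl⟩ := Finset.mem_image.1 hB
    exact (hcl A hA).preimage hlc
  · intro B hB r hr t ht hrt
    obtain ⟨A, hA, rfl⟩ := Finset.mem_image.1 hB
    have := (hf A hA).dist_le_mul _ ht _ hr
    rw [dist_lineMap_lineMap, Real.dist_eq, Real.dist_eq, abs_of_nonneg (sub_nonneg.2 hrt)] at this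
    exact this.trans (le_of_eq (by ring))
  · intro t _
    have : l t ∈ ⋃ A ∈ S, A := hc ▸ Set.mem_univ _
    obtain ⟨A, hA, h⟩ : ∃ A ∈ S, l t ∈ A := by simpa using this
    exact Set.mem_biUnion (Finset.mem_image_of_mem _ hA) h

end Cover

variable {d : ℕ} {Ω : Set (E d)}

theorem contDiff_polyFun (r : MvPolynomial (Fin d) ℝ) : ContDiff ℝ 1 (polyFun r) := by
  have h : polyFun r = fun x : E d => ∑ m ∈ r.support, r.coeff m * ∏ i, x i ^ m i := by
    ext x; rw [polyFun, MvPolynomial.eval_eq']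
  rw [h]
  fun_prop

/-- Extension by zero outside `Ω` agrees with the element polynomial on each closed element, because
`s` vanishes on the boundary. The complement of `Ω` serves as one more closed piece, and the sum of
the local constants serves for all pieces. -/
theorem IsPotentialReconstruction.memH10 (hd : 1 ≤ d) (hΩ : IsLipschitzDomain Ω)
    {T : SimplicialMesh Ω} {q : Finset (E d) → MvPolynomial (Fin d) ℝ} {s : E d → ℝ}
    (hs : IsPotentialReconstruction T q s) : MemH10 Ω s := by
  classical
  have h0 : ∀ x ∉ Ω, Ω.indicator s x = 0 := fun x hx => Set.indicator_of_notMem hx s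
  have hcell : ∀ K ∈ T.elems, ∃ C : NNReal, LipschitzOnWith C (Ω.indicator s) (cell K) := by
    intro K hK
    obtain ⟨r, -, hr⟩ := hs.piecewise_quadratic K hK
    obtain ⟨C, hC⟩ := (contDiff_polyFun r).contDiffOn.exists_lipschitzOnWith one_ne_zero
      (convex_cell K) (isCompact_cell K)
    refine ⟨C, fun x hx y hy => ?_⟩
    have e : ∀ x ∈ cell K, Ω.indicator s x = polyFun r x := fun x hx => by
      by_cases hxΩ : x ∈ Ω
      · rw [Set.indicator_of_mem hxΩ, hr x hx]
      · rw [h0 x hxΩ, ← hr x hx]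
        refine (hs.eq_zero_of_mem_frontier hd hΩ ?_).symm
        rw [frontier, hΩ.isOpen.interior_eq]
        exact ⟨T.cell_subset hK hx, hxΩ⟩
    rw [e x hx, e y hy]
    exact hC hx hy
  choose! C hC using hcell
  have hlip : LipschitzWith (∑ K ∈ T.elems, C K) (Ω.indicator s) := by
    refine lipschitzWith_of_closed_cover (insert Ωᶜ (T.elems.image cell)) ?_ ?_ ?_
    · intro A hA
      rcases Finset.mem_insert.1 hA with rfl | hA
      · exact hΩ.isOpen.isClosed_compl
      · obtain ⟨K, -, rfl⟩ := Finset.mem_image.1 hA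
        exact isClosed_cell K
    · refine Set.eq_univ_of_forall fun x => ?_
      by_cases hx : x ∈ Ω
      · obtain ⟨K, hK, hxK⟩ := T.exists_mem_cell (subset_closure hx)
        exact Set.mem_biUnion (Finset.mem_insert_of_mem (Finset.mem_image_of_mem _ hK)) hxK
      · exact Set.mem_biUnion (Finset.mem_insert_self _ _) hx
    · intro A hA
      rcases Finset.mem_insert.1 hA with rfl | hA
      · intro x hx y hy
        rw [h0 x hx, h0 y hy]; simp
      · obtain ⟨K, hK, rfl⟩ := Finset.mem_image.1 hA
        exact (hC K hK).weaken (Finset.single_le_sum (fun _ _ => zero_le) hK)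
  exact (memH10_of_lipschitz hΩ.isOpen hΩ.isBounded hlip h0).congr hΩ.isOpen.measurableSet
    fun x hx => Set.indicator_of_mem hx s


/-! ### Elementwise integration; the element boundaries are null sets. -/

section Integration

variable {d : ℕ} {Ω : Set (E d)}

theorem interior_cell_ae_eq (K : Finset (E d)) : interior (cell K) =ᵐ[volume] cell K :=
  ae_eq_set.2 ⟨by rw [Set.sdiff_eq_empty.2 interior_subset, measure_empty],
    volume_cell_diff_interior K⟩

theorem SimplicialMesh.restrict_cell_le (T : SimplicialMesh Ω) (hΩ : IsLipschitzDomain Ω)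
    {K : Finset (E d)} (hK : K ∈ T.elems) :
    volume.restrict (cell K) ≤ volume.restrict Ω := by
  rw [← Measure.restrict_congr_set (interior_cell_ae_eq K)]
  exact Measure.restrict_mono (T.interior_cell_subset hΩ hK) le_rfl

theorem SimplicialMesh.ae_eq_iUnion (T : SimplicialMesh Ω) (hΩ : IsLipschitzDomain Ω) :
    (⋃ K ∈ T.elems, interior (cell K)) =ᵐ[volume] Ω := by
  refine ae_eq_set.2 ⟨?_, ?_⟩
  · have h : (⋃ K ∈ T.elems, interior (cell K)) ⊆ Ω :=
      Set.iUnion₂_subset fun K hK => T.interior_cell_subset hΩ hK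
    rw [Set.sdiff_eq_empty.2 h, measure_empty]
  · refine measure_mono_null (t := ⋃ K ∈ T.elems, cell K \ interior (cell K)) (fun x hx => ?_)
      ((measure_biUnion_null_iff T.elems.countable_toSet).2 fun K _ => volume_cell_diff_interior K)
    obtain ⟨K, hK, hxK⟩ := T.exists_mem_cell (subset_closure hx.1)
    exact Set.mem_biUnion hK ⟨hxK, fun h => hx.2 (Set.mem_biUnion hK h)⟩

theorem SimplicialMesh.setIntegral_eq_sum (T : SimplicialMesh Ω) (hΩ : IsLipschitzDomain Ω)
    {F : E d → ℝ} (hF : Integrable F (volume.restrict Ω)) :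
    ∫ x in Ω, F x = ∑ K ∈ T.elems, ∫ x in cell K, F x := by
  rw [← setIntegral_congr_set (T.ae_eq_iUnion hΩ), integral_biUnion_finset]
  · exact Finset.sum_congr rfl fun K _ => setIntegral_congr_set (interior_cell_ae_eq K)
  · exact fun K _ => isOpen_interior.measurableSet
  · exact fun K hK L hL hne => T.disjoint_interior hK hL hne
  · exact fun K hK => hF.mono_measure
      (Measure.restrict_mono (T.interior_cell_subset hΩ hK) le_rfl)

theorem ae_mem_interior_cell (K : Finset (E d)) :
    ∀ᵐ x ∂volume.restrict (cell K), x ∈ interior (cell K) := by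
  rw [← Measure.restrict_congr_set (interior_cell_ae_eq K)]
  exact ae_restrict_mem isOpen_interior.measurableSet

theorem SimplicialMesh.sum_indicator_eq (T : SimplicialMesh Ω) {F : Type*} [AddCommMonoid F]
    (g : Finset (E d) → E d → F) {K : Finset (E d)} (hK : K ∈ T.elems) {x : E d}
    (hx : x ∈ interior (cell K)) :
    ∑ L ∈ T.elems, (interior (cell L)).indicator (g L) x = g K x := by
  rw [Finset.sum_eq_single_of_mem K hK, Set.indicator_of_mem hx]
  intro L hL hne
  exact Set.indicator_of_notMem
    (Set.disjoint_left.1 (T.disjoint_interior hK hL hne.symm) hx) _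

theorem memLp_two_of_continuous {F : Type*} [NormedAddCommGroup F] {S : Set (E d)}
    (hS : Bornology.IsBounded S) {v : E d → F} (hv : Continuous v) :
    MemLp v 2 (volume.restrict S) := by
  obtain ⟨C, hC⟩ := hS.isCompact_closure.exists_bound_of_continuousOn hv.continuousOn
  have hfin : IsFiniteMeasure (volume.restrict (closure S)) :=
    ⟨by simpa using hS.isCompact_closure.measure_lt_top⟩
  have h : MemLp v 2 (volume.restrict (closure S)) :=
    MemLp.of_bound (hv.aestronglyMeasurable) C
      ((ae_restrict_mem isClosed_closure.measurableSet).mono hC)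
  exact h.mono_measure (Measure.restrict_mono subset_closure le_rfl)

theorem SimplicialMesh.memLp_sum_indicator (T : SimplicialMesh Ω) (hΩ : Bornology.IsBounded Ω)
    {F : Type*} [NormedAddCommGroup F] {g : Finset (E d) → E d → F} (hg : ∀ K, Continuous (g K)) :
    MemLp (fun x => ∑ K ∈ T.elems, (interior (cell K)).indicator (g K) x) 2
      (volume.restrict Ω) :=
  memLp_finsetSum _ fun K _ =>
    (memLp_two_of_continuous hΩ (hg K)).indicator isOpen_interior.measurableSet

theorem continuous_elementFlux (U : Finset (E d) → Finset (E d) → ℝ) (K : Finset (E d)) :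
    Continuous (elementFlux U K) := by
  unfold elementFlux rtBasis
  fun_prop

end Integration

/-! ### Cancellation of the face fluxes. -/

section Cancellation

variable {d : ℕ} {Ω : Set (E d)} {T : SimplicialMesh Ω}

theorem orientedDist_swap (x y v : E d) : orientedDist y x (-v) = orientedDist x y v := by
  have : inner ℝ (x - y) (-v) = inner ℝ (y - x) v := by
    rw [← neg_sub y x, inner_neg_neg]
  rw [orientedDist, orientedDist, this, dist_comm]

/-- Exchanging `K` and `L` reverses the difference of the cell values, while the face measure and
the oriented distance are symmetric. -/
theorem IsFiniteVolumeSolution.antisymm {P : AdmissiblePoints T} {f : E d → ℝ}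
    {pK : Finset (E d) → ℝ} {U : Finset (E d) → Finset (E d) → ℝ}
    (h : IsFiniteVolumeSolution T P f pK U) {K L : Finset (E d)} {a b : E d}
    (hKL : T.IsInteriorFace K L a b) :
    U K (open Classical in K.erase a) + U L (open Classical in L.erase b) = 0 := by
  have hLK : T.IsInteriorFace L K b a :=
    ⟨hKL.2.1, hKL.1, hKL.2.2.1.symm, hKL.2.2.2.2.1, hKL.2.2.2.1, hKL.2.2.2.2.2.symm⟩
  rw [h.flux_interior K L a b hKL, h.flux_interior L K b a hLK, hKL.2.2.2.2.2, ← neg_sub b a,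
    orientedDist_swap]
  ring

/-- For two terms this is the hypothesis; for more, all terms are forced to vanish. So it need not
be shown that at most two elements share a face. -/
theorem sum_eq_zero_of_pairwise_add_eq_zero {ι : Type*} {s : Finset ι} {g : ι → ℝ}
    (hs : 1 < s.card) (h : ∀ i ∈ s, ∀ j ∈ s, i ≠ j → g i + g j = 0) : ∑ i ∈ s, g i = 0 := by
  classical
  have h1 : ∀ i ∈ s, ((s.card : ℝ) - 2) * g i + ∑ j ∈ s, g j = 0 := by
    intro i hi
    have h2 : ∑ j ∈ s.erase i, (g i + g j) = 0 := Finset.sum_eq_zero fun j hj =>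
      h i hi j (Finset.mem_of_mem_erase hj) (Finset.ne_of_mem_erase hj).symm
    rw [Finset.sum_add_distrib, Finset.sum_const, Finset.card_erase_of_mem hi, nsmul_eq_mul,
      Nat.cast_sub (by omega), Nat.cast_one] at h2
    rw [← Finset.add_sum_erase s g hi]
    linarith
  have h2 := Finset.sum_eq_zero h1
  rw [Finset.sum_add_distrib, ← Finset.mul_sum, Finset.sum_const, nsmul_eq_mul, ← add_mul] at h2
  have h3 : (1 : ℝ) < s.card := by exact_mod_cast hs
  exact (mul_eq_zero.1 h2).resolve_left (by linarith)

/-- The fluxes through the faces cancel when tested with a function of the face that vanishes on the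
unshared faces. -/
theorem IsFiniteVolumeSolution.sum_flux_mul_eq_zero {P : AdmissiblePoints T} {f : E d → ℝ}
    {pK : Finset (E d) → ℝ} {U : Finset (E d) → Finset (E d) → ℝ}
    (h : IsFiniteVolumeSolution T P f pK U) (J : Finset (E d) → ℝ)
    (hJ : ∀ K a, T.IsUnsharedFace K a → J (open Classical in K.erase a) = 0) :
    ∑ K ∈ T.elems, ∑ a ∈ K, U K (open Classical in K.erase a) *
      J (open Classical in K.erase a) = 0 := by
  classical
  rw [Finset.sum_sigma']
  set I := T.elems.sigma fun K => K with hI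
  -- The pairs (element, opposite vertex) are grouped by their face. A group with several pairs
  -- cancels by `antisymm`. A single pair means an unshared face: an element that contains all
  -- vertices of the face has just one more vertex, and so would give a second pair.
  rw [← Finset.sum_fiberwise_of_maps_to (s := I) (t := I.image fun z => z.1.erase z.2)
    (g := fun z => z.1.erase z.2) (fun z hz => Finset.mem_image_of_mem _ hz)]
  refine Finset.sum_eq_zero fun σ hσ => ?_
  have hfib : ∀ z ∈ I.filter (fun z => z.1.erase z.2 = σ), U z.1 (z.1.erase z.2) *
      J (z.1.erase z.2) = U z.1 (z.1.erase z.2) * J σ := fun z hz => by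
    rw [(Finset.mem_filter.1 hz).2]
  rw [Finset.sum_congr rfl hfib, ← Finset.sum_mul]
  obtain ⟨⟨K, a⟩, hz, rfl⟩ := Finset.mem_image.1 hσ
  obtain ⟨hK, ha⟩ : K ∈ T.elems ∧ a ∈ K := by simpa [hI] using hz
  rcases Nat.lt_or_ge 1 (I.filter (fun z => z.1.erase z.2 = K.erase a)).card with hc | hc
  · rw [sum_eq_zero_of_pairwise_add_eq_zero hc, zero_mul]
    rintro ⟨L, b⟩ hL ⟨M, c⟩ hM hne
    simp only [hI, Finset.mem_filter, Finset.mem_sigma] at hL hM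
    have hLM : L.erase b = M.erase c := hL.2.trans hM.2.symm
    refine h.antisymm ⟨hL.1.1, hM.1.1, ?_, hL.1.2, hM.1.2, hLM⟩
    rintro rfl
    refine hne ?_
    rw [(Finset.erase_inj L hL.1.2).1 hLM]
  · rw [hJ K a ⟨hK, ha, fun L hL hne hsub => ?_⟩, mul_zero]
    have hcard : (K.erase a).card + 1 = L.card := by
      rw [Finset.card_erase_add_one ha, T.card_eq K hK, T.card_eq L hL]
    obtain ⟨b, hb, hbL⟩ : ∃ b ∉ K.erase a, insert b (K.erase a) = L := by
      have : K.erase a ⋖ L := by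
        rw [Finset.covBy_iff_card_sdiff_eq_one]
        exact ⟨hsub, by rw [Finset.card_sdiff_of_subset hsub]; omega⟩
      obtain ⟨b, hb, e⟩ := Finset.covBy_iff_exists_insert.1 this
      exact ⟨b, hb, e⟩
    have m1 : (⟨K, a⟩ : (_ : Finset (E d)) × E d) ∈
        I.filter (fun z => z.1.erase z.2 = K.erase a) := Finset.mem_filter.2 ⟨hz, rfl⟩
    have m2 : (⟨L, b⟩ : (_ : Finset (E d)) × E d) ∈
        I.filter (fun z => z.1.erase z.2 = K.erase a) := by
      refine Finset.mem_filter.2 ⟨Finset.mem_sigma.2 ⟨hL, ?_⟩, ?_⟩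
      · rw [← hbL]; exact Finset.mem_insert_self _ _
      · rw [← hbL]; exact Finset.erase_insert hb
    have := Finset.card_le_one.1 hc _ m1 _ m2
    exact hne (congrArg Sigma.fst this).symm

end Cancellation

/-! ### The divergence of the reconstructed flux. -/

section Divergence

variable {n : ℕ}

/-- The mean value of `φ` on the face with the given `n + 1` vertices. -/
noncomputable def faceMean (φ : E (n + 1) → ℝ) (σ : Finset (E (n + 1))) : ℝ :=
  if h : σ.card = n + 1 then
    -- The ordering of the vertices is chosen from `σ` alone, so all elements with the face `σ` get
    -- the same value and invariance under reordering is not needed.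
    ∫ y, φ (simplexChart (exists_vertices σ h).choose y) ∂cornerMeasure n
  else 0

theorem faceMean_eq_zero {φ : E (n + 1) → ℝ} {σ : Finset (E (n + 1))}
    (h0 : ∀ x ∈ cell σ, φ x = 0) : faceMean φ σ = 0 := by
  rw [faceMean]
  split_ifs with h
  · refine integral_eq_zero_of_ae ?_
    filter_upwards [ae_cornerMeasure_mem n] with y hy
    refine h0 _ ?_
    have e : cell σ = simplexChart (exists_vertices σ h).choose '' cornerSimplex n := by
      rw [image_simplexChart, (exists_vertices σ h).choose_spec.2, cell]
    rw [e]
    exact Set.mem_image_of_mem _ hy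
  · rfl

theorem integral_rtBasis_eq_faceMean {K : Finset (E (n + 1))} {a : E (n + 1)} (ha : a ∈ K)
    (hcard : K.card = n + 2) (hK : AffineIndependent ℝ ((↑) : K → E (n + 1)))
    {φ : E (n + 1) → ℝ} (hφ : ContDiff ℝ 1 φ) :
    ∫ x in cell K, inner ℝ (rtBasis K a x) (gradient φ x) =
      faceMean φ (open Classical in K.erase a) - cellMean K φ := by
  classical
  have h : (K.erase a).card = n + 1 := by rw [Finset.card_erase_of_mem ha, hcard]; rfl
  have hr := (exists_vertices (K.erase a) h).choose_spec.2
  have hr' : Set.range (addApex a (exists_vertices (K.erase a) h).choose) =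
      (K : Set (E (n + 1))) := by
    rw [range_addApex, hr, ← Finset.coe_insert, Finset.insert_erase ha]
  have hinj : Function.Injective (addApex a (exists_vertices (K.erase a) h).choose) := by
    have himg : Finset.univ.image (addApex a (exists_vertices (K.erase a) h).choose) = K := by
      apply Finset.coe_injective
      rw [Finset.coe_image, Finset.coe_univ, Set.image_univ, hr']
    rw [← Set.injOn_univ, ← Finset.coe_univ, ← Finset.card_image_iff, himg, hcard]
    simp
  have key := integral_rtBasis hK hinj hr' hφ
  have hb := (isCompact_cell K)
  have i1 : IntegrableOn (fun x => inner ℝ (rtBasis K a x) (gradient φ x)) (cell K) := by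
    refine ContinuousOn.integrableOn_compact hb (Continuous.continuousOn ?_)
    exact Continuous.inner (by unfold rtBasis; fun_prop) (continuous_gradient hφ)
  have i2 : IntegrableOn (fun x => φ x / volume.real (cell K)) (cell K) :=
    (hφ.continuous.div_const _).continuousOn.integrableOn_compact hb
  rw [integral_add i1 i2, integral_div] at key
  rw [faceMean, dif_pos h, ← key, cellMean]
  ring

theorem integral_elementFlux {K : Finset (E (n + 1))} (hcard : K.card = n + 2)
    (hK : AffineIndependent ℝ ((↑) : K → E (n + 1))) (U : Finset (E (n + 1)) → Finset (E (n + 1)) → ℝ)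
    {φ : E (n + 1) → ℝ} (hφ : ContDiff ℝ 1 φ) :
    ∫ x in cell K, inner ℝ (elementFlux U K x) (gradient φ x) =
      ∑ a ∈ K, U K (open Classical in K.erase a) * faceMean φ (open Classical in K.erase a) -
        (∑ a ∈ K, U K (open Classical in K.erase a)) * cellMean K φ := by
  classical
  have hi : ∀ a ∈ K, Integrable (fun x => U K (K.erase a) *
      inner ℝ (rtBasis K a x) (gradient φ x)) (volume.restrict (cell K)) := fun a _ => by
    refine Integrable.const_mul ?_ _
    refine ContinuousOn.integrableOn_compact (isCompact_cell K) (Continuous.continuousOn ?_)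
    exact Continuous.inner (by unfold rtBasis; fun_prop) (continuous_gradient hφ)
  simp only [elementFlux, sum_inner, real_inner_smul_left]
  rw [integral_finsetSum _ hi, Finset.sum_mul, ← Finset.sum_sub_distrib]
  refine Finset.sum_congr rfl fun a ha => ?_
  rw [integral_const_mul, integral_rtBasis_eq_faceMean ha hcard hK hφ, mul_sub]

end Divergence

section FluxReconstruction

variable {d : ℕ} {Ω : Set (E d)} {T : SimplicialMesh Ω}

theorem SimplicialMesh.memLp_fluxReconstruction (T : SimplicialMesh Ω)
    (hΩ : Bornology.IsBounded Ω) (U : Finset (E d) → Finset (E d) → ℝ) :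
    MemLp (fluxReconstruction T U) 2 (volume.restrict Ω) :=
  T.memLp_sum_indicator hΩ fun K => continuous_elementFlux U K

/-- On each element, the volume terms add up to the total flux times the mean of `φ`, and the
balance equation turns this into `f_K ∫_K φ`. The face terms cancel over the mesh, as `φ` vanishes
on the unshared faces. Hence the weak divergence is the piecewise mean of `f`. -/
theorem IsFiniteVolumeSolution.integral_fluxReconstruction (hd : 1 ≤ d) (hΩ : IsLipschitzDomain Ω)
    {P : AdmissiblePoints T} {f : E d → ℝ} {pK : Finset (E d) → ℝ}
    {U : Finset (E d) → Finset (E d) → ℝ} (h : IsFiniteVolumeSolution T P f pK U)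
    {φ : E d → ℝ} (hφ : IsTestFunction Ω φ) :
    ∫ x in Ω, inner ℝ (fluxReconstruction T U x) (gradient φ x) =
      -∑ K ∈ T.elems, cellMean K f * ∫ x in cell K, φ x := by
  obtain ⟨n, rfl⟩ := Nat.exists_eq_add_of_le' hd
  have hvol : volume Ω ≠ ⊤ := hΩ.isBounded.measure_lt_top.ne
  rw [T.setIntegral_eq_sum hΩ (integrable_inner (T.memLp_fluxReconstruction hΩ.isBounded U)
    (hφ.memLp hvol).2)]
  have h1 : ∀ K ∈ T.elems, ∫ x in cell K, inner ℝ (fluxReconstruction T U x) (gradient φ x) =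
      ∑ a ∈ K, U K (open Classical in K.erase a) * faceMean φ (open Classical in K.erase a) -
        cellMean K f * ∫ x in cell K, φ x := by
    intro K hK
    have e : (∫ x in cell K, f x) * cellMean K φ = cellMean K f * ∫ x in cell K, φ x := by
      rw [cellMean, cellMean]; ring
    rw [← e, ← h.balance K hK, ← integral_elementFlux (T.card_eq K hK) (T.affineIndependent K hK) U
      hφ.contDiff_one]
    refine integral_congr_ae ((ae_mem_interior_cell K).mono fun x hx => ?_)
    simp only [fluxReconstruction]
    rw [T.sum_indicator_eq _ hK hx]
  rw [Finset.sum_congr rfl h1, Finset.sum_sub_distrib, h.sum_flux_mul_eq_zero, zero_sub]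
  exact fun K a hKa => faceMean_eq_zero fun x hx => hφ.eq_zero (hKa.disjoint hd hΩ.isOpen hx)

theorem IsFiniteVolumeSolution.memHdiv (hd : 1 ≤ d) (hΩ : IsLipschitzDomain Ω)
    {P : AdmissiblePoints T} {f : E d → ℝ} {pK : Finset (E d) → ℝ}
    {U : Finset (E d) → Finset (E d) → ℝ} (h : IsFiniteVolumeSolution T P f pK U) :
    MemHdiv Ω (fluxReconstruction T U) := by
  have hvol : volume Ω ≠ ⊤ := hΩ.isBounded.measure_lt_top.ne
  have hw := T.memLp_sum_indicator hΩ.isBounded (g := fun K _ => cellMean K f)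
    fun K => continuous_const
  refine ⟨_, T.memLp_fluxReconstruction hΩ.isBounded U, hw, fun φ hφ => ?_⟩
  rw [h.integral_fluxReconstruction hd hΩ hφ, neg_inj]
  refine Eq.trans ?_ (T.setIntegral_eq_sum hΩ (hw.integrable_mul (hφ.memLp hvol).1)).symm
  refine Finset.sum_congr rfl fun K hK => ?_
  rw [← integral_const_mul]
  refine integral_congr_ae ((ae_mem_interior_cell K).mono fun x hx => ?_)
  simp only [Pi.mul_apply]
  rw [T.sum_indicator_eq _ hK hx]

end FluxReconstruction


/-! ### The residual bound and the error estimate. -/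

variable {d : ℕ} {Ω : Set (E d)}

theorem integrable_mul_of_memLp_two {S : Set (E d)} {v w : E d → ℝ}
    (hv : MemLp v 2 (volume.restrict S)) (hw : MemLp w 2 (volume.restrict S)) :
    Integrable (fun x => v x * w x) (volume.restrict S) :=
  hv.integrable_mul hw

theorem abs_integral_mul_le {S : Set (E d)} {v w : E d → ℝ}
    (hv : MemLp v 2 (volume.restrict S)) (hw : MemLp w 2 (volume.restrict S)) :
    |∫ x in S, v x * w x| ≤ l2Norm S v * l2Norm S w := by
  refine le_trans (le_of_eq ?_) (abs_integral_inner_le hv hw)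
  congr 2
  ext x
  simp [mul_comm]

theorem SimplicialMesh.l2Norm_sq_eq_sum (T : SimplicialMesh Ω) (hΩ : IsLipschitzDomain Ω)
    {F : Type*} [NormedAddCommGroup F] {v : E d → F} (hv : MemLp v 2 (volume.restrict Ω)) :
    l2Norm Ω v ^ 2 = ∑ K ∈ T.elems, l2Norm (cell K) v ^ 2 := by
  simp only [l2Norm_sq]
  refine T.setIntegral_eq_sum hΩ ?_
  exact hv.integrable_norm_pow two_ne_zero

/-- The data oscillation `{∑ (h_K / π)² ‖f - f_K‖²_K}^{1/2}`. -/
noncomputable def oscillation (T : SimplicialMesh Ω) (f : E d → ℝ) : ℝ :=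
  Real.sqrt (∑ K ∈ T.elems, Metric.diam (cell K) ^ 2 / Real.pi ^ 2 *
    l2Norm (cell K) (fun x => f x - cellMean K f) ^ 2)

theorem oscillation_nonneg (T : SimplicialMesh Ω) (f : E d → ℝ) : 0 ≤ oscillation T f :=
  Real.sqrt_nonneg _

theorem oscillation_sq (T : SimplicialMesh Ω) (f : E d → ℝ) :
    oscillation T f ^ 2 = ∑ K ∈ T.elems, Metric.diam (cell K) ^ 2 / Real.pi ^ 2 *
      l2Norm (cell K) (fun x => f x - cellMean K f) ^ 2 :=
  Real.sq_sqrt (Finset.sum_nonneg fun _ _ => by positivity)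

/-- The left-hand side is `(f - f_K, φ - φ_K)_K`, because each factor is orthogonal to constants;
Cauchy-Schwarz and the Poincaré inequality then apply. -/
theorem integral_mul_sub_cellMean_le (hd : 1 ≤ d) {K : Finset (E d)} (hcard : K.card = d + 1)
    (hK : AffineIndependent ℝ ((↑) : K → E d)) {f : E d → ℝ}
    (hf : MemLp f 2 (volume.restrict (cell K))) {φ : E d → ℝ} (hφ : ContDiff ℝ 1 φ) :
    (∫ x in cell K, f x * φ x) - cellMean K f * ∫ x in cell K, φ x ≤
      Metric.diam (cell K) / Real.pi * l2Norm (cell K) (fun x => f x - cellMean K f) *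
        l2Norm (cell K) (gradient φ) := by
  have hb : Bornology.IsBounded (cell K) := (isCompact_cell K).isBounded
  have hfin : IsFiniteMeasure (volume.restrict (cell K)) :=
    ⟨by simpa using hb.measure_lt_top⟩
  have hv := volume_real_cell_pos hcard hK
  have hm : ∀ v : E d → ℝ, ∫ x in cell K, v x = cellMean K v * volume.real (cell K) := fun v => by
    rw [cellMean, div_mul_cancel₀ _ hv.ne']
  have mf : MemLp (fun x => f x - cellMean K f) 2 (volume.restrict (cell K)) :=
    hf.sub (memLp_const _)
  have mφ := memLp_two_of_continuous hb hφ.continuous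
  have mφ' : MemLp (fun x => φ x - cellMean K φ) 2 (volume.restrict (cell K)) :=
    mφ.sub (memLp_const _)
  have e : (∫ x in cell K, f x * φ x) - cellMean K f * ∫ x in cell K, φ x =
      ∫ x in cell K, (f x - cellMean K f) * (φ x - cellMean K φ) := by
    have e1 : ∀ x, (f x - cellMean K f) * (φ x - cellMean K φ) =
        f x * φ x - cellMean K f * φ x - cellMean K φ * (f x - cellMean K f) := fun x => by ring
    have i1 := integrable_mul_of_memLp_two hf mφ
    have i2 := (mφ.integrable one_le_two).const_mul (cellMean K f)
    have i3 := (mf.integrable one_le_two).const_mul (cellMean K φ)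
    have i12 : Integrable (fun x => f x * φ x - cellMean K f * φ x)
      (volume.restrict (cell K)) := i1.sub i2
    simp only [e1]
    rw [integral_sub i12 i3, integral_sub i1 i2, integral_const_mul, integral_const_mul,
      integral_sub (hf.integrable one_le_two) (integrable_const _), hm f]
    simp [mul_comm]
  have hp : l2Norm (cell K) (fun x => φ x - cellMean K φ) ≤
      Metric.diam (cell K) / Real.pi * l2Norm (cell K) (gradient φ) := by
    refine abs_le_of_sq_le_sq' ?_ (mul_nonneg (div_nonneg Metric.diam_nonneg Real.pi_pos.le)
      (l2Norm_nonneg _ _)) |>.2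
    rw [mul_pow, l2Norm_sq, l2Norm_sq, div_pow]
    simpa using poincare_cell hd hcard hK hφ
  rw [e]
  calc _ ≤ l2Norm (cell K) (fun x => f x - cellMean K f) *
        l2Norm (cell K) (fun x => φ x - cellMean K φ) :=
      (le_abs_self _).trans (abs_integral_mul_le mf mφ')
    _ ≤ l2Norm (cell K) (fun x => f x - cellMean K f) *
        (Metric.diam (cell K) / Real.pi * l2Norm (cell K) (gradient φ)) :=
      mul_le_mul_of_nonneg_left hp (l2Norm_nonneg _ _)
    _ = _ := by ring

variable {T : SimplicialMesh Ω}

theorem IsFiniteVolumeSolution.residual_test_le (hd : 1 ≤ d) (hΩ : IsLipschitzDomain Ω)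
    {P : AdmissiblePoints T} {f : E d → ℝ} (hf : MemLp f 2 (volume.restrict Ω))
    {pK : Finset (E d) → ℝ} {U : Finset (E d) → Finset (E d) → ℝ}
    (h : IsFiniteVolumeSolution T P f pK U) {φ : E d → ℝ} (hφ : IsTestFunction Ω φ) :
    (∫ x in Ω, f x * φ x) + ∫ x in Ω, inner ℝ (fluxReconstruction T U x) (gradient φ x) ≤
      oscillation T f * l2Norm Ω (gradient φ) := by
  have hvol : volume Ω ≠ ⊤ := hΩ.isBounded.measure_lt_top.ne
  obtain ⟨m1, m2⟩ := hφ.memLp hvol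
  rw [h.integral_fluxReconstruction hd hΩ hφ,
    T.setIntegral_eq_sum hΩ (integrable_mul_of_memLp_two hf m1), ← sub_eq_add_neg,
    ← Finset.sum_sub_distrib]
  refine (Finset.sum_le_sum fun K hK => integral_mul_sub_cellMean_le hd (T.card_eq K hK)
    (T.affineIndependent K hK) (hf.mono_measure (T.restrict_cell_le hΩ hK))
    hφ.contDiff_one).trans ?_
  refine (Real.sum_mul_le_sqrt_mul_sqrt _ _ _).trans (le_of_eq ?_)
  rw [← T.l2Norm_sq_eq_sum hΩ m2, Real.sqrt_sq (l2Norm_nonneg _ _)]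
  simp only [oscillation, mul_pow, div_pow]

/-- Both sides are continuous in `v` for the `H¹` norm, so the bound extends from test functions by
density. -/
theorem IsFiniteVolumeSolution.residual_le (hd : 1 ≤ d) (hΩ : IsLipschitzDomain Ω)
    {P : AdmissiblePoints T} {f : E d → ℝ} (hf : MemLp f 2 (volume.restrict Ω))
    {pK : Finset (E d) → ℝ} {U : Finset (E d) → Finset (E d) → ℝ}
    (h : IsFiniteVolumeSolution T P f pK U) {v : E d → ℝ} (hv : MemH10 Ω v) :
    (∫ x in Ω, f x * v x) + ∫ x in Ω, inner ℝ (fluxReconstruction T U x) (weakGrad Ω v x) ≤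
      oscillation T f * l2Norm Ω (weakGrad Ω v) := by
  have hvol : volume Ω ≠ ⊤ := hΩ.isBounded.measure_lt_top.ne
  obtain ⟨mv, mG, -⟩ := hv.hasWeakGradient
  have mu := T.memLp_fluxReconstruction hΩ.isBounded U
  -- `c` collects the factors of the three approximation errors; the tolerance `δ / (c + 1)` keeps
  -- their sum below `δ`, also when `c = 0`.
  set c := l2Norm Ω f + l2Norm Ω (fluxReconstruction T U) + oscillation T f with hc
  have hf0 := l2Norm_nonneg Ω f
  have hu0 := l2Norm_nonneg Ω (fluxReconstruction T U)
  have ho0 := oscillation_nonneg T f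
  have hc0 : 0 ≤ c := by positivity
  refine le_of_forall_pos_le_add fun δ hδ => ?_
  have hε : 0 < δ / (c + 1) := by positivity
  have hεδ : δ / (c + 1) * c ≤ δ := by
    rw [div_mul_eq_mul_div, div_le_iff₀ (by positivity)]
    nlinarith
  obtain ⟨φ, hφ, h1, h2⟩ := hv.exists_near hΩ.isOpen hvol hε
  set ε := δ / (c + 1)
  obtain ⟨m1, m2⟩ := hφ.memLp hvol
  have t0 := h.residual_test_le hd hΩ hf hφ
  have t1 := (le_abs_self _).trans (abs_integral_mul_le hf (mv.sub m1))
  have t2 := (le_abs_self _).trans (abs_integral_inner_le mu (mG.sub m2))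
  simp only [Pi.sub_apply, mul_sub, inner_sub_right] at t1 t2
  rw [integral_sub (integrable_mul_of_memLp_two hf mv) (integrable_mul_of_memLp_two hf m1)] at t1
  rw [integral_sub (integrable_inner mu mG) (integrable_inner mu m2)] at t2
  have t3 : l2Norm Ω (gradient φ) ≤ l2Norm Ω (weakGrad Ω v) +
      l2Norm Ω (fun x => weakGrad Ω v x - gradient φ x) := by
    have h3 := l2Norm_add_le mG (mG.sub m2).neg
    have e1 : l2Norm Ω (-(weakGrad Ω v - gradient φ)) =
        l2Norm Ω (fun x => weakGrad Ω v x - gradient φ x) := by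
      simp only [l2Norm, Pi.neg_apply, norm_neg, Pi.sub_apply]
    rw [e1] at h3
    simpa using h3
  have t4 := mul_le_mul_of_nonneg_left (t3.trans (add_le_add_right h2.le _)) ho0
  have t5 := t1.trans (mul_le_mul_of_nonneg_left h1.le hf0)
  have t6 := t2.trans (mul_le_mul_of_nonneg_left h2.le hu0)
  have e : δ / (c + 1) * c = l2Norm Ω f * ε + l2Norm Ω (fluxReconstruction T U) * ε +
      oscillation T f * ε := by rw [hc]; ring
  rw [e] at hεδ
  linarith

/-- The guaranteed bound for a reconstructed flux and any potential in `H¹₀`. -/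
theorem IsFiniteVolumeSolution.error_sq_le (hd : 1 ≤ d) (hΩ : IsLipschitzDomain Ω)
    {P : AdmissiblePoints T} {f : E d → ℝ} (hf : MemLp f 2 (volume.restrict Ω))
    {pK : Finset (E d) → ℝ} {U : Finset (E d) → Finset (E d) → ℝ}
    (h : IsFiniteVolumeSolution T P f pK U) {p s : E d → ℝ} (hp : IsWeakSolution Ω f p)
    (hs : MemH10 Ω s) :
    l2Norm Ω (fun x => -weakGrad Ω p x - fluxReconstruction T U x) ^ 2 ≤
      l2Norm Ω (fun x => fluxReconstruction T U x + weakGrad Ω s x) ^ 2 +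
        oscillation T f ^ 2 := by
  have hvol : volume Ω ≠ ⊤ := hΩ.isBounded.measure_lt_top.ne
  have gp := hp.1.hasWeakGradient
  have gs := hs.hasWeakGradient
  have hw := hp.1.sub hΩ.isOpen hvol hs
  have gw := hw.hasWeakGradient
  have hae := gw.ae_eq hΩ.isOpen hvol (gp.sub hvol gs)
  have mu := T.memLp_fluxReconstruction hΩ.isBounded U
  set uh := fluxReconstruction T U
  set W := weakGrad Ω (fun x => p x - s x)
  set g : E d → E d := fun x => weakGrad Ω p x + uh x with hg
  have mg : MemLp g 2 (volume.restrict Ω) := gp.2.1.add mu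
  have e1 : l2Norm Ω (fun x => -weakGrad Ω p x - uh x) ^ 2 = ∫ x in Ω, ‖g x‖ ^ 2 := by
    rw [l2Norm_sq]
    congr 1
    ext x
    rw [← norm_neg, neg_sub, sub_neg_eq_add, add_comm]
  -- Here `u_h + ∇s = g - W`. This holds only almost everywhere, since `W` is the chosen weak
  -- gradient of `p - s`.
  have e2 : l2Norm Ω (fun x => uh x + weakGrad Ω s x) ^ 2 =
      (∫ x in Ω, ‖g x‖ ^ 2) - 2 * (∫ x in Ω, inner ℝ (g x) (W x)) + ∫ x in Ω, ‖W x‖ ^ 2 := by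
    have i1 := mg.integrable_norm_pow two_ne_zero
    have i2 := (integrable_inner mg gw.2.1).const_mul 2
    have i3 := gw.2.1.integrable_norm_pow two_ne_zero
    have i12 : Integrable (fun x => ‖g x‖ ^ 2 - 2 * inner ℝ (g x) (W x))
      (volume.restrict Ω) := i1.sub i2
    rw [l2Norm_sq, ← integral_const_mul, ← integral_sub i1 i2, ← integral_add i12 i3]
    refine integral_congr_ae (hae.mono fun x hx => ?_)
    simp only
    rw [← norm_sub_sq_real, hx]
    congr 2
    simp only [hg]
    abel
  have e3 : ∫ x in Ω, inner ℝ (g x) (W x) ≤ oscillation T f * l2Norm Ω W := by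
    have h1 := h.residual_le hd hΩ hf hw
    rw [← hp.2 _ hw] at h1
    refine le_trans (le_of_eq ?_) h1
    rw [← integral_add (integrable_inner gp.2.1 gw.2.1) (integrable_inner mu gw.2.1)]
    simp only [hg, inner_add_left]
  rw [e1, e2, ← l2Norm_sq Ω W]
  -- `2 osc ‖W‖ - ‖W‖² ≤ osc²`: the negative square kept from the expansion makes the two
  -- contributions add as squares.
  nlinarith [sq_nonneg (oscillation T f - l2Norm Ω W)]

end FVPoisson

theorem mainTheorem1 {d : ℕ} (hd : 1 ≤ d) (Ω : Set (FVPoisson.E d))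
    (hΩ : FVPoisson.IsLipschitzDomain Ω)
    (f : FVPoisson.E d → ℝ) (hf : MemLp f 2 (volume.restrict Ω))
    (p : FVPoisson.E d → ℝ) (hp : FVPoisson.IsWeakSolution Ω f p)
    (u : FVPoisson.E d → FVPoisson.E d) (hu : u = fun x => -FVPoisson.weakGrad Ω p x)
    (T : FVPoisson.SimplicialMesh Ω) (P : FVPoisson.AdmissiblePoints T)
    (pK : Finset (FVPoisson.E d) → ℝ)
    (U : Finset (FVPoisson.E d) → Finset (FVPoisson.E d) → ℝ)
    (hFV : FVPoisson.IsFiniteVolumeSolution T P f pK U)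
    (uh : FVPoisson.E d → FVPoisson.E d) (huh : uh = FVPoisson.fluxReconstruction T U)
    (q : Finset (FVPoisson.E d) → MvPolynomial (Fin d) ℝ)
    (hq : FVPoisson.IsPotentialPostprocessing T U pK q)
    (s : FVPoisson.E d → ℝ) (hs : FVPoisson.IsPotentialReconstruction T q s) :
    FVPoisson.MemHdiv Ω uh ∧ FVPoisson.MemH10 Ω s ∧
      FVPoisson.l2Norm Ω (fun x => u x - uh x) ≤
        Real.sqrt (∑ K ∈ T.elems, FVPoisson.estimatorSq Ω f uh s K) := by
  subst hu huh
  have hs1 := hs.memH10 hd hΩ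
  refine ⟨hFV.memHdiv hd hΩ, hs1, ?_⟩
  refine Real.le_sqrt_of_sq_le ((hFV.error_sq_le hd hΩ hf hp hs1).trans (le_of_eq ?_))
  rw [FVPoisson.oscillation_sq, T.l2Norm_sq_eq_sum hΩ, ← Finset.sum_add_distrib]
  · rfl
  · exact (T.memLp_fluxReconstruction hΩ.isBounded U).add hs1.hasWeakGradient.2.1
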